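/- **Setting.** Consider a limit order book on the price levels $1,\dots,N$ with initial best bid $p_B\ge 1$ and best ask $p_A\le N$, spread $s_0=p_A-p_B\ge 1$ and initial best queues of sizes $q_0^A,q_0^B\ge 1$. All orders have unit size. The best ask (bid) is the lowest (highest) level with outstanding sell (buy) orders, the mid-price is their average, and $\tau$ is the time of the first change of the mid-price. In a queue of size $k$ at level $l$, limit orders, market orders and cancellations have rates $\lambda_k(X_l)$, $\mu_k(X_l)$, $\phi_k(X_l)\ge 0$, where the state variables $X_l$ keep their initial values until the mid-price moves. (The rate $\lambda_k(X_l)$ may differ for buy and sell limit orders.) Assume that the total arrival rate inside the spread is the same for sell and for buy limit orders, $$\Lambda=\sum_{m=1}^{s_0-1}\lambda_0(X_{p_A-m})=\sum_{m=1}^{s_0-1}\lambda_0(X_{p_B+m}),$$ where the first sum refers to sell orders and the second to buy orders. At time $0$ a limit order that is never cancelled is the last order of the best queue of side $i\in\{A,B\}$; let $j\ne i$ be the other side. Up to and including the time $\tau$, the order flow is given by independent processes: the queue position of the order, a pure-death process started at $q_0^i$ with death rates $\mu_k(X_{p_i})+\phi_k(X_{p_i})$ (assumed positive for $1\le k\le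 q_0^i$); the opposite best queue, a non-explosive birth-death process started at $q_0^j$ with birth rates $\lambda_k(X_{p_j})$ and death rates $\mu_k(X_{p_j})+\phi_k(X_{p_j})$; and, for each side and each level $l$ inside the spread, arrivals of limit orders at rate $\lambda_0(X_l)$. Let $\epsilon_i$ and $\sigma_j\in(0,\infty]$ be the first-passage times to $0$ of the first two processes. The order is filled before the mid-price moves if $\epsilon_i<\infty$ and the mid-price does not change during $[0,\epsilon_i)$, i.e. $\epsilon_i\le\tau$ (the execution of the order may itself move the mid-price). **Proposition.** The times $\epsilon_i$ and $\sigma_j$ have densities $g$ and $f$ on $(0,\infty)$ (that of $\sigma_j$ being defective if $P(\sigma_j=\infty)>0$), with Laplace transforms $\hat g_{\epsilon_i}$ and $\hat f_{\sigma_j}$, and the following hold. 1. For all $s\in\mathbb C$ with $\operatorname{Re}s>-\min_{1\le k\le q_0^i}(\mu_k(X_{p_i})+\phi_k(X_{p_i}))$, the integral defining $\hat g_{\epsilon_i}(s)$ converges absolutely and $$\hat g_{\epsilon_i}(s)=\prod_{k=1}^{q_0^i}\frac{\mu_k(X_{p_i})+\phi_k(X_{p_i})}{\mu_k(X_{p_i})+\phi_k(X_{p_i})+s}.$$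 In what follows $\hat g_{\epsilon_i}$ denotes this rational function. 2. If $\lambda_k(X_{p_j})>0$ for $k\ge 0$ and $\mu_k(X_{p_j})+\phi_k(X_{p_j})>0$ for $k\ge1$, then, for every $s\in\mathbb C$ at which the integral defining $\hat f_{\sigma_j}(s)$ converges absolutely, the following continued fractions converge and $$\hat f_{\sigma_j}(s)=\prod_{m=1}^{q_0^j}\left(-\frac1{\lambda_{m-1}(X_{p_j})}\;\mathop{\mathrm K}_{k=m}^{\infty}\frac{-\lambda_{k-1}(X_{p_j})\,(\mu_k(X_{p_j})+\phi_k(X_{p_j}))}{\lambda_k(X_{p_j})+\mu_k(X_{p_j})+\phi_k(X_{p_j})+s}\right).$$ 3. Put $$\hat F(s)=\frac1s\,\hat g_{\epsilon_i}(s)\left(\hat f_{\sigma_j}(2\Lambda-s)+\frac{2\Lambda}{2\Lambda-s}\bigl(1-\hat f_{\sigma_j}(2\Lambda-s)\bigr)\right).$$ The probability that the order is filled before the mid-price moves is the value at $0$ of the inverse (two-sided) Laplace transform of $\hat F$: $$P\bigl(\epsilon_i<\infty,\ \epsilon_i\le\tau\bigr)=\frac1{2\pi \mathrm i}\int_{\gamma-\mathrm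 i\infty}^{\gamma+\mathrm i\infty}\hat F(s)\,ds ,$$ the integral being absolutely convergent, for every $\gamma>0$ such that either $\gamma<2\Lambda$, or $\gamma>2\Lambda$, $\sigma_j<\infty$ almost surely and $E[e^{(\gamma-2\Lambda)\sigma_j}]<\infty$. 4. If $s_0=1$, then $\Lambda=0$ and $\hat F(s)=\frac1s\,\hat g_{\epsilon_i}(s)\,\hat f_{\sigma_j}(-s)$. -/

import Mathlib

open MeasureTheory ProbabilityTheory Filter Topology
open scoped NNReal ENNReal

noncomputable section

/-! ### Birth-death processes -/

/-- The total jump rate in state `k` of the birth-death process on `ℕ` with birth rates `birth` and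
death rates `death`; no death occurs in state `0`. -/
def bdRate (birth death : ℕ → ℝ≥0) (k : ℕ) : ℝ :=
  birth k + if k = 0 then 0 else (death k : ℝ)

/-- The transition probabilities of the jump chain; a state of rate `0` is absorbing. -/
def bdJump (birth death : ℕ → ℝ≥0) (k l : ℕ) : ℝ :=
  if bdRate birth death k = 0 then (if l = k then 1 else 0)
  else if l = k + 1 then birth k / bdRate birth death k
  else if l + 1 = k then death k / bdRate birth death k
  else 0

/-- `X` is, under `P`, a (non-explosive, right-continuous) birth-death process with the given rates,
started in `x₀`: there are a jump chain `Y` and holding times `H` such that `Y` is a Markov chain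
with transition probabilities `bdJump`, given `Y` the holding times are independent and `H k` is
exponential with rate `bdRate (Y k)` (infinite if this rate is `0`), and `X` sits in `Y n` between
the time `H 0 + ⋯ + H (n-1)` of the `n`-th jump and that of the next one. -/
structure IsBirthDeath {Ω : Type*} [MeasurableSpace Ω] (P : Measure Ω) (X : ℝ≥0 → Ω → ℕ)
    (x₀ : ℕ) (birth death : ℕ → ℝ≥0) : Prop where
  measurable : ∀ t, Measurable (X t)
  jumpHold : ∃ (Y : ℕ → Ω → ℕ) (H : ℕ → Ω → ℝ≥0∞),
    (∀ n, Measurable (Y n)) ∧ (∀ n, Measurable (H n)) ∧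
    (∀ (n : ℕ) (y : ℕ → ℕ) (t : ℕ → ℝ≥0),
      P.real {ω | ∀ k ≤ n, Y k ω = y k ∧ (t k : ℝ≥0∞) < H k ω} =
        (if y 0 = x₀ then 1 else 0) *
          (∏ k ∈ Finset.range (n + 1), Real.exp (-(bdRate birth death (y k) * t k))) *
          ∏ k ∈ Finset.range n, bdJump birth death (y k) (y (k + 1))) ∧
    ∀ᵐ ω ∂P, ∀ t : ℝ≥0, ∃ n : ℕ,
      ∑ k ∈ Finset.range n, H k ω ≤ t ∧ (t : ℝ≥0∞) < ∑ k ∈ Finset.range (n + 1), H k ω ∧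
        X t ω = Y n ω

/-- The first-passage time to `0` (infinite if `0` is never reached). -/
def firstPassage {Ω : Type*} (X : ℝ≥0 → Ω → ℕ) (ω : Ω) : ℝ≥0∞ :=
  ⨅ (t : ℝ≥0) (_ : X t ω = 0), (t : ℝ≥0∞)

/-! ### The order book -/

/-- The two sides of the book. -/
inductive Side
  | ask
  | bid

/-- The opposite side. -/
def Side.opp : Side → Side
  | .ask => .bid
  | .bid => .ask

/-- Ask queues are counted positively, bid queues negatively. -/
def Side.sgn : Side → ℤ
  | .ask => 1
  | .bid => -1

/-- Best ask of a book `q` on the price levels `1, …, N`. -/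
def bestAsk (N : ℕ) (q : ℕ → ℤ) : ℕ :=
  sInf ({l | 1 ≤ l ∧ l ≤ N ∧ 0 < q l} ∪ {N + 1})

/-- Best bid of a book `q` on the price levels `1, …, N`. -/
def bestBid (N : ℕ) (q : ℕ → ℤ) : ℕ :=
  sSup ({l | 1 ≤ l ∧ l ≤ N ∧ q l < 0} ∪ {0})

/-- Mid-price. -/
def midPrice (N : ℕ) (q : ℕ → ℤ) : ℝ := ((bestBid N q : ℝ) + bestAsk N q) / 2

/-- Time of the first change of the mid-price (infinite if it never changes). -/
def midMoveTime {Ω : Type*} (N : ℕ) (Q : ℝ≥0 → Ω → ℕ → ℤ) (ω : Ω) : ℝ≥0∞ :=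
  ⨅ (t : ℝ≥0) (_ : midPrice N (Q t ω) ≠ midPrice N (Q 0 ω)), (t : ℝ≥0∞)

/-- The queues that decide about the first mid-price move of a book with best quotes `p`: the sell
queues at the levels in `(p bid, p ask]` and the buy queues at the levels in `[p bid, p ask)`. -/
def activeQueues (p : Side → ℕ) : Set (Side × ℕ) :=
  {x | p .bid ≤ x.2 ∧ x.2 ≤ p .ask ∧ x ≠ (.ask, p .bid) ∧ x ≠ (.bid, p .ask)}

/-- A limit order book `Q` on the levels `1, …, N` (`Q t ω l` is the signed queue at level `l`) into
which a limit order, never cancelled, has been put at time `0` at the best quote of side `i`, as the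
last order of its queue.

`p s` is the initial best quote and `q₀ s` the initial size of the best queue of side `s`. `X l` is
the value at time `0` of the state variables of level `l`; in a queue of size `k` at a level with
state variables `x`, limit orders of side `s` arrive at rate `lam s k x`, market orders at rate
`mu k x`, and cancellations at rate `phi k x`.

The state variables keep their values until the mid-price moves. Accordingly the order flow up to
this time is described by independent processes `Z s l`:
* `Z i (p i)`, the queue position of the order, which is a pure-death process (orders that arrive
  later join the queue behind it);
* `Z i.opp (p i.opp)`, the opposite best queue, which is a birth-death process;
* for `l` inside the spread, `Z s l`, the number of limit orders of side `s` that have been posted at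
  the empty level `l`, which is a Poisson process.
The book follows them up to and including the time of the first move (`follow`); it is not
restricted thereafter, nor at the levels outside the spread, except that it is right-continuous and
never crossed. -/
structure IsTaggedBook {Ω 𝒳 : Type*} [MeasurableSpace Ω] (P : Measure Ω) (X : ℕ → 𝒳)
    (lam : Side → ℕ → 𝒳 → ℝ≥0) (mu phi : ℕ → 𝒳 → ℝ≥0) (N : ℕ) (p q₀ : Side → ℕ) (i : Side)
    (Z : Side → ℕ → ℝ≥0 → Ω → ℕ) (Q : ℝ≥0 → Ω → ℕ → ℤ) : Prop where
  position : IsBirthDeath P (Z i (p i)) (q₀ i) (fun _ => 0)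
    (fun k => mu k (X (p i)) + phi k (X (p i)))
  opposite : IsBirthDeath P (Z i.opp (p i.opp)) (q₀ i.opp) (fun k => lam i.opp k (X (p i.opp)))
    (fun k => mu k (X (p i.opp)) + phi k (X (p i.opp)))
  inside : ∀ s l, p .bid < l → l < p .ask →
    IsBirthDeath P (Z s l) 0 (fun _ => lam s 0 (X l)) (fun _ => 0)
  indep : iIndepFun (fun (x : activeQueues p) (ω : Ω) (t : ℝ≥0) => Z x.1.1 x.1.2 t ω) P
  init : ∀ᵐ ω ∂P, bestAsk N (Q 0 ω) = p .ask ∧ bestBid N (Q 0 ω) = p .bid ∧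
    ∀ s, Q 0 ω (p s) = s.sgn * q₀ s
  rightCont : ∀ᵐ ω ∂P, ∀ l t, ∀ᶠ u in 𝓝[>] t, Q u ω l = Q t ω l
  uncrossed : ∀ᵐ ω ∂P, ∀ t, bestBid N (Q t ω) < bestAsk N (Q t ω)
  follow : ∀ᵐ ω ∂P, ∀ t, (∀ u < t, midPrice N (Q u ω) = midPrice N (Q 0 ω)) →
    (Z i (p i) t ω : ℤ) ≤ i.sgn * Q t ω (p i) ∧
    Q t ω (p i.opp) = i.opp.sgn * Z i.opp (p i.opp) t ω ∧
    ∀ l, p .bid < l → l < p .ask → Q t ω l = (Z .ask l t ω : ℤ) - Z .bid l t ω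

/-- The order is filled, and the mid-price does not move before it is. (If the order is the last one
in its queue when it is filled, then its execution itself moves the mid-price.) -/
def fillEvent {Ω : Type*} (N : ℕ) (p : Side → ℕ) (i : Side) (Z : Side → ℕ → ℝ≥0 → Ω → ℕ)
    (Q : ℝ≥0 → Ω → ℕ → ℤ) : Set Ω :=
  {ω | firstPassage (Z i (p i)) ω ≠ ⊤ ∧ firstPassage (Z i (p i)) ω ≤ midMoveTime N Q ω}

/-! ### Densities, Laplace transforms and continued fractions -/

/-- `f` is the density of the (possibly defective) law on `(0, ∞)` of the random time `T`. -/
structure IsDensity {Ω : Type*} [MeasurableSpace Ω] (P : Measure Ω) (T : Ω → ℝ≥0∞) (f : ℝ → ℝ) :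
    Prop where
  measurable : Measurable f
  nonneg : ∀ x, 0 ≤ f x
  eq : ∀ B : Set ℝ, MeasurableSet B →
    P {ω | T ω ≠ ⊤ ∧ (T ω).toReal ∈ B} = ∫⁻ x in B ∩ Set.Ioi 0, ENNReal.ofReal (f x)

/-- The integral defining the Laplace transform of `f` at `s` converges absolutely. -/
def LaplaceConverges (f : ℝ → ℝ) (s : ℂ) : Prop :=
  IntegrableOn (fun t : ℝ => Complex.exp (-s * t) * f t) (Set.Ioi 0)

/-- Laplace transform. -/
def laplace (f : ℝ → ℝ) (s : ℂ) : ℂ :=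
  ∫ t in Set.Ioi (0 : ℝ), Complex.exp (-s * t) * f t

/-- The inverse (two-sided) Laplace transform of `F` at `t`: the Bromwich integral
`(2πi)⁻¹ ∫ e^{st} F(s) ds` along the line `Re s = γ`, `s = γ + iu`. -/
def inverseLaplace (F : ℂ → ℂ) (γ t : ℝ) : ℂ :=
  (2 * Real.pi * Complex.I)⁻¹ *
    ∫ u : ℝ, Complex.exp ((γ + u * Complex.I) * t) * F (γ + u * Complex.I) * Complex.I

/-- The finite continued fraction `a_k / (b_k + a_{k+1} / (b_{k+1} + ⋯))` with `n` levels. -/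
def contFrac (a b : ℕ → ℂ) : ℕ → ℕ → ℂ
  | 0, _ => 0
  | n + 1, k => a k / (b k + contFrac a b n (k + 1))

/-- The transform `∏_{k=1}^{q} ν_k / (ν_k + s)`. -/
def deathTransform (ν : ℕ → ℝ≥0) (q : ℕ) (s : ℂ) : ℂ :=
  ∏ k ∈ Finset.Icc 1 q, ((ν k : ℝ) : ℂ) / (((ν k : ℝ) : ℂ) + s)

/-- The transform `s⁻¹ ĝ(s) (f̂(2Λ-s) + 2Λ/(2Λ-s) (1 - f̂(2Λ-s)))`. -/
def fillTransform (gHat fHat : ℂ → ℂ) (Λ : ℝ) (s : ℂ) : ℂ :=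
  1 / s * gHat s *
    (fHat (2 * Λ - s) + 2 * Λ / (2 * Λ - s) * (1 - fHat (2 * Λ - s)))

end

/-!
Until the mid-price moves, the book is driven by independent queues, so the order is filled in time
if and only if `ε`, the passage time to `0` of its queue position, is at most the minimum `M` of the
depletion time `σ` of the opposite queue and an exponential time of rate `2Λ`, the first arrival
inside the spread. Hence the fill probability is `∫ P(ε ≤ t) P(M ∈ dt)`. Inserting Bromwich
inversion of the distribution function of `ε`, whose transform `s⁻¹ ĝ(s)` is integrable on vertical
lines, and exchanging the integrals leaves `E[exp (s M)]`, which the tail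
`P(M > t) = P(σ > t) exp (-2Λt)` expresses through `f̂(2Λ - s)`.

A birth-death process is observed along its jumps: decomposing at the first jump, the first-passage
law is a sum, over the number of jumps, of convolutions of exponential laws, and its transform
solves the three-term recursion of the birth-death generator. The approximants of the continued
fraction are the ratios of the transforms for the process killed above a high level. The transform
at real `s` is a positive supersolution of the recursion, which bounds the real approximants; these
dominate the complex ones, and all converge to the ratios of the transforms of the process itself.
-/

noncomputable section

/-! ### Exponential laws -/

/-- The law on `[0, ∞]` of a holding time of rate `r`; a holding time of rate `0` is infinite. -/
def expLaw (r : ℝ) : Measure ℝ≥0∞ :=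
  if r = 0 then Measure.dirac ⊤ else (expMeasure r).map ENNReal.ofReal

lemma expLaw_zero : expLaw 0 = Measure.dirac ⊤ := if_pos rfl

lemma expLaw_of_ne {r : ℝ} (hr : r ≠ 0) : expLaw r = (expMeasure r).map ENNReal.ofReal :=
  if_neg hr

lemma isProbabilityMeasure_expLaw {r : ℝ} (hr : 0 ≤ r) : IsProbabilityMeasure (expLaw r) := by
  rcases hr.eq_or_lt with rfl | hr
  · rw [expLaw_zero]; infer_instance
  · have := isProbabilityMeasure_expMeasure hr
    rw [expLaw_of_ne hr.ne']
    exact Measure.isProbabilityMeasure_map ENNReal.measurable_ofReal.aemeasurable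

lemma expLaw_Ioi {r : ℝ} (hr : 0 ≤ r) (t : ℝ≥0) :
    expLaw r (Set.Ioi (t : ℝ≥0∞)) = ENNReal.ofReal (Real.exp (-(r * t))) := by
  rcases hr.eq_or_lt with rfl | hr
  · simp [expLaw_zero]
  · have := isProbabilityMeasure_expMeasure hr
    have hpre : ENNReal.ofReal ⁻¹' Set.Ioi (t : ℝ≥0∞) = (Set.Iic (t : ℝ))ᶜ := by
      ext x
      rw [Set.mem_preimage, Set.mem_Ioi, Set.compl_Iic, Set.mem_Ioi, ← ENNReal.ofReal_coe_nnreal,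
        ENNReal.ofReal_lt_ofReal_iff_of_nonneg t.coe_nonneg]
    have hcdf : (expMeasure r).real (Set.Iic (t : ℝ)) = 1 - Real.exp (-(r * t)) := by
      rw [← cdf_eq_real, cdf_expMeasure_eq hr, if_pos t.coe_nonneg]
    rw [expLaw_of_ne hr.ne', Measure.map_apply ENNReal.measurable_ofReal measurableSet_Ioi, hpre,
      ← ofReal_measureReal, probReal_compl_eq_one_sub measurableSet_Iic, hcdf, sub_sub_cancel]

lemma expLaw_Ioi_zero {r : ℝ} (hr : 0 ≤ r) : expLaw r (Set.Ioi 0) = 1 := by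
  rw [← ENNReal.coe_zero, expLaw_Ioi hr]; simp

lemma generateFrom_range_Ioi_coe :
    MeasurableSpace.generateFrom (Set.range fun t : ℝ≥0 => Set.Ioi (t : ℝ≥0∞)) =
      ENNReal.measurableSpace := by
  rw [BorelSpace.measurable_eq (α := ℝ≥0∞)]
  refine le_antisymm (MeasurableSpace.generateFrom_le ?_) ?_
  · rintro _ ⟨t, rfl⟩
    exact isOpen_Ioi.measurableSet
  · rw [borel_eq_generateFrom_Ioi]
    refine MeasurableSpace.generateFrom_le ?_
    rintro _ ⟨t, rfl⟩
    induction t with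
    | top => simp
    | coe t => exact MeasurableSpace.measurableSet_generateFrom ⟨t, rfl⟩

lemma isPiSystem_range_Ioi_coe : IsPiSystem (Set.range fun t : ℝ≥0 => Set.Ioi (t : ℝ≥0∞)) := by
  rintro _ ⟨t, rfl⟩ _ ⟨t', rfl⟩ _
  exact ⟨max t t', by simp [Set.Ioi_inter_Ioi]⟩

section Tails

variable {Ω : Type*} [MeasurableSpace Ω] {P : Measure Ω}

lemma map_eq_expLaw [IsProbabilityMeasure P] {T : Ω → ℝ≥0∞} (hT : Measurable T) {r : ℝ}
    (hr : 0 ≤ r)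
    (htail : ∀ t : ℝ≥0, P {ω | (t : ℝ≥0∞) < T ω} = ENNReal.ofReal (Real.exp (-(r * t)))) :
    P.map T = expLaw r := by
  have := Measure.isProbabilityMeasure_map (μ := P) hT.aemeasurable
  have := isProbabilityMeasure_expLaw hr
  refine ext_of_generate_finite _ generateFrom_range_Ioi_coe.symm isPiSystem_range_Ioi_coe ?_
    (by simp)
  rintro _ ⟨t, rfl⟩
  rw [Measure.map_apply hT measurableSet_Ioi, expLaw_Ioi hr]
  exact htail t

lemma iIndepFun_of_measure_lt {ι : Type*} {T : ι → Ω → ℝ≥0∞} (hT : ∀ i, Measurable (T i))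
    (h : ∀ (s : Finset ι) (t : ι → ℝ≥0),
      P {ω | ∀ i ∈ s, (t i : ℝ≥0∞) < T i ω} = ∏ i ∈ s, P {ω | (t i : ℝ≥0∞) < T i ω}) :
    iIndepFun T P := by
  rw [iIndepFun_iff_iIndep]
  refine iIndepSets.iIndep (fun i => (hT i).comap_le)
    (fun i => Set.preimage (T i) '' Set.range fun t : ℝ≥0 => Set.Ioi (t : ℝ≥0∞))
    (fun i => isPiSystem_range_Ioi_coe.comap (T i))
    (fun i => by rw [← generateFrom_range_Ioi_coe, MeasurableSpace.comap_generateFrom]) ?_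
  rw [iIndepSets_iff]
  intro s f hf
  have hchoice : ∀ i, ∃ t : ℝ≥0, i ∈ s → f i = {ω | (t : ℝ≥0∞) < T i ω} := by
    intro i
    by_cases hi : i ∈ s
    · obtain ⟨_, ⟨t, rfl⟩, ht⟩ := hf i hi
      exact ⟨t, fun _ => ht.symm⟩
    · exact ⟨0, fun h => absurd h hi⟩
  choose t ht using hchoice
  have hinter : ⋂ i ∈ s, f i = {ω | ∀ i ∈ s, (t i : ℝ≥0∞) < T i ω} := by
    ext ω
    simp +contextual only [Set.mem_iInter, Set.mem_ofPred_eq, ht]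
  rw [hinter, h]
  exact Finset.prod_congr rfl fun i hi => by rw [ht i hi]

end Tails

/-! ### The jump chain and the holding times -/

lemma bdRate_nonneg (birth death : ℕ → ℝ≥0) (k : ℕ) : 0 ≤ bdRate birth death k := by
  unfold bdRate
  split_ifs <;> positivity

instance (birth death : ℕ → ℝ≥0) (k : ℕ) :
    IsProbabilityMeasure (expLaw (bdRate birth death k)) :=
  isProbabilityMeasure_expLaw (bdRate_nonneg birth death k)

lemma bdJump_nonneg (birth death : ℕ → ℝ≥0) (k l : ℕ) : 0 ≤ bdJump birth death k l := by
  have := bdRate_nonneg birth death k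
  unfold bdJump
  split_ifs <;> positivity

lemma tsum_bdJump_mul (birth death : ℕ → ℝ≥0) (k : ℕ) (G : ℕ → ℝ≥0∞) :
    ∑' l, ENNReal.ofReal (bdJump birth death k l) * G l =
      if bdRate birth death k = 0 then G k
      else ENNReal.ofReal (birth k / bdRate birth death k) * G (k + 1) +
        if k = 0 then 0 else ENNReal.ofReal (death k / bdRate birth death k) * G (k - 1) := by
  by_cases hr : bdRate birth death k = 0
  · rw [tsum_eq_single k fun l hl => by simp [bdJump, hr, hl]]
    simp [bdJump, hr]
  rw [if_neg hr]
  rcases k with _ | k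
  · rw [tsum_eq_single 1 fun l hl => by simp [bdJump, hr, hl]]
    simp [bdJump, hr]
  · rw [tsum_eq_sum (s := {k + 1 + 1, k}), Finset.sum_pair (by omega)]
    · simp [bdJump, hr, show k ≠ k + 1 + 1 by omega]
    · intro l hl
      rw [Finset.mem_insert, Finset.mem_singleton, not_or] at hl
      simp [bdJump, hr, hl.1, hl.2]

lemma tsum_bdJump (birth death : ℕ → ℝ≥0) (k : ℕ) :
    ∑' l, ENNReal.ofReal (bdJump birth death k l) = 1 := by
  have hsum := tsum_bdJump_mul birth death k fun _ => 1
  simp only [mul_one] at hsum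
  have := bdRate_nonneg birth death k
  rw [hsum]
  split_ifs with hr hk
  · rfl
  · rw [add_zero, show (birth k : ℝ) = bdRate birth death k by simp [bdRate, hk], div_self hr,
      ENNReal.ofReal_one]
  · rw [← ENNReal.ofReal_add (by positivity) (by positivity), ← add_div,
      show (birth k + death k : ℝ) = bdRate birth death k by simp [bdRate, hk], div_self hr,
      ENNReal.ofReal_one]

lemma fin_ofNat_eq_mk {n k : ℕ} (hk : k ≤ n) :
    Fin.ofNat (n + 1) k = ⟨k, Nat.lt_succ_of_le hk⟩ :=
  Fin.ext (Nat.mod_eq_of_lt (Nat.lt_succ_of_le hk))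

section Paths

variable {Ω : Type*} {Y : ℕ → Ω → ℕ}

/-- The event that the states of the jump chain up to the `n`-th jump are given by `y`. -/
def pathEvent (Y : ℕ → Ω → ℕ) (n : ℕ) (y : ℕ → ℕ) : Set Ω := {ω | ∀ k ≤ n, Y k ω = y k}

lemma pathEvent_succ (n : ℕ) (y : ℕ → ℕ) :
    pathEvent Y (n + 1) y = Y (n + 1) ⁻¹' {y (n + 1)} ∩ pathEvent Y n y := by
  ext ω
  simp only [pathEvent, Nat.le_succ_iff_eq_or_le, Set.mem_inter_iff, Set.mem_preimage,
    Set.mem_singleton_iff, Set.mem_ofPred_eq, forall_eq_or_imp]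

lemma pathEvent_update (n l : ℕ) (y : ℕ → ℕ) :
    pathEvent Y n (Function.update y (n + 1) l) = pathEvent Y n y := by
  ext ω
  refine forall₂_congr fun k hk => ?_
  rw [Function.update_of_ne (by omega)]

lemma preimage_history_eq_pathEvent (n : ℕ) (a : Fin (n + 1) → ℕ) :
    (fun ω (k : Fin (n + 1)) => Y k ω) ⁻¹' {a} =
      pathEvent Y n fun k : ℕ => a (Fin.ofNat (n + 1) k) := by
  ext ω
  simp only [pathEvent, Set.mem_preimage, Set.mem_singleton_iff, Set.mem_ofPred_eq, funext_iff,
    Fin.forall_iff, Nat.lt_succ_iff]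
  refine forall₂_congr fun k hk => ?_
  rw [fin_ofNat_eq_mk hk]

end Paths

section JumpHold

variable {Ω : Type*} [MeasurableSpace Ω] {P : Measure Ω} {Y : ℕ → Ω → ℕ}
  {H : ℕ → Ω → ℝ≥0∞} {x₀ : ℕ} {birth death : ℕ → ℝ≥0}

/-- `Y` and `H` are the jump chain and the holding times of a birth-death process: the part of
`IsBirthDeath` which does not refer to the process itself. -/
structure IsJumpHold (P : Measure Ω) (Y : ℕ → Ω → ℕ) (H : ℕ → Ω → ℝ≥0∞) (x₀ : ℕ)
    (birth death : ℕ → ℝ≥0) : Prop where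
  chain : ∀ n, Measurable (Y n)
  hold : ∀ n, Measurable (H n)
  law : ∀ (n : ℕ) (y : ℕ → ℕ) (t : ℕ → ℝ≥0),
      P.real {ω | ∀ k ≤ n, Y k ω = y k ∧ (t k : ℝ≥0∞) < H k ω} =
        (if y 0 = x₀ then 1 else 0) *
          (∏ k ∈ Finset.range (n + 1), Real.exp (-(bdRate birth death (y k) * t k))) *
          ∏ k ∈ Finset.range n, bdJump birth death (y k) (y (k + 1))

/-- The probability of `pathEvent` (see `IsJumpHold.measure_pathEvent`). -/
def pathWeight (birth death : ℕ → ℝ≥0) (x₀ n : ℕ) (y : ℕ → ℕ) : ℝ≥0∞ :=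
  (if y 0 = x₀ then 1 else 0) *
    ∏ k ∈ Finset.range n, ENNReal.ofReal (bdJump birth death (y k) (y (k + 1)))

lemma pathWeight_ne_top (n : ℕ) (y : ℕ → ℕ) : pathWeight birth death x₀ n y ≠ ⊤ :=
  ENNReal.mul_ne_top (by split_ifs <;> simp) (ENNReal.prod_ne_top fun _ _ => ENNReal.ofReal_ne_top)

lemma pathWeight_succ (n : ℕ) (y : ℕ → ℕ) : pathWeight birth death x₀ (n + 1) y =
    pathWeight birth death x₀ n y * ENNReal.ofReal (bdJump birth death (y n) (y (n + 1))) := by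
  rw [pathWeight, Finset.prod_range_succ, ← mul_assoc, pathWeight]

lemma pathWeight_update (n l : ℕ) (y : ℕ → ℕ) :
    pathWeight birth death x₀ n (Function.update y (n + 1) l)
      = pathWeight birth death x₀ n y := by
  unfold pathWeight
  congr 1
  refine Finset.prod_congr rfl fun k hk => ?_
  have := Finset.mem_range.1 hk
  rw [Function.update_of_ne (by omega), Function.update_of_ne (by omega)]

namespace IsJumpHold

lemma measurableSet_pathEvent (h : IsJumpHold P Y H x₀ birth death) (n : ℕ) (y : ℕ → ℕ) :
    MeasurableSet (pathEvent Y n y) := by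
  simp only [pathEvent, Set.ofPred_forall]
  exact MeasurableSet.iInter fun k => MeasurableSet.iInter fun _ =>
    h.chain k (measurableSet_singleton _)

lemma measurable_jumpTime (h : IsJumpHold P Y H x₀ birth death) (n : ℕ) :
    Measurable fun ω => ∑ k ∈ Finset.range n, H k ω :=
  Finset.measurable_fun_sum _ fun k _ => h.hold k

lemma measure_pathEvent_inter_lt [IsFiniteMeasure P] (h : IsJumpHold P Y H x₀ birth death) (n : ℕ)
    (y : ℕ → ℕ) (t : ℕ → ℝ≥0) :
    P (pathEvent Y n y ∩ {ω | ∀ k ≤ n, (t k : ℝ≥0∞) < H k ω}) = pathWeight birth death x₀ n y *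
      ∏ k ∈ Finset.range (n + 1), expLaw (bdRate birth death (y k)) (Set.Ioi (t k)) := by
  have hset : pathEvent Y n y ∩ {ω | ∀ k ≤ n, (t k : ℝ≥0∞) < H k ω} =
      {ω | ∀ k ≤ n, Y k ω = y k ∧ (t k : ℝ≥0∞) < H k ω} := by
    ext ω
    exact forall₂_and.symm
  have hjump : 0 ≤ ∏ k ∈ Finset.range n, bdJump birth death (y k) (y (k + 1)) :=
    Finset.prod_nonneg fun k _ => bdJump_nonneg _ _ _ _
  rw [hset, ← ofReal_measureReal, h.law n y t, pathWeight]
  simp only [expLaw_Ioi (bdRate_nonneg birth death _)]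
  rw [← ENNReal.ofReal_prod_of_nonneg fun k _ => bdJump_nonneg _ _ _ _,
    ← ENNReal.ofReal_prod_of_nonneg fun k _ => (Real.exp_pos _).le]
  split_ifs
  · rw [one_mul, one_mul, mul_comm, ENNReal.ofReal_mul hjump]
  · simp

lemma measure_pathEvent_inter_pos [IsFiniteMeasure P] (h : IsJumpHold P Y H x₀ birth death)
    (n : ℕ) (y : ℕ → ℕ) :
    P (pathEvent Y n y ∩ {ω | ∀ k ≤ n, 0 < H k ω}) = pathWeight birth death x₀ n y := by
  have hlaw := h.measure_pathEvent_inter_lt n y fun _ => 0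
  simp only [ENNReal.coe_zero, expLaw_Ioi_zero (bdRate_nonneg _ _ _), Finset.prod_const_one,
    mul_one] at hlaw
  exact hlaw

lemma measure_pathEvent_inter_pos_succ [IsFiniteMeasure P] (h : IsJumpHold P Y H x₀ birth death)
    (n : ℕ) (y : ℕ → ℕ) :
    P (pathEvent Y n y ∩ {ω | ∀ k ≤ n + 1, 0 < H k ω}) = pathWeight birth death x₀ n y := by
  set E := pathEvent Y n y ∩ {ω | ∀ k ≤ n + 1, 0 < H k ω}
  have hfiber : ∀ l, P (Y (n + 1) ⁻¹' {l} ∩ E) =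
      pathWeight birth death x₀ n y * ENNReal.ofReal (bdJump birth death (y n) l) := by
    intro l
    have hnext := h.measure_pathEvent_inter_pos (n + 1) (Function.update y (n + 1) l)
    rwa [pathEvent_succ, pathEvent_update, pathWeight_succ, pathWeight_update,
      Function.update_self, Function.update_of_ne (by omega), Set.inter_assoc] at hnext
  have hsum := tsum_measure_preimage_singleton (μ := P.restrict E) Set.countable_univ
    (f := Y (n + 1)) fun l _ => h.chain (n + 1) (measurableSet_singleton l)
  rw [Set.preimage_univ, Measure.restrict_apply_univ,
    tsum_univ fun l => P.restrict E (Y (n + 1) ⁻¹' {l})] at hsum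
  simp only [Measure.restrict_apply (h.chain (n + 1) (measurableSet_singleton _)), hfiber] at hsum
  rw [← hsum, ENNReal.tsum_mul_left, tsum_bdJump, mul_one]

lemma ae_hold_zero_pos [IsProbabilityMeasure P] (h : IsJumpHold P Y H x₀ birth death) :
    ∀ᵐ ω ∂P, Y 0 ω = x₀ ∧ 0 < H 0 ω := by
  have hset : pathEvent Y 0 (fun _ => x₀) ∩ {ω | ∀ k ≤ 0, 0 < H k ω} =
      {ω | Y 0 ω = x₀ ∧ 0 < H 0 ω} := by
    ext ω
    simp [pathEvent]
  have hone := h.measure_pathEvent_inter_pos 0 fun _ => x₀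
  rw [hset] at hone
  have hmeas : MeasurableSet {ω | Y 0 ω = x₀ ∧ 0 < H 0 ω} :=
    (h.chain 0 (measurableSet_singleton x₀)).inter (h.hold 0 measurableSet_Ioi)
  exact (mem_ae_iff_prob_eq_one hmeas).2 (hone.trans (by simp [pathWeight]))

lemma ae_hold_succ_pos [IsFiniteMeasure P] (h : IsJumpHold P Y H x₀ birth death) (n : ℕ) :
    ∀ᵐ ω ∂P, (∀ k ≤ n, 0 < H k ω) → 0 < H (n + 1) ω := by
  have hpath : ∀ y : ℕ → ℕ, ∀ᵐ ω ∂P, ω ∈ pathEvent Y n y →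
      (∀ k ≤ n, 0 < H k ω) → 0 < H (n + 1) ω := by
    intro y
    have hpos : MeasurableSet {ω | ∀ k ≤ n + 1, 0 < H k ω} := by
      simp only [Set.ofPred_forall]
      exact MeasurableSet.iInter fun k => MeasurableSet.iInter fun _ => h.hold k measurableSet_Ioi
    have hae := ae_eq_of_subset_of_measure_ge
      (s := pathEvent Y n y ∩ {ω | ∀ k ≤ n + 1, 0 < H k ω})
      (t := pathEvent Y n y ∩ {ω | ∀ k ≤ n, 0 < H k ω})
      (Set.inter_subset_inter_right _ fun ω hω k hk => hω k (hk.trans n.le_succ))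
      (by rw [h.measure_pathEvent_inter_pos, h.measure_pathEvent_inter_pos_succ])
      ((h.measurableSet_pathEvent n y).inter hpos).nullMeasurableSet (measure_ne_top _ _)
    filter_upwards [hae.mem_iff] with ω hω hy hk
    exact (hω.2 ⟨hy, hk⟩).2 (n + 1) le_rfl
  filter_upwards [ae_all_iff.2 fun a : Fin (n + 1) → ℕ =>
    hpath fun k : ℕ => a (Fin.ofNat (n + 1) k)] with ω hω
  exact hω (fun k => Y k ω) ((preimage_history_eq_pathEvent (Y := Y) n _).subset rfl)

lemma ae_hold_pos [IsProbabilityMeasure P] (h : IsJumpHold P Y H x₀ birth death) :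
    ∀ᵐ ω ∂P, ∀ k, 0 < H k ω := by
  filter_upwards [h.ae_hold_zero_pos, ae_all_iff.2 h.ae_hold_succ_pos] with ω hzero hsucc k
  induction k using Nat.strong_induction_on with
  | _ k ih =>
    rcases k with _ | k
    · exact hzero.2
    · exact hsucc k fun j hj => ih j (Nat.lt_succ_of_le hj)

lemma measure_pathEvent [IsProbabilityMeasure P] (h : IsJumpHold P Y H x₀ birth death) (n : ℕ)
    (y : ℕ → ℕ) : P (pathEvent Y n y) = pathWeight birth death x₀ n y := by
  rw [← h.measure_pathEvent_inter_pos n y]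
  refine measure_congr ?_
  filter_upwards [h.ae_hold_pos] with ω hω
  exact propext ⟨fun hy => ⟨hy, fun k _ => hω k⟩, And.left⟩

end IsJumpHold

end JumpHold

/-! ### The law of the jump times -/

section

variable {Ω : Type*} [MeasurableSpace Ω] {P : Measure Ω}

lemma indepFun_sum_range {H : ℕ → Ω → ℝ≥0∞} (hH : ∀ k, Measurable (H k)) {m : ℕ}
    (hind : iIndepFun (fun k : Fin (m + 1) => H k) P) :
    IndepFun (fun ω => ∑ k ∈ Finset.range m, H k ω) (H m) P := by
  have hsum : (fun ω => ∑ k ∈ Finset.range m, H k ω) =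
      ∑ k ∈ Finset.univ.map Fin.castSuccEmb, fun ω => H (k : Fin (m + 1)) ω := by
    ext ω
    rw [Finset.sum_apply, Finset.sum_map]
    exact (Fin.sum_univ_eq_sum_range (fun k => H k ω) m).symm
  have hlast := hind.indepFun_finsetSum_of_notMem (fun k => hH k)
    (s := Finset.univ.map Fin.castSuccEmb) (i := Fin.last m)
    (by simp [Fin.castSucc_ne_last])
  rwa [hsum]

lemma lintegral_eq_tsum_preimage {α : Type*} [MeasurableSpace α] [Countable α]
    [MeasurableSingletonClass α] {Z : Ω → α} (hZ : Measurable Z) (f : Ω → ℝ≥0∞) :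
    ∫⁻ ω, f ω ∂P = ∑' a, ∫⁻ ω in Z ⁻¹' {a}, f ω ∂P := by
  rw [← lintegral_iUnion (fun a => hZ (measurableSet_singleton a)) (pairwise_disjoint_fiber Z),
    ← Set.preimage_iUnion, Set.iUnion_of_singleton, Set.preimage_univ, Measure.restrict_univ]

lemma setLIntegral_preimage_congr {α : Type*} [MeasurableSpace α] [Countable α]
    [MeasurableSingletonClass α] {Z : Ω → α} (hZ : Measurable Z) {B : Set α} {f g : Ω → ℝ≥0∞}
    (h : ∀ a ∈ B, ∫⁻ ω in Z ⁻¹' {a}, f ω ∂P = ∫⁻ ω in Z ⁻¹' {a}, g ω ∂P) :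
    ∫⁻ ω in Z ⁻¹' B, f ω ∂P = ∫⁻ ω in Z ⁻¹' B, g ω ∂P := by
  rw [lintegral_eq_tsum_preimage hZ, lintegral_eq_tsum_preimage hZ]
  refine tsum_congr fun a => ?_
  rw [Measure.restrict_restrict (hZ (measurableSet_singleton a)), ← Set.preimage_inter]
  by_cases ha : a ∈ B
  · rw [Set.singleton_inter_of_mem ha, h a ha]
  · simp [Set.singleton_inter_eq_empty.2 ha]

end

/-- The law of the time of the `m`-th jump, given that the jump chain follows `y`. -/
def jumpTimeLaw (birth death : ℕ → ℝ≥0) (y : ℕ → ℕ) : ℕ → Measure ℝ≥0∞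
  | 0 => Measure.dirac 0
  | m + 1 => (jumpTimeLaw birth death y m).conv (expLaw (bdRate birth death (y m)))

variable {Ω : Type*} [MeasurableSpace Ω] {P : Measure Ω} {Y : ℕ → Ω → ℕ}
  {H : ℕ → Ω → ℝ≥0∞} {x₀ : ℕ} {birth death : ℕ → ℝ≥0}

namespace IsJumpHold

variable [IsProbabilityMeasure P]

lemma cond_hold_lt (h : IsJumpHold P Y H x₀ birth death) {n : ℕ} {y : ℕ → ℕ}
    (hy : pathWeight birth death x₀ n y ≠ 0) (s : Finset (Fin (n + 1))) (t : Fin (n + 1) → ℝ≥0) :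
    P[|pathEvent Y n y] {ω | ∀ k ∈ s, (t k : ℝ≥0∞) < H k ω} =
      ∏ k ∈ s, expLaw (bdRate birth death (y k)) (Set.Ioi (t k)) := by
  set t' : Fin (n + 1) → ℝ≥0 := fun k => if k ∈ s then t k else 0
  have hae : (pathEvent Y n y ∩ {ω | ∀ k ∈ s, (t k : ℝ≥0∞) < H k ω} : Set Ω) =ᵐ[P]
      (pathEvent Y n y ∩ {ω | ∀ k ≤ n, (t' (Fin.ofNat (n + 1) k) : ℝ≥0∞) < H k ω} : Set Ω) := by
    filter_upwards [h.ae_hold_pos] with ω hω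
    refine propext (and_congr_right fun _ => ?_)
    have hall : (∀ k ≤ n, (t' (Fin.ofNat (n + 1) k) : ℝ≥0∞) < H k ω) ↔
        ∀ k : Fin (n + 1), (t' k : ℝ≥0∞) < H k ω := by
      simp only [Fin.forall_iff, Nat.lt_succ_iff]
      refine forall₂_congr fun k hk => ?_
      rw [fin_ofNat_eq_mk hk]
    refine Iff.trans (forall_congr' fun k => ?_) hall.symm
    by_cases hk : k ∈ s <;> simp [t', hk, hω k]
  have hprod : ∏ k ∈ Finset.range (n + 1), expLaw (bdRate birth death (y k))
      (Set.Ioi (t' (Fin.ofNat (n + 1) k))) =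
      ∏ k ∈ s, expLaw (bdRate birth death (y k)) (Set.Ioi (t k)) := by
    rw [← Fin.prod_univ_eq_prod_range (fun k => expLaw (bdRate birth death (y k))
      (Set.Ioi (t' (Fin.ofNat (n + 1) k) : ℝ≥0∞))), ← Finset.prod_subset (Finset.subset_univ s)]
    · refine Finset.prod_congr rfl fun k hk => ?_
      simp [t', hk]
    · intro k _ hk
      simp [t', hk, expLaw_Ioi_zero (bdRate_nonneg _ _ _)]
  rw [cond_apply (h.measurableSet_pathEvent n y), measure_congr hae,
    h.measure_pathEvent_inter_lt, h.measure_pathEvent, ← mul_assoc,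
    ENNReal.inv_mul_cancel hy (pathWeight_ne_top n y), one_mul, hprod]

lemma map_hold (h : IsJumpHold P Y H x₀ birth death) {n : ℕ} {y : ℕ → ℕ}
    (hy : pathWeight birth death x₀ n y ≠ 0) (k : Fin (n + 1)) :
    (P[|pathEvent Y n y]).map (H k) = expLaw (bdRate birth death (y k)) := by
  have : IsProbabilityMeasure P[|pathEvent Y n y] :=
    cond_isProbabilityMeasure (by rwa [h.measure_pathEvent])
  refine map_eq_expLaw (h.hold k) (bdRate_nonneg _ _ _) fun t => ?_
  simpa [expLaw_Ioi (bdRate_nonneg birth death _)] using h.cond_hold_lt hy {k} fun _ => t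

lemma iIndepFun_hold (h : IsJumpHold P Y H x₀ birth death) {n : ℕ} {y : ℕ → ℕ}
    (hy : pathWeight birth death x₀ n y ≠ 0) :
    iIndepFun (fun k : Fin (n + 1) => H k) P[|pathEvent Y n y] := by
  refine iIndepFun_of_measure_lt (fun k => h.hold k) fun s t => ?_
  rw [h.cond_hold_lt hy]
  refine Finset.prod_congr rfl fun k _ => ?_
  simpa using (h.cond_hold_lt hy {k} t).symm

lemma map_jumpTime (h : IsJumpHold P Y H x₀ birth death) {n : ℕ} {y : ℕ → ℕ}
    (hy : pathWeight birth death x₀ n y ≠ 0) {m : ℕ} (hm : m ≤ n + 1) :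
    (P[|pathEvent Y n y]).map (fun ω => ∑ k ∈ Finset.range m, H k ω) =
      jumpTimeLaw birth death y m := by
  have : IsProbabilityMeasure P[|pathEvent Y n y] :=
    cond_isProbabilityMeasure (by rwa [h.measure_pathEvent])
  induction m with
  | zero => simp [jumpTimeLaw]
  | succ m ih =>
    have hindep := indepFun_sum_range h.hold
      ((h.iIndepFun_hold hy).precomp (Fin.castLE_injective hm))
    have hconv := hindep.map_add_eq_map_conv_map (h.measurable_jumpTime m) (h.hold m)
    rw [ih (m.le_succ.trans hm), h.map_hold hy ⟨m, hm⟩] at hconv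
    rw [jumpTimeLaw, ← hconv]
    congr 1
    ext ω
    exact Finset.sum_range_succ _ _

lemma setLIntegral_pathEvent (h : IsJumpHold P Y H x₀ birth death) {n m : ℕ} (hm : m ≤ n + 1)
    (y : ℕ → ℕ) {F : ℝ≥0∞ → ℝ≥0∞} (hF : Measurable F) :
    ∫⁻ ω in pathEvent Y n y, F (∑ k ∈ Finset.range m, H k ω) ∂P =
      pathWeight birth death x₀ n y * ∫⁻ t, F t ∂jumpTimeLaw birth death y m := by
  by_cases hy : pathWeight birth death x₀ n y = 0
  · rw [hy, zero_mul, setLIntegral_measure_zero _ _ (by rw [h.measure_pathEvent, hy])]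
  · have hcond : P.restrict (pathEvent Y n y) =
        pathWeight birth death x₀ n y • P[|pathEvent Y n y] := by
      rw [ProbabilityTheory.cond, h.measure_pathEvent, smul_smul,
        ENNReal.mul_inv_cancel hy (pathWeight_ne_top n y),
        one_smul]
    rw [hcond, lintegral_smul_measure, smul_eq_mul, ← h.map_jumpTime hy hm,
      lintegral_map hF (h.measurable_jumpTime m)]

lemma setLIntegral_pathEvent_succ (h : IsJumpHold P Y H x₀ birth death) (m : ℕ) (y : ℕ → ℕ)
    {F : ℝ≥0∞ → ℝ≥0∞} (hF : Measurable F) :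
    ∫⁻ ω in pathEvent Y (m + 1) y, F (∑ k ∈ Finset.range (m + 1), H k ω) ∂P =
      ENNReal.ofReal (bdJump birth death (y m) (y (m + 1))) *
        ∫⁻ ω in pathEvent Y m y, ∫⁻ x, F (∑ k ∈ Finset.range m, H k ω + x)
          ∂expLaw (bdRate birth death (y m)) ∂P := by
  have hG : Measurable fun t => ∫⁻ x, F (t + x) ∂expLaw (bdRate birth death (y m)) :=
    Measurable.lintegral_prod_right' (f := fun z : ℝ≥0∞ × ℝ≥0∞ => F (z.1 + z.2)) (by fun_prop)
  rw [h.setLIntegral_pathEvent (by omega) y hF, h.setLIntegral_pathEvent (by omega) y hG,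
    pathWeight_succ, jumpTimeLaw, Measure.lintegral_conv hF, mul_assoc, mul_left_comm]

end IsJumpHold

/-- The kernel of the Markov chain (state after the `m`-th jump, time of the `m`-th jump), killed
when the state is `0`, acting on functions. -/
def bdStep (birth death : ℕ → ℝ≥0) (u : ℕ → ℝ≥0∞ → ℝ≥0∞) (k : ℕ) (t : ℝ≥0∞) : ℝ≥0∞ :=
  if k = 0 then 0 else ∑' l, ENNReal.ofReal (bdJump birth death k l) *
    ∫⁻ x, u l (t + x) ∂expLaw (bdRate birth death k)

namespace IsJumpHold

variable [IsProbabilityMeasure P]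

lemma setLIntegral_pathEvent_bdStep (h : IsJumpHold P Y H x₀ birth death) (m : ℕ) (y : ℕ → ℕ)
    (hy : y m ≠ 0) {u : ℕ → ℝ≥0∞ → ℝ≥0∞} (hu : ∀ k, Measurable (u k)) :
    ∫⁻ ω in pathEvent Y m y, u (Y (m + 1) ω) (∑ k ∈ Finset.range (m + 1), H k ω) ∂P =
      ∫⁻ ω in pathEvent Y m y,
        bdStep birth death u (Y m ω) (∑ k ∈ Finset.range m, H k ω) ∂P := by
  have hG : ∀ l, Measurable fun ω => ∫⁻ x, u l (∑ k ∈ Finset.range m, H k ω + x)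
      ∂expLaw (bdRate birth death (y m)) := fun l =>
    (Measurable.lintegral_prod_right' (f := fun z : ℝ≥0∞ × ℝ≥0∞ => u l (z.1 + z.2))
      (by fun_prop)).comp (h.measurable_jumpTime m)
  have hstep : ∀ ω ∈ pathEvent Y m y, bdStep birth death u (Y m ω) (∑ k ∈ Finset.range m, H k ω) =
      ∑' l, ENNReal.ofReal (bdJump birth death (y m) l) *
        ∫⁻ x, u l (∑ k ∈ Finset.range m, H k ω + x) ∂expLaw (bdRate birth death (y m)) :=
    fun ω hω => by rw [hω m le_rfl, bdStep, if_neg hy]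
  rw [setLIntegral_congr_fun (h.measurableSet_pathEvent m y) hstep,
    lintegral_tsum fun l => ((hG l).const_mul _).aemeasurable,
    lintegral_eq_tsum_preimage (h.chain (m + 1))]
  refine tsum_congr fun l => ?_
  have hnext := h.setLIntegral_pathEvent_succ m (Function.update y (m + 1) l) (hu l)
  rw [pathEvent_update, Function.update_self, Function.update_of_ne (by omega)] at hnext
  rw [lintegral_const_mul _ (hG l), ← hnext, pathEvent_succ, pathEvent_update,
    Function.update_self, Measure.restrict_restrict (h.chain (m + 1) (measurableSet_singleton l))]
  refine setLIntegral_congr_fun ((h.chain (m + 1) (measurableSet_singleton l)).inter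
    (h.measurableSet_pathEvent m y)) fun ω hω => ?_
  rw [show Y (m + 1) ω = l from hω.1]

lemma setLIntegral_bdStep (h : IsJumpHold P Y H x₀ birth death)
    (m : ℕ) {u : ℕ → ℝ≥0∞ → ℝ≥0∞} (hu : ∀ k, Measurable (u k)) :
    ∫⁻ ω in {ω | ∀ j < m + 1, Y j ω ≠ 0},
        u (Y (m + 1) ω) (∑ k ∈ Finset.range (m + 1), H k ω) ∂P =
      ∫⁻ ω in {ω | ∀ j < m, Y j ω ≠ 0},
        bdStep birth death u (Y m ω) (∑ k ∈ Finset.range m, H k ω) ∂P := by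
  have hhist : Measurable fun ω (k : Fin (m + 1)) => Y k ω :=
    measurable_pi_iff.2 fun k => h.chain k
  have hpre : {ω | ∀ j < m + 1, Y j ω ≠ 0} =
      (fun ω (k : Fin (m + 1)) => Y k ω) ⁻¹' {a | ∀ k, a k ≠ 0} := by
    ext ω
    simp only [Set.mem_preimage, Set.mem_ofPred_eq, Fin.forall_iff]
  have hmeas : ∀ n, MeasurableSet {ω | ∀ j < n, Y j ω ≠ 0} := fun n => by
    simp only [Set.ofPred_forall]
    exact MeasurableSet.iInter fun j => MeasurableSet.iInter fun _ =>
      (h.chain j (measurableSet_singleton 0)).compl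
  have hkill : ∫⁻ ω in {ω | ∀ j < m, Y j ω ≠ 0},
        bdStep birth death u (Y m ω) (∑ k ∈ Finset.range m, H k ω) ∂P =
      ∫⁻ ω in {ω | ∀ j < m + 1, Y j ω ≠ 0},
        bdStep birth death u (Y m ω) (∑ k ∈ Finset.range m, H k ω) ∂P := by
    rw [← lintegral_indicator (hmeas m), ← lintegral_indicator (hmeas (m + 1))]
    refine lintegral_congr fun ω => ?_
    by_cases hω : Y m ω = 0
    · simp [Set.indicator, bdStep, hω]
    · simp only [Set.indicator, Set.mem_ofPred_eq, Nat.lt_succ_iff_lt_or_eq, or_imp, forall_and,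
        forall_eq, ne_eq, hω, not_false_eq_true, and_true]
  rw [hkill, hpre]
  refine setLIntegral_preimage_congr hhist fun a ha => ?_
  rw [preimage_history_eq_pathEvent]
  exact h.setLIntegral_pathEvent_bdStep m _ (ha _) hu

end IsJumpHold

/-! ### The law of the first-passage time -/

/-- The measure `exp (-r x) dx` on `(0, ∞)`. It is not normalised, so that `passageLaw` satisfies a
recursion without divisions. -/
def expDens (r : ℝ) : Measure ℝ :=
  (volume.restrict (Set.Ioi 0)).withDensity fun x => ENNReal.ofReal (Real.exp (-(r * x)))

instance (r : ℝ) : SFinite (expDens r) := by unfold expDens; infer_instance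

lemma expDens_absolutelyContinuous (r : ℝ) : expDens r ≪ volume.restrict (Set.Ioi 0) :=
  withDensity_absolutelyContinuous _ _

lemma ae_expDens_pos (r : ℝ) : ∀ᵐ x ∂expDens r, 0 < x :=
  (expDens_absolutelyContinuous r).ae_le (ae_restrict_mem measurableSet_Ioi)

lemma expMeasure_eq_smul_expDens {r : ℝ} (hr : 0 ≤ r) :
    expMeasure r = ENNReal.ofReal r • expDens r := by
  have hdens : expMeasure r = (volume.restrict (Set.Ici 0)).withDensity
      fun x => ENNReal.ofReal r * ENNReal.ofReal (Real.exp (-(r * x))) := by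
    rw [← withDensity_indicator measurableSet_Ici]
    refine congrArg volume.withDensity (funext fun x => (exponentialPDF_eq r x).trans ?_)
    rw [Set.indicator_apply]
    split_ifs with hx hx' hx'
    · exact ENNReal.ofReal_mul hr
    · exact absurd hx hx'
    · exact absurd hx' hx
    · exact ENNReal.ofReal_zero
  rw [hdens, expDens, restrict_Ioi_eq_restrict_Ici]
  exact withDensity_smul _ (by fun_prop)

lemma lintegral_expLaw {r : ℝ} (hr : 0 < r) {F : ℝ≥0∞ → ℝ≥0∞} (hF : Measurable F) :
    ∫⁻ x, F x ∂expLaw r = ENNReal.ofReal r * ∫⁻ x, F (ENNReal.ofReal x) ∂expDens r := by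
  rw [expLaw_of_ne hr.ne', lintegral_map hF ENNReal.measurable_ofReal,
    expMeasure_eq_smul_expDens hr.le, lintegral_smul_measure, smul_eq_mul]

/-- The law of the first-passage time to `0` of the birth-death process started in `k`, on the event
that the passage takes `n` jumps. -/
def passageLaw (birth death : ℕ → ℝ≥0) : ℕ → ℕ → Measure ℝ
  | 0, k => if k = 0 then Measure.dirac 0 else 0
  | n + 1, k => if k = 0 then 0 else
      (birth k : ℝ≥0∞) • (passageLaw birth death n (k + 1)).conv (expDens (bdRate birth death k)) +
      (death k : ℝ≥0∞) • (passageLaw birth death n (k - 1)).conv (expDens (bdRate birth death k))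

variable {birth death : ℕ → ℝ≥0}

instance (birth death : ℕ → ℝ≥0) (n k : ℕ) : SFinite (passageLaw birth death n k) := by
  induction n generalizing k with
  | zero => simp only [passageLaw]; split_ifs <;> infer_instance
  | succ n ih =>
    have := ih (k + 1)
    have := ih (k - 1)
    simp only [passageLaw]
    split_ifs <;> infer_instance

lemma passageLaw_succ_of_ne (n : ℕ) {k : ℕ} (hk : k ≠ 0) : passageLaw birth death (n + 1) k =
    (birth k : ℝ≥0∞) • (passageLaw birth death n (k + 1)).conv (expDens (bdRate birth death k)) +
    (death k : ℝ≥0∞) • (passageLaw birth death n (k - 1)).conv (expDens (bdRate birth death k)) :=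
  if_neg hk

lemma lintegral_passageLaw_succ (n : ℕ) {k : ℕ} (hk : k ≠ 0) {F : ℝ → ℝ≥0∞} (hF : Measurable F) :
    ∫⁻ x, F x ∂passageLaw birth death (n + 1) k =
      birth k * ∫⁻ x, ∫⁻ y, F (x + y) ∂expDens (bdRate birth death k)
        ∂passageLaw birth death n (k + 1) +
      death k * ∫⁻ x, ∫⁻ y, F (x + y) ∂expDens (bdRate birth death k)
        ∂passageLaw birth death n (k - 1) := by
  rw [passageLaw_succ_of_ne n hk, lintegral_add_measure, lintegral_smul_measure,
    lintegral_smul_measure, Measure.lintegral_conv hF, Measure.lintegral_conv hF, smul_eq_mul,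
    smul_eq_mul]

lemma passageLaw_ae_nonneg (n k : ℕ) : ∀ᵐ x ∂passageLaw birth death n k, 0 ≤ x := by
  induction n generalizing k with
  | zero =>
    rw [passageLaw]
    split_ifs
    · rw [ae_dirac_iff measurableSet_Ici]
    · simp
  | succ n ih =>
    rcases eq_or_ne k 0 with rfl | hk
    · simp [passageLaw]
    have hconv : ∀ l, ∀ᵐ x ∂(passageLaw birth death n l).conv (expDens (bdRate birth death k)),
        0 ≤ x := by
      intro l
      rw [Measure.conv, ae_map_iff (by fun_prop) measurableSet_Ici]
      refine (Measure.ae_prod_iff_ae_ae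
        (measurableSet_Ici.preimage (measurable_fst.add measurable_snd))).2 ?_
      filter_upwards [ih l] with x hx
      filter_upwards [ae_expDens_pos (bdRate birth death k)] with y hy using add_nonneg hx hy.le
    rw [passageLaw_succ_of_ne n hk, ae_add_measure_iff]
    exact ⟨Measure.ae_smul_measure (hconv _) _, Measure.ae_smul_measure (hconv _) _⟩

lemma passageLaw_succ_absolutelyContinuous (n k : ℕ) :
    passageLaw birth death (n + 1) k ≪ volume := by
  rcases eq_or_ne k 0 with rfl | hk
  · exact Measure.AbsolutelyContinuous.zero _
  have hac : expDens (bdRate birth death k) ≪ volume :=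
    (expDens_absolutelyContinuous _).trans Measure.restrict_le_self.absolutelyContinuous
  rw [passageLaw_succ_of_ne n hk]
  exact .add_left ((Measure.conv_absolutelyContinuous hac).smul_left _)
    ((Measure.conv_absolutelyContinuous hac).smul_left _)

/-- The (possibly defective) law of the first-passage time to `0` from `k`. -/
def firstPassageLaw (birth death : ℕ → ℝ≥0) (k : ℕ) : Measure ℝ :=
  Measure.sum fun n => passageLaw birth death n k

lemma firstPassageLaw_absolutelyContinuous {k : ℕ} (hk : k ≠ 0) :
    firstPassageLaw birth death k ≪ volume.restrict (Set.Ioi 0) := by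
  refine Measure.absolutelyContinuous_sum_left fun n => ?_
  rcases n with _ | n
  · simp [passageLaw, hk, Measure.AbsolutelyContinuous.zero]
  have hne : ∀ᵐ x ∂passageLaw birth death (n + 1) k, x ≠ 0 :=
    (passageLaw_succ_absolutelyContinuous n k).ae_le (Measure.ae_ne volume 0)
  have hpos : ∀ᵐ x ∂passageLaw birth death (n + 1) k, x ∈ Set.Ioi 0 := by
    filter_upwards [passageLaw_ae_nonneg (n + 1) k, hne] with x hx hx' using hx.lt_of_ne' hx'
  rw [← Measure.restrict_eq_self_of_ae_mem hpos]
  exact (passageLaw_succ_absolutelyContinuous n k).restrict _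

/-- The expectation of `F` of the time of the first passage to `0`, on the event that it takes `n`
jumps, for the process started in `k` at time `t`. -/
def passageFun (birth death : ℕ → ℝ≥0) (F : ℝ → ℝ≥0∞) (n k : ℕ) (t : ℝ≥0∞) : ℝ≥0∞ :=
  if t = ⊤ then 0 else ∫⁻ x, F (t.toReal + x) ∂passageLaw birth death n k

lemma measurable_passageFun {F : ℝ → ℝ≥0∞} (hF : Measurable F) (n k : ℕ) :
    Measurable (passageFun birth death F n k) :=
  .ite (measurableSet_singleton _) measurable_const <|
    Measurable.lintegral_prod_right' (f := fun z : ℝ≥0∞ × ℝ => F (z.1.toReal + z.2)) (by fun_prop)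

lemma passageFun_succ_of_ne {F : ℝ → ℝ≥0∞} (hF : Measurable F) (n : ℕ) {k : ℕ} (hk : k ≠ 0)
    {t : ℝ≥0∞} (ht : t ≠ ⊤) : passageFun birth death F (n + 1) k t =
      birth k * ∫⁻ x, passageFun birth death F n (k + 1) (t + ENNReal.ofReal x)
        ∂expDens (bdRate birth death k) +
      death k * ∫⁻ x, passageFun birth death F n (k - 1) (t + ENNReal.ofReal x)
        ∂expDens (bdRate birth death k) := by
  have hshift : ∀ l, ∫⁻ x, passageFun birth death F n l (t + ENNReal.ofReal x)
        ∂expDens (bdRate birth death k) =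
      ∫⁻ x, ∫⁻ y, F (t.toReal + (x + y)) ∂expDens (bdRate birth death k)
        ∂passageLaw birth death n l := by
    intro l
    have hmeas : Measurable fun z : ℝ × ℝ => F (t.toReal + (z.2 + z.1)) := by fun_prop
    rw [← lintegral_lintegral_swap hmeas.aemeasurable]
    refine lintegral_congr_ae ?_
    filter_upwards [ae_expDens_pos (bdRate birth death k)] with x hx
    rw [passageFun, if_neg (by simp [ht]), ENNReal.toReal_add ht ENNReal.ofReal_ne_top,
      ENNReal.toReal_ofReal hx.le]
    exact lintegral_congr fun y => by rw [add_assoc, add_comm x]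
  rw [hshift, hshift, passageFun, if_neg ht, lintegral_passageLaw_succ n hk (by fun_prop)]

lemma bdStep_passageFun {F : ℝ → ℝ≥0∞} (hF : Measurable F) (n : ℕ) :
    bdStep birth death (passageFun birth death F n) = passageFun birth death F (n + 1) := by
  ext k t
  rcases eq_or_ne k 0 with rfl | hk
  · simp [bdStep, passageFun, passageLaw]
  rcases eq_or_ne t ⊤ with rfl | ht
  · simp [bdStep, passageFun]
  have hG : ∀ l, Measurable fun x => passageFun birth death F n l (t + x) := fun l =>
    (measurable_passageFun hF n l).comp (measurable_const.add measurable_id)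
  rw [bdStep, if_neg hk, tsum_bdJump_mul, passageFun_succ_of_ne hF n hk ht]
  rcases (bdRate_nonneg birth death k).eq_or_lt with hr | hr
  · have hzero : birth k = 0 ∧ death k = 0 := by
      simpa [bdRate, hk, add_eq_zero_iff_of_nonneg] using hr.symm
    rw [if_pos hr.symm, ← hr, expLaw_zero, lintegral_dirac' _ (hG k)]
    simp [hzero, passageFun]
  · rw [if_neg hr.ne', if_neg hk, lintegral_expLaw hr (hG _), lintegral_expLaw hr (hG _),
      ← mul_assoc, ← mul_assoc, ← ENNReal.ofReal_mul (by positivity),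
      ← ENNReal.ofReal_mul (by positivity), div_mul_cancel₀ _ hr.ne', div_mul_cancel₀ _ hr.ne',
      ENNReal.ofReal_coe_nnreal, ENNReal.ofReal_coe_nnreal]

namespace IsJumpHold

variable {Ω : Type*} [MeasurableSpace Ω] {P : Measure Ω} [IsProbabilityMeasure P] {Y : ℕ → Ω → ℕ}
  {H : ℕ → Ω → ℝ≥0∞} {x₀ : ℕ}

lemma setLIntegral_passageFun (h : IsJumpHold P Y H x₀ birth death) {F : ℝ → ℝ≥0∞}
    (hF : Measurable F) (m n : ℕ) :
    ∫⁻ ω in {ω | ∀ j < m, Y j ω ≠ 0},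
        passageFun birth death F n (Y m ω) (∑ k ∈ Finset.range m, H k ω) ∂P =
      ∫⁻ x, F x ∂passageLaw birth death (m + n) x₀ := by
  induction m generalizing n with
  | zero =>
    have hstart : ∀ᵐ ω ∂P, passageFun birth death F n (Y 0 ω) (∑ k ∈ Finset.range 0, H k ω) =
        ∫⁻ x, F x ∂passageLaw birth death n x₀ := by
      filter_upwards [h.ae_hold_zero_pos] with ω hω
      simp [hω.1, passageFun]
    simp only [not_lt_zero, IsEmpty.forall_iff, implies_true, Set.ofPred_true,
      Measure.restrict_univ, zero_add]
    rw [lintegral_congr_ae hstart, lintegral_const, measure_univ, mul_one]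
  | succ m ih =>
    rw [h.setLIntegral_bdStep m (measurable_passageFun hF n), bdStep_passageFun hF, ih (n + 1),
      Nat.succ_add_eq_add_succ]

end IsJumpHold

/-! ### Hitting times of right-continuous paths -/

section HittingTimes

variable {α : Type*} {A : Set α} {x : ℝ≥0 → α} {t : ℝ≥0}

/-- The hitting time of `A` by the path `x` (infinite if `A` is never reached). -/
def hitTime (A : Set α) (x : ℝ≥0 → α) : ℝ≥0∞ := ⨅ (t : ℝ≥0) (_ : x t ∈ A), (t : ℝ≥0∞)

/-- The hitting time of `A` along a countable dense set of times. Unlike `hitTime A`, it is a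
measurable function of the path for the product σ-algebra. -/
def hitTimeDense (A : Set α) (x : ℝ≥0 → α) : ℝ≥0∞ :=
  ⨅ (n : ℕ) (_ : x (TopologicalSpace.denseSeq ℝ≥0 n) ∈ A), (TopologicalSpace.denseSeq ℝ≥0 n : ℝ≥0∞)

/-- The path `x` is right-continuous for the discrete topology. -/
def RightConst (x : ℝ≥0 → α) : Prop := ∀ t, ∀ᶠ u in 𝓝[>] t, x u = x t

lemma hitTime_le (ht : x t ∈ A) : hitTime A x ≤ t := iInf₂_le t ht

lemma notMem_of_lt_hitTime (ht : (t : ℝ≥0∞) < hitTime A x) : x t ∉ A :=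
  fun hA => (hitTime_le hA).not_gt ht

lemma RightConst.exists_Ioo (hx : RightConst x) (t : ℝ≥0) :
    ∃ δ > t, ∀ u ∈ Set.Ioo t δ, x u = x t := by
  obtain ⟨δ, hδ, hsub⟩ := mem_nhdsGT_iff_exists_Ioo_subset.1 (hx t)
  exact ⟨δ, hδ, hsub⟩

lemma RightConst.hitTime_mem (hx : RightConst x) (ht : hitTime A x = t) : x t ∈ A := by
  by_contra hA
  obtain ⟨δ, hδ, hconst⟩ := hx.exists_Ioo t
  have hle : (δ : ℝ≥0∞) ≤ hitTime A x := by
    refine le_iInf₂ fun u hu => ENNReal.coe_le_coe.2 (not_lt.1 fun huδ => ?_)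
    have htu : t ≤ u := ENNReal.coe_le_coe.1 (ht ▸ hitTime_le hu)
    rcases htu.eq_or_lt with rfl | htu
    · exact hA hu
    · exact hA (hconst u ⟨htu, huδ⟩ ▸ hu)
  rw [ht, ENNReal.coe_le_coe] at hle
  exact hle.not_gt hδ

lemma RightConst.hitTimeDense_eq (hx : RightConst x) (A : Set α) :
    hitTimeDense A x = hitTime A x := by
  refine le_antisymm (le_iInf₂ fun t ht => ?_) (le_iInf₂ fun n hn => hitTime_le hn)
  obtain ⟨δ, hδ, hconst⟩ := hx.exists_Ioo t
  refine le_of_forall_gt_imp_ge_of_dense fun c hc => ?_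
  obtain ⟨d, htd, hdc⟩ := ENNReal.lt_iff_exists_nnreal_btwn.1 hc
  obtain ⟨n, hn⟩ := (TopologicalSpace.denseRange_denseSeq ℝ≥0).exists_mem_open isOpen_Ioo
    (Set.nonempty_Ioo.2 (lt_min hδ (ENNReal.coe_lt_coe.1 htd)))
  have hmem : x (TopologicalSpace.denseSeq ℝ≥0 n) ∈ A :=
    hconst _ ⟨hn.1, hn.2.trans_le (min_le_left _ _)⟩ ▸ ht
  exact (iInf₂_le n hmem).trans
    ((ENNReal.coe_le_coe.2 (hn.2.le.trans (min_le_right _ _))).trans hdc.le)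

lemma measurable_hitTimeDense [MeasurableSpace α] (hA : MeasurableSet A) :
    Measurable (hitTimeDense A) := by
  classical
  refine Measurable.iInf fun n => ?_
  simp only [iInf_eq_if]
  exact Measurable.ite (measurable_pi_apply _ hA) measurable_const measurable_const

end HittingTimes

lemma monotone_sum_range {R : Type*} [AddCommMonoid R] [PartialOrder R] [CanonicallyOrderedAdd R]
    (h : ℕ → R) : Monotone fun n => ∑ k ∈ Finset.range n, h k :=
  fun _ _ hmn => Finset.sum_le_sum_of_subset (Finset.range_mono hmn)

/-- The path `x` sits in `y n` during the `n`-th of the holding times `h`. -/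
structure FollowsJumps {α : Type*} (x : ℝ≥0 → α) (y : ℕ → α) (h : ℕ → ℝ≥0∞) : Prop where
  pos : ∀ k, 0 < h k
  eq : ∀ t : ℝ≥0, ∃ n : ℕ, ∑ k ∈ Finset.range n, h k ≤ t ∧
    (t : ℝ≥0∞) < ∑ k ∈ Finset.range (n + 1), h k ∧ x t = y n

namespace FollowsJumps

variable {α : Type*} {A : Set α} {x : ℝ≥0 → α} {y : ℕ → α} {h : ℕ → ℝ≥0∞} {n : ℕ}

lemma eq_of_mem (hx : FollowsJumps x y h) {t : ℝ≥0} (hle : ∑ k ∈ Finset.range n, h k ≤ t)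
    (hlt : (t : ℝ≥0∞) < ∑ k ∈ Finset.range (n + 1), h k) : x t = y n := by
  obtain ⟨m, hmle, hmlt, hm⟩ := hx.eq t
  have hnm : n < m + 1 := (monotone_sum_range h).reflect_lt (hle.trans_lt hmlt)
  have hmn : m < n + 1 := (monotone_sum_range h).reflect_lt (hmle.trans_lt hlt)
  rw [hm, show m = n by omega]

lemma rightConst (hx : FollowsJumps x y h) : RightConst x := by
  intro t
  obtain ⟨n, hle, hlt, hxt⟩ := hx.eq t
  have hnear : ∀ᶠ u : ℝ≥0 in 𝓝[>] t, (u : ℝ≥0∞) < ∑ k ∈ Finset.range (n + 1), h k :=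
    nhdsWithin_le_nhds ((ENNReal.continuous_coe.tendsto t).eventually_lt_const hlt)
  filter_upwards [hnear, self_mem_nhdsWithin] with u hu htu
  rw [hxt, hx.eq_of_mem (hle.trans (ENNReal.coe_le_coe.2 (le_of_lt htu))) hu]

lemma hitTime_eq (hx : FollowsJumps x y h) (A : Set α) :
    hitTime A x = ⨅ (n : ℕ) (_ : y n ∈ A), ∑ k ∈ Finset.range n, h k := by
  refine le_antisymm (le_iInf₂ fun n hn => ?_) (le_iInf₂ fun t ht => ?_)
  · by_cases htop : ∑ k ∈ Finset.range n, h k = ⊤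
    · exact htop ▸ le_top
    lift ∑ k ∈ Finset.range n, h k to ℝ≥0 using htop with t ht
    refine hitTime_le (hx.eq_of_mem (n := n) ht.symm.le ?_ ▸ hn)
    rw [Finset.sum_range_succ, ← ht]
    exact ENNReal.lt_add_right ENNReal.coe_ne_top (hx.pos n).ne'
  · obtain ⟨n, hle, -, hxt⟩ := hx.eq t
    exact (iInf₂_le n (hxt ▸ ht)).trans hle

lemma hitTime_eq_jumpTime (hx : FollowsJumps x y h) (hn : y n ∈ A) (hlt : ∀ j < n, y j ∉ A) :
    hitTime A x = ∑ k ∈ Finset.range n, h k := by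
  rw [hx.hitTime_eq]
  refine le_antisymm (iInf₂_le n hn) (le_iInf₂ fun m hm => monotone_sum_range h ?_)
  exact not_lt.1 fun hmn => hlt m hmn hm

lemma hitTime_mem_iff (hx : FollowsJumps x y h) {B : Set ℝ} :
    hitTime A x ≠ ⊤ ∧ (hitTime A x).toReal ∈ B ↔ ∃ n, (∀ j < n, y j ∉ A) ∧ y n ∈ A ∧
      ∑ k ∈ Finset.range n, h k ≠ ⊤ ∧ (∑ k ∈ Finset.range n, h k).toReal ∈ B := by
  classical
  constructor
  · intro hB
    have hex : ∃ n, y n ∈ A := by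
      by_contra! hne
      exact hB.1 (by simp [hx.hitTime_eq, hne])
    have hmin : ∀ j < Nat.find hex, y j ∉ A := fun j hj => Nat.find_min hex hj
    rw [hx.hitTime_eq_jumpTime (Nat.find_spec hex) hmin] at hB
    exact ⟨Nat.find hex, hmin, Nat.find_spec hex, hB⟩
  · rintro ⟨n, hlt, hn, hB⟩
    rwa [hx.hitTime_eq_jumpTime hn hlt]

lemma hitTime_eq_hold_zero (hx : FollowsJumps x y h) (hzero : y 0 ∉ A)
    (hone : y 1 ∈ A ∨ h 0 = ⊤) : hitTime A x = h 0 := by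
  rw [hx.hitTime_eq]
  refine le_antisymm ?_ (le_iInf₂ fun n hn => ?_)
  · rcases hone with hone | htop
    · exact (iInf₂_le 1 hone).trans_eq (Finset.sum_range_one _)
    · exact htop ▸ le_top
  · rcases n with _ | n
    · exact absurd hn hzero
    · exact Finset.single_le_sum_of_canonicallyOrdered (Finset.mem_range.2 n.succ_pos)

end FollowsJumps

/-! ### First-passage times of birth-death processes -/

variable {Ω : Type*} [MeasurableSpace Ω] {P : Measure Ω} {X : ℝ≥0 → Ω → ℕ} {Y : ℕ → Ω → ℕ}
  {H : ℕ → Ω → ℝ≥0∞} {x₀ : ℕ} {birth death : ℕ → ℝ≥0}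

lemma firstPassage_eq_hitTime {Ω : Type*} (X : ℝ≥0 → Ω → ℕ) (ω : Ω) :
    firstPassage X ω = hitTime {0} (fun t => X t ω) := rfl

lemma IsJumpHold.measurableSet_forall_lt_ne_zero (h : IsJumpHold P Y H x₀ birth death) (n : ℕ) :
    MeasurableSet {ω | ∀ j < n, Y j ω ≠ 0} := by
  simp only [Set.ofPred_forall]
  exact MeasurableSet.iInter fun j => MeasurableSet.iInter fun _ =>
    (h.chain j (measurableSet_singleton 0)).compl

variable [IsProbabilityMeasure P]

lemma IsJumpHold.measure_passage (h : IsJumpHold P Y H x₀ birth death) (n : ℕ) {B : Set ℝ}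
    (hB : MeasurableSet B) :
    P ({ω | ∀ j < n, Y j ω ≠ 0} ∩ {ω | Y n ω = 0 ∧ ∑ k ∈ Finset.range n, H k ω ≠ ⊤ ∧
      (∑ k ∈ Finset.range n, H k ω).toReal ∈ B}) = passageLaw birth death n x₀ B := by
  set E := {ω | Y n ω = 0 ∧ ∑ k ∈ Finset.range n, H k ω ≠ ⊤ ∧
    (∑ k ∈ Finset.range n, H k ω).toReal ∈ B}
  have hS := h.measurable_jumpTime n
  have hE : MeasurableSet E := (h.chain n (measurableSet_singleton 0)).inter
    ((hS (measurableSet_singleton ⊤).compl).inter (hS.ennreal_toReal hB))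
  classical
  have hindicator : ∀ ω, passageFun birth death (B.indicator 1) 0 (Y n ω)
      (∑ k ∈ Finset.range n, H k ω) = E.indicator 1 ω := by
    intro ω
    rw [Set.indicator_apply, passageFun, passageLaw]
    by_cases hY : Y n ω = 0
    · have hshift : Measurable fun x =>
          B.indicator (1 : ℝ → ℝ≥0∞) ((∑ k ∈ Finset.range n, H k ω).toReal + x) :=
        (measurable_one.indicator hB).comp (measurable_const_add _)
      rw [if_pos hY, lintegral_dirac' _ hshift, add_zero, Set.indicator_apply]
      simp only [E, Set.mem_ofPred_eq, hY, true_and]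
      split_ifs <;> first | rfl | (exfalso; tauto)
    · simp [hY, E]
  have hint := h.setLIntegral_passageFun (measurable_one.indicator hB) n 0
  rw [lintegral_indicator_one hB, add_zero, lintegral_congr hindicator,
    lintegral_indicator_one hE, Measure.restrict_apply hE] at hint
  rw [Set.inter_comm, hint]

namespace IsBirthDeath

lemma exists_jumpHold (h : IsBirthDeath P X x₀ birth death) :
    ∃ (Y : ℕ → Ω → ℕ) (H : ℕ → Ω → ℝ≥0∞), IsJumpHold P Y H x₀ birth death ∧
      ∀ᵐ ω ∂P, FollowsJumps (fun t => X t ω) (fun n => Y n ω) (fun n => H n ω) := by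
  obtain ⟨Y, H, hY, hH, hlaw, hX⟩ := h.jumpHold
  have hJ : IsJumpHold P Y H x₀ birth death := ⟨hY, hH, hlaw⟩
  refine ⟨Y, H, hJ, ?_⟩
  filter_upwards [hJ.ae_hold_pos, hX] with ω hpos hω
  exact ⟨hpos, hω⟩

lemma ae_rightConst (h : IsBirthDeath P X x₀ birth death) :
    ∀ᵐ ω ∂P, RightConst (fun t => X t ω) := by
  obtain ⟨Y, H, -, hX⟩ := h.exists_jumpHold
  filter_upwards [hX] with ω hω using hω.rightConst

lemma measure_firstPassage (h : IsBirthDeath P X x₀ birth death) {B : Set ℝ}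
    (hB : MeasurableSet B) : P {ω | firstPassage X ω ≠ ⊤ ∧ (firstPassage X ω).toReal ∈ B} =
      firstPassageLaw birth death x₀ B := by
  obtain ⟨Y, H, hJ, hX⟩ := h.exists_jumpHold
  set E : ℕ → Set Ω := fun n => {ω | ∀ j < n, Y j ω ≠ 0} ∩
    {ω | Y n ω = 0 ∧ ∑ k ∈ Finset.range n, H k ω ≠ ⊤ ∧ (∑ k ∈ Finset.range n, H k ω).toReal ∈ B}
  have hE : ∀ n, MeasurableSet (E n) := fun n =>
    have hS := hJ.measurable_jumpTime n
    (hJ.measurableSet_forall_lt_ne_zero n).inter <|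
      (hJ.chain n (measurableSet_singleton 0)).inter <|
        (hS (measurableSet_singleton ⊤).compl).inter (hS.ennreal_toReal hB)
  have hdisj : Pairwise (Function.onFun Disjoint E) := by
    refine pairwise_disjoint_on E |>.2 fun m n hmn => Set.disjoint_left.2 fun ω hm hn => ?_
    exact hn.1 m hmn hm.2.1
  have hevent : {ω | firstPassage X ω ≠ ⊤ ∧ (firstPassage X ω).toReal ∈ B} =ᵐ[P] ⋃ n, E n := by
    rw [eventuallyEq_set]
    filter_upwards [hX] with ω hω
    rw [Set.mem_iUnion]
    exact hω.hitTime_mem_iff (A := {0})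
  rw [measure_congr hevent, measure_iUnion hdisj hE, firstPassageLaw, Measure.sum_apply _ hB]
  exact tsum_congr fun n => hJ.measure_passage n hB

lemma isFiniteMeasure_firstPassageLaw (h : IsBirthDeath P X x₀ birth death) :
    IsFiniteMeasure (firstPassageLaw birth death x₀) := by
  constructor
  rw [← h.measure_firstPassage MeasurableSet.univ]
  exact measure_lt_top _ _

lemma exists_isDensity (h : IsBirthDeath P X x₀ birth death) (hx : x₀ ≠ 0) :
    ∃ f, IsDensity P (firstPassage X) f := by
  have := h.isFiniteMeasure_firstPassageLaw
  set f := (firstPassageLaw birth death x₀).rnDeriv (volume.restrict (Set.Ioi 0))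
  refine ⟨fun x => (f x).toReal, (Measure.measurable_rnDeriv _ _).ennreal_toReal,
    fun x => ENNReal.toReal_nonneg, fun B hB => ?_⟩
  have hfinite : ∀ᵐ x ∂volume.restrict (Set.Ioi 0), ENNReal.ofReal (f x).toReal = f x := by
    filter_upwards [Measure.rnDeriv_lt_top (firstPassageLaw birth death x₀) _] with x hx
    exact ENNReal.ofReal_toReal hx.ne
  rw [h.measure_firstPassage hB, ← Measure.restrict_restrict hB,
    lintegral_congr_ae (ae_restrict_of_ae hfinite),
    Measure.setLIntegral_rnDeriv (firstPassageLaw_absolutelyContinuous hx)]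

lemma withDensity_eq (h : IsBirthDeath P X x₀ birth death) {f : ℝ → ℝ}
    (hf : IsDensity P (firstPassage X) f) :
    (volume.restrict (Set.Ioi 0)).withDensity (fun x => ENNReal.ofReal (f x)) =
      firstPassageLaw birth death x₀ := by
  ext B hB
  rw [withDensity_apply _ hB, Measure.restrict_restrict hB, ← hf.eq B hB,
    h.measure_firstPassage hB]

end IsBirthDeath

/-! ### Poisson processes -/

section Poisson

variable {a : ℝ≥0}

lemma bdRate_poisson (a : ℝ≥0) (k : ℕ) : bdRate (fun _ => a) (fun _ => 0) k = a := by
  simp [bdRate]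

lemma IsJumpHold.ae_poisson_chain_one (h : IsJumpHold P Y H 0 (fun _ => a) (fun _ => 0))
    (ha : a ≠ 0) : ∀ᵐ ω ∂P, Y 1 ω = 1 := by
  have hone : P (pathEvent Y 1 id) = 1 := by
    rw [h.measure_pathEvent]
    simp [pathWeight, bdJump, bdRate_poisson, ha]
  filter_upwards [(mem_ae_iff_prob_eq_one (h.measurableSet_pathEvent 1 id)).2 hone] with ω hω
  exact hω 1 le_rfl

lemma IsJumpHold.map_poisson_hold (h : IsJumpHold P Y H 0 (fun _ => a) (fun _ => 0)) :
    P.map (H 0) = expLaw a := by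
  refine map_eq_expLaw (h.hold 0) a.coe_nonneg fun t => ?_
  have hlaw := h.measure_pathEvent_inter_lt 0 (fun _ => 0) fun _ => t
  rw [zero_add, Finset.prod_range_one, bdRate_poisson, expLaw_Ioi a.coe_nonneg] at hlaw
  rw [← one_mul (ENNReal.ofReal _), show 1 = pathWeight (fun _ => a) (fun _ => 0) 0 0 fun _ => 0 by
    simp [pathWeight], ← hlaw]
  refine measure_congr (eventuallyEq_set.2 ?_)
  filter_upwards [h.ae_hold_zero_pos] with ω hω
  simp [pathEvent, hω.1]

lemma IsBirthDeath.measure_lt_hitTime (h : IsBirthDeath P X 0 (fun _ => a) (fun _ => 0))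
    (t : ℝ≥0) : P {ω | (t : ℝ≥0∞) < hitTime {0}ᶜ (fun u => X u ω)} =
      ENNReal.ofReal (Real.exp (-(a * t))) := by
  obtain ⟨Y, H, hJ, hX⟩ := h.exists_jumpHold
  have hfirst : ∀ᵐ ω ∂P, Y 1 ω ∈ ({0}ᶜ : Set ℕ) ∨ H 0 ω = ⊤ := by
    rcases eq_or_ne a 0 with rfl | ha
    · have hdirac : ∀ᵐ x ∂P.map (H 0), x = ⊤ := by
        rw [hJ.map_poisson_hold, NNReal.coe_zero, expLaw_zero, ae_dirac_eq]
        exact rfl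
      filter_upwards [ae_of_ae_map (hJ.hold 0).aemeasurable hdirac] with ω hω using .inr hω
    · filter_upwards [hJ.ae_poisson_chain_one ha] with ω hω
      exact .inl (by simp [hω])
  have hhit : ∀ᵐ ω ∂P, hitTime {0}ᶜ (fun u => X u ω) = H 0 ω := by
    filter_upwards [hX, hJ.ae_hold_zero_pos, hfirst] with ω hω hzero hone
    exact hω.hitTime_eq_hold_zero (by simp [hzero.1]) hone
  rw [← expLaw_Ioi a.coe_nonneg t, ← hJ.map_poisson_hold,
    Measure.map_apply (hJ.hold 0) measurableSet_Ioi]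
  refine measure_congr (eventuallyEq_set.2 ?_)
  filter_upwards [hhit] with ω hω
  rw [hω, Set.mem_preimage, Set.mem_Ioi]

end Poisson

/-! ### Convergence of the continued fraction -/

/-- The approximants `μ_m / (λ_m + μ_m + s - λ_m (μ_{m+1} / ⋯))`, with `n` levels, of the ratio of
the transforms of the passage times from `m` and from `m - 1`. -/
def ladder {K : Type*} [Field K] (lam mu : ℕ → K) (s : K) : ℕ → ℕ → K
  | 0, _ => 0
  | n + 1, m => mu m / (lam m + mu m + s - lam m * ladder lam mu s n (m + 1))

/-- The denominator of the approximant `ladder lam mu s (n + 1) m`. -/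
def ladderDen {K : Type*} [Field K] (lam mu : ℕ → K) (s : K) (n m : ℕ) : K :=
  lam m + mu m + s - lam m * ladder lam mu s n (m + 1)

/-- The approximants at a complex point for real rates. -/
abbrev cladder (lam mu : ℕ → ℝ) (s : ℂ) (n m : ℕ) : ℂ :=
  ladder (fun k => (lam k : ℂ)) (fun k => (mu k : ℂ)) s n m

/-- The denominators of the approximants `cladder`. -/
abbrev cladderDen (lam mu : ℕ → ℝ) (s : ℂ) (n m : ℕ) : ℂ :=
  ladderDen (fun k => (lam k : ℂ)) (fun k => (mu k : ℂ)) s n m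

section Field

variable {K : Type*} [Field K] {lam mu : ℕ → K} {s : K}

lemma ladder_succ (n m : ℕ) :
    ladder lam mu s (n + 1) m = mu m / ladderDen lam mu s n m := rfl

lemma ladder_succ_sub_ladder_succ {n n' m : ℕ} (hn : ladderDen lam mu s n m ≠ 0)
    (hn' : ladderDen lam mu s n' m ≠ 0) :
    ladder lam mu s (n + 1) m - ladder lam mu s (n' + 1) m =
      mu m * lam m * (ladder lam mu s n (m + 1) - ladder lam mu s n' (m + 1)) /
        (ladderDen lam mu s n m * ladderDen lam mu s n' m) := by
  rw [ladder_succ, ladder_succ, div_sub_div _ _ hn hn']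
  congr 1
  rw [ladderDen, ladderDen]
  ring

end Field

lemma cladder_succ (lam mu : ℕ → ℝ) (s : ℂ) (n m : ℕ) :
    cladder lam mu s (n + 1) m = mu m / cladderDen lam mu s n m := rfl

lemma contFrac_eq_ladder {lam mu : ℕ → ℂ} {s : ℂ} {a b : ℕ → ℂ}
    (ha : ∀ k, 1 ≤ k → a k = -(lam (k - 1) * mu k)) (hb : ∀ k, b k = lam k + mu k + s)
    (n : ℕ) {m : ℕ} (hm : 1 ≤ m) :
    contFrac a b n m = -lam (m - 1) * ladder lam mu s n m := by
  induction n generalizing m with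
  | zero => rw [contFrac, ladder, mul_zero]
  | succ n ih =>
    rw [contFrac, ladder, ih (by omega), ha m hm, hb, Nat.add_sub_cancel]
    ring

lemma add_re_le_norm (x : ℝ) (s : ℂ) : x + s.re ≤ ‖(x : ℂ) + s‖ := by
  simpa using Complex.re_le_norm ((x : ℂ) + s)

/-- The rates are positive, and `h` is positive and superharmonic for the process killed at
rate `r`. -/
structure IsSupersolution (lam mu : ℕ → ℝ) (r : ℝ) (h : ℕ → ℝ) : Prop where
  lam_pos : ∀ k, 0 < lam k
  mu_pos : ∀ k, 1 ≤ k → 0 < mu k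
  pos : ∀ k, 0 < h k
  le : ∀ k, lam (k + 1) * h (k + 2) + mu (k + 1) * h k ≤
      (lam (k + 1) + mu (k + 1) + r) * h (k + 1)

namespace IsSupersolution

section Real

variable {lam mu : ℕ → ℝ} {r : ℝ} {h : ℕ → ℝ}

lemma mu_mul_div_le (hs : IsSupersolution lam mu r h) {m : ℕ} {x : ℝ}
    (hx : x ≤ h (m + 2) / h (m + 1)) :
    mu (m + 1) * h m / h (m + 1) ≤ lam (m + 1) + mu (m + 1) + r - lam (m + 1) * x := by
  have hlam : lam (m + 1) * x ≤ lam (m + 1) * (h (m + 2) / h (m + 1)) :=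
    mul_le_mul_of_nonneg_left hx (hs.lam_pos _).le
  have hsuper : mu (m + 1) * h m / h (m + 1) + lam (m + 1) * (h (m + 2) / h (m + 1)) ≤
      lam (m + 1) + mu (m + 1) + r := by
    rw [mul_div_assoc', ← add_div, div_le_iff₀ (hs.pos (m + 1))]
    linarith [hs.le m]
  linarith

lemma mu_mul_div_pos (hs : IsSupersolution lam mu r h) (m : ℕ) :
    0 < mu (m + 1) * h m / h (m + 1) :=
  div_pos (mul_pos (hs.mu_pos _ (by omega)) (hs.pos _)) (hs.pos _)

lemma ladder_le (hs : IsSupersolution lam mu r h) (n m : ℕ) :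
    ladder lam mu r n (m + 1) ≤ h (m + 1) / h m := by
  induction n generalizing m with
  | zero => exact (div_pos (hs.pos _) (hs.pos _)).le
  | succ n ih =>
    have hden := hs.mu_mul_div_le (ih (m + 1))
    rw [ladder, div_le_div_iff₀ ((hs.mu_mul_div_pos m).trans_le hden) (hs.pos m)]
    rw [div_le_iff₀ (hs.pos (m + 1))] at hden
    linarith

lemma ladderDen_pos (hs : IsSupersolution lam mu r h) (n m : ℕ) :
    0 < ladderDen lam mu r n (m + 1) :=
  (hs.mu_mul_div_pos m).trans_le (hs.mu_mul_div_le (hs.ladder_le n (m + 1)))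

end Real

variable {lam mu : ℕ → ℝ} {s : ℂ} {h : ℕ → ℝ}

lemma ladderDen_le_norm (hs : IsSupersolution lam mu s.re h) {n m : ℕ}
    (hle : ‖cladder lam mu s n (m + 2)‖ ≤ ladder lam mu s.re n (m + 2)) :
    ladderDen lam mu s.re n (m + 1) ≤ ‖cladderDen lam mu s n (m + 1)‖ := by
  have hrate := add_re_le_norm (lam (m + 1) + mu (m + 1)) s
  have hmul : ‖(lam (m + 1) : ℂ) * cladder lam mu s n (m + 2)‖ ≤
      lam (m + 1) * ladder lam mu s.re n (m + 2) := by
    rw [norm_mul, Complex.norm_real, Real.norm_of_nonneg (hs.lam_pos _).le]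
    exact mul_le_mul_of_nonneg_left hle (hs.lam_pos _).le
  have hsub := norm_sub_norm_le ((lam (m + 1) : ℂ) + mu (m + 1) + s)
    (lam (m + 1) * cladder lam mu s n (m + 2))
  rw [Complex.ofReal_add] at hrate
  simp only [ladderDen]
  linarith

lemma norm_cladder_le (hs : IsSupersolution lam mu s.re h) (n m : ℕ) :
    ‖cladder lam mu s n (m + 1)‖ ≤ ladder lam mu s.re n (m + 1) := by
  induction n generalizing m with
  | zero => exact norm_zero.le
  | succ n ih =>
    rw [cladder_succ, ladder_succ, norm_div, Complex.norm_real,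
      Real.norm_of_nonneg (hs.mu_pos _ (by omega)).le]
    exact div_le_div_of_nonneg_left (hs.mu_pos _ (by omega)).le (hs.ladderDen_pos n m)
      (hs.ladderDen_le_norm (ih (m + 1)))

lemma ladderDen_le_norm_cladderDen (hs : IsSupersolution lam mu s.re h) (n m : ℕ) :
    ladderDen lam mu s.re n (m + 1) ≤ ‖cladderDen lam mu s n (m + 1)‖ :=
  hs.ladderDen_le_norm (hs.norm_cladder_le n (m + 1))

lemma cladderDen_ne_zero (hs : IsSupersolution lam mu s.re h) (n m : ℕ) :
    cladderDen lam mu s n (m + 1) ≠ 0 :=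
  norm_pos_iff.1 ((hs.ladderDen_pos n m).trans_le (hs.ladderDen_le_norm_cladderDen n m))

lemma norm_cladder_sub_le (hs : IsSupersolution lam mu s.re h) (n m : ℕ) :
    ‖cladder lam mu s (n + 1) (m + 1) - cladder lam mu s n (m + 1)‖ ≤
      ladder lam mu s.re (n + 1) (m + 1) - ladder lam mu s.re n (m + 1) := by
  induction n generalizing m with
  | zero => simpa only [ladder, sub_zero] using hs.norm_cladder_le 1 m
  | succ n ih =>
    have hmu : 0 ≤ mu (m + 1) := (hs.mu_pos _ (by omega)).le
    have hlam : 0 ≤ lam (m + 1) := (hs.lam_pos _).le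
    rw [ladder_succ_sub_ladder_succ (hs.ladderDen_pos (n + 1) m).ne' (hs.ladderDen_pos n m).ne',
      ladder_succ_sub_ladder_succ (hs.cladderDen_ne_zero (n + 1) m) (hs.cladderDen_ne_zero n m),
      norm_div, norm_mul, norm_mul, norm_mul, Complex.norm_real, Complex.norm_real,
      Real.norm_of_nonneg hmu, Real.norm_of_nonneg hlam]
    gcongr
    · exact mul_nonneg (mul_nonneg hmu hlam) ((norm_nonneg _).trans (ih (m + 1)))
    · exact mul_pos (hs.ladderDen_pos (n + 1) m) (hs.ladderDen_pos n m)
    · exact ih (m + 1)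
    · exact (hs.ladderDen_pos n m).le
    · exact hs.ladderDen_le_norm_cladderDen (n + 1) m
    · exact hs.ladderDen_le_norm_cladderDen n m

lemma exists_tendsto_cladder (hs : IsSupersolution lam mu s.re h) (m : ℕ) :
    ∃ R : ℂ, Tendsto (fun n => cladder lam mu s n (m + 1)) atTop (𝓝 R) := by
  refine cauchySeq_tendsto_of_complete (cauchySeq_of_dist_le_of_summable
    (fun n => ladder lam mu s.re (n + 1) (m + 1) - ladder lam mu s.re n (m + 1)) (fun n => ?_) ?_)
  · rw [dist_comm, dist_eq_norm]
    exact hs.norm_cladder_sub_le n m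
  · refine summable_of_sum_range_le (c := h (m + 1) / h m)
      (fun n => (norm_nonneg _).trans (hs.norm_cladder_sub_le n m)) fun n => ?_
    rw [Finset.sum_range_sub (fun n => ladder lam mu s.re n (m + 1))]
    simpa only [ladder, sub_zero] using hs.ladder_le n m

end IsSupersolution

/-- Transforms at `s` of the time of passage from `k` to `0` in `n` jumps, for the birth-death
process killed when it reaches the level `M`. -/
def killedTransform (lam mu : ℕ → ℝ) (s : ℂ) (M : ℕ) : ℕ → ℕ → ℂ
  | 0, k => if k = 0 then 1 else 0
  | n + 1, k => if 0 < k ∧ k < M then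
      (lam k * killedTransform lam mu s M n (k + 1) + mu k * killedTransform lam mu s M n (k - 1)) /
        (lam k + mu k + s)
      else 0

/-- `a n k` is the transform at `s` of the passage time from `k` to `0` in `n` jumps. -/
structure IsPassageTransform (lam mu : ℕ → ℝ) (s : ℂ) (a : ℕ → ℕ → ℂ) : Prop where
  zero : ∀ k, a 0 k = if k = 0 then 1 else 0
  succ_zero : ∀ n, a (n + 1) 0 = 0
  succ_succ : ∀ n k, a (n + 1) (k + 1) =
    (lam (k + 1) * a n (k + 2) + mu (k + 1) * a n k) / (lam (k + 1) + mu (k + 1) + s)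

/-- `β n k` is a summable majorant of the transforms of the passage times, satisfying the recursion
of the process killed at rate `r`. -/
structure IsPassageBound (lam mu : ℕ → ℝ) (r : ℝ) (β : ℕ → ℕ → ℝ) : Prop where
  nonneg : ∀ n k, 0 ≤ β n k
  zero : β 0 0 = 1
  succ_succ : ∀ n k, β (n + 1) (k + 1) * (lam (k + 1) + mu (k + 1) + r) =
    lam (k + 1) * β n (k + 2) + mu (k + 1) * β n k
  lam_nonneg : ∀ k, 0 ≤ lam k
  mu_nonneg : ∀ k, 0 ≤ mu k
  rate_pos : ∀ k, 0 < lam (k + 1) + mu (k + 1) + r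
  summable : ∀ k, Summable fun n => β n k

section Passage

variable {lam mu : ℕ → ℝ} {s : ℂ} {M : ℕ}

lemma killedTransform_succ (n : ℕ) {k : ℕ} (hk : k + 1 < M) :
    killedTransform lam mu s M (n + 1) (k + 1) =
      (lam (k + 1) * killedTransform lam mu s M n (k + 2) +
        mu (k + 1) * killedTransform lam mu s M n k) / (lam (k + 1) + mu (k + 1) + s) := by
  rw [killedTransform, if_pos ⟨k.succ_pos, hk⟩, Nat.add_sub_cancel]

lemma killedTransform_of_le (n : ℕ) {k : ℕ} (hk : M ≤ k) (h0 : k ≠ 0) :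
    killedTransform lam mu s M n k = 0 := by
  cases n with
  | zero => rw [killedTransform, if_neg h0]
  | succ n => rw [killedTransform, if_neg fun h => h.2.not_ge hk]

lemma killedTransform_succ_zero (n : ℕ) : killedTransform lam mu s M (n + 1) 0 = 0 := by
  rw [killedTransform, if_neg fun h => h.1.ne rfl]

lemma tsum_killedTransform_zero : ∑' n, killedTransform lam mu s M n 0 = 1 := by
  rw [tsum_eq_single 0 fun n hn => ?_, killedTransform, if_pos rfl]
  obtain ⟨n, rfl⟩ := Nat.exists_eq_succ_of_ne_zero hn
  exact killedTransform_succ_zero n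

lemma IsPassageTransform.killedTransform_eq {a : ℕ → ℕ → ℂ} (ha : IsPassageTransform lam mu s a)
    {n k : ℕ} (h : k + n < M) : killedTransform lam mu s M n k = a n k := by
  induction n generalizing k with
  | zero => rw [killedTransform, ha.zero]
  | succ n ih =>
    cases k with
    | zero => rw [killedTransform_succ_zero, ha.succ_zero]
    | succ k => rw [killedTransform_succ n (by omega), ha.succ_succ, ih (by omega), ih (by omega)]

namespace IsPassageBound

variable {β : ℕ → ℕ → ℝ}

lemma tsum_superharmonic {r : ℝ} (hβ : IsPassageBound lam mu r β) (k : ℕ) :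
    lam (k + 1) * (∑' n, β n (k + 2)) + mu (k + 1) * (∑' n, β n k) ≤
      (lam (k + 1) + mu (k + 1) + r) * ∑' n, β n (k + 1) := by
  rw [← tsum_mul_left, ← tsum_mul_left, ← ((hβ.summable (k + 2)).mul_left _).tsum_add
    ((hβ.summable k).mul_left _), mul_comm, ← tsum_mul_right]
  simp_rw [← hβ.succ_succ]
  rw [((hβ.summable (k + 1)).mul_right _).tsum_eq_zero_add]
  exact le_add_of_nonneg_left (mul_nonneg (hβ.nonneg _ _) (hβ.rate_pos k).le)

lemma tsum_pos {r : ℝ} (hβ : IsPassageBound lam mu r β) (hmu : ∀ k, 1 ≤ k → 0 < mu k) (k : ℕ) :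
    0 < ∑' n, β n k := by
  induction k with
  | zero =>
    have hle := (hβ.summable 0).le_tsum 0 fun n _ => hβ.nonneg n 0
    rw [hβ.zero] at hle
    exact one_pos.trans_le hle
  | succ k ih =>
    have hlam : 0 ≤ lam (k + 1) * ∑' n, β n (k + 2) :=
      mul_nonneg (hβ.lam_nonneg _) (tsum_nonneg fun n => hβ.nonneg _ _)
    exact pos_of_mul_pos_right ((add_pos_of_nonneg_of_pos hlam
      (mul_pos (hmu (k + 1) (by omega)) ih)).trans_le (hβ.tsum_superharmonic k)) (hβ.rate_pos k).le

lemma isSupersolution {r : ℝ} (hβ : IsPassageBound lam mu r β) (hlam : ∀ k, 0 < lam k)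
    (hmu : ∀ k, 1 ≤ k → 0 < mu k) : IsSupersolution lam mu r fun k => ∑' n, β n k where
  lam_pos := hlam
  mu_pos := hmu
  pos := hβ.tsum_pos hmu
  le := hβ.tsum_superharmonic

lemma rate_le_norm (hβ : IsPassageBound lam mu s.re β) (k : ℕ) :
    0 < ‖(lam (k + 1) : ℂ) + mu (k + 1) + s‖ ∧
      lam (k + 1) + mu (k + 1) + s.re ≤ ‖(lam (k + 1) : ℂ) + mu (k + 1) + s‖ := by
  have hle := add_re_le_norm (lam (k + 1) + mu (k + 1)) s
  rw [Complex.ofReal_add] at hle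
  exact ⟨(hβ.rate_pos k).trans_le hle, hle⟩

lemma norm_killedTransform_le (hβ : IsPassageBound lam mu s.re β) (M n k : ℕ) :
    ‖killedTransform lam mu s M n k‖ ≤ β n k := by
  induction n generalizing k with
  | zero =>
    obtain rfl | hk := eq_or_ne k 0
    · rw [killedTransform, if_pos rfl, hβ.zero, norm_one]
    · rw [killedTransform, if_neg hk, norm_zero]
      exact hβ.nonneg 0 k
  | succ n ih =>
    by_cases hk : 0 < k ∧ k < M
    · obtain ⟨k, rfl⟩ := Nat.exists_eq_succ_of_ne_zero hk.1.ne'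
      obtain ⟨hpos, hrate⟩ := hβ.rate_le_norm k
      rw [killedTransform_succ n hk.2, norm_div, div_le_iff₀ hpos]
      calc ‖(lam (k + 1) : ℂ) * killedTransform lam mu s M n (k + 2) +
              mu (k + 1) * killedTransform lam mu s M n k‖
          ≤ lam (k + 1) * ‖killedTransform lam mu s M n (k + 2)‖ +
              mu (k + 1) * ‖killedTransform lam mu s M n k‖ := by
            refine (norm_add_le _ _).trans_eq ?_
            rw [norm_mul, norm_mul, Complex.norm_real, Complex.norm_real,
              Real.norm_of_nonneg (hβ.lam_nonneg _), Real.norm_of_nonneg (hβ.mu_nonneg _)]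
        _ ≤ lam (k + 1) * β n (k + 2) + mu (k + 1) * β n k :=
            add_le_add (mul_le_mul_of_nonneg_left (ih _) (hβ.lam_nonneg _))
              (mul_le_mul_of_nonneg_left (ih _) (hβ.mu_nonneg _))
        _ = β (n + 1) (k + 1) * (lam (k + 1) + mu (k + 1) + s.re) := (hβ.succ_succ n k).symm
        _ ≤ β (n + 1) (k + 1) * ‖(lam (k + 1) : ℂ) + mu (k + 1) + s‖ :=
            mul_le_mul_of_nonneg_left hrate (hβ.nonneg _ _)
    · rw [killedTransform, if_neg hk, norm_zero]
      exact hβ.nonneg (n + 1) k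

lemma summable_killedTransform (hβ : IsPassageBound lam mu s.re β) (M k : ℕ) :
    Summable fun n => killedTransform lam mu s M n k :=
  Summable.of_norm_bounded (hβ.summable k) fun n => hβ.norm_killedTransform_le M n k

lemma tsum_killedTransform_succ (hβ : IsPassageBound lam mu s.re β) {k : ℕ} (hk : k + 1 < M) :
    (∑' n, killedTransform lam mu s M n (k + 1)) * (lam (k + 1) + mu (k + 1) + s) =
      lam (k + 1) * (∑' n, killedTransform lam mu s M n (k + 2)) +
        mu (k + 1) * ∑' n, killedTransform lam mu s M n k := by
  have hne : (lam (k + 1) : ℂ) + mu (k + 1) + s ≠ 0 := norm_pos_iff.1 (hβ.rate_le_norm k).1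
  have h0 : killedTransform lam mu s M 0 (k + 1) = 0 := by
    rw [killedTransform, if_neg k.succ_ne_zero]
  rw [(hβ.summable_killedTransform M (k + 1)).tsum_eq_zero_add, h0, zero_add, ← tsum_mul_left,
    ← tsum_mul_left, ← tsum_mul_right, ←
    ((hβ.summable_killedTransform M (k + 2)).mul_left _).tsum_add
      ((hβ.summable_killedTransform M k).mul_left _)]
  refine tsum_congr fun n => ?_
  rw [killedTransform_succ n hk, div_mul_cancel₀ _ hne]

lemma tsum_killedTransform_eq_cladder_mul (hβ : IsPassageBound lam mu s.re β)
    (hlam : ∀ k, 0 < lam k) (hmu : ∀ k, 1 ≤ k → 0 < mu k) {n m : ℕ} (hM : n + (m + 1) = M) :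
    ∑' j, killedTransform lam mu s M j (m + 1) =
      cladder lam mu s n (m + 1) * ∑' j, killedTransform lam mu s M j m := by
  induction n generalizing m with
  | zero =>
    simp_rw [killedTransform_of_le _ (show M ≤ m + 1 by omega) m.succ_ne_zero, ladder, tsum_zero,
      zero_mul]
  | succ n ih =>
    have hrec := hβ.tsum_killedTransform_succ (show m + 1 < M by omega)
    rw [ih (m := m + 1) (by omega)] at hrec
    rw [cladder_succ, div_mul_eq_mul_div,
      eq_div_iff ((hβ.isSupersolution hlam hmu).cladderDen_ne_zero n m), cladderDen,
      ladderDen, mul_sub, hrec]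
    ring

lemma tsum_killedTransform (hβ : IsPassageBound lam mu s.re β)
    (hlam : ∀ k, 0 < lam k) (hmu : ∀ k, 1 ≤ k → 0 < mu k) {k : ℕ} (hk : k < M) :
    ∑' n, killedTransform lam mu s M n k =
      ∏ m ∈ Finset.range k, cladder lam mu s (M - (m + 1)) (m + 1) := by
  induction k with
  | zero => rw [tsum_killedTransform_zero, Finset.prod_range_zero]
  | succ k ih =>
    rw [Finset.prod_range_succ, ← ih (by omega),
      hβ.tsum_killedTransform_eq_cladder_mul hlam hmu (n := M - (k + 1)) (by omega), mul_comm]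

/-- The process killed at the level `M` has only the approximants with finitely many levels as
ratios of its transforms; the majorant allows letting `M → ∞` in the sum over the jumps. -/
theorem exists_tendsto_cladder_tsum_eq {a : ℕ → ℕ → ℂ} (hβ : IsPassageBound lam mu s.re β)
    (ha : IsPassageTransform lam mu s a) (hlam : ∀ k, 0 < lam k) (hmu : ∀ k, 1 ≤ k → 0 < mu k)
    (q : ℕ) : ∃ R : ℕ → ℂ,
      (∀ m, Tendsto (fun n => cladder lam mu s n (m + 1)) atTop (𝓝 (R m))) ∧
      ∑' n, a n q = ∏ m ∈ Finset.range q, R m := by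
  choose R hR using fun m => (hβ.isSupersolution hlam hmu).exists_tendsto_cladder m
  refine ⟨R, hR, ?_⟩
  have htsum : Tendsto (fun M => ∑' n, killedTransform lam mu s M n q) atTop
      (𝓝 (∑' n, a n q)) := by
    refine tendsto_tsum_of_dominated_convergence (hβ.summable q) (fun n => ?_)
      (Eventually.of_forall fun M n => hβ.norm_killedTransform_le M n q)
    refine tendsto_const_nhds.congr' ?_
    filter_upwards [eventually_gt_atTop (q + n)] with M hM
    exact (ha.killedTransform_eq hM).symm
  have hprod : Tendsto (fun M => ∑' n, killedTransform lam mu s M n q) atTop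
      (𝓝 (∏ m ∈ Finset.range q, R m)) := by
    have hfin : Tendsto (fun M : ℕ => ∏ m ∈ Finset.range q,
        cladder lam mu s (M - (m + 1)) (m + 1)) atTop (𝓝 (∏ m ∈ Finset.range q, R m)) :=
      tendsto_finsetProd _ fun m _ => (hR m).comp (tendsto_sub_atTop_nat (m + 1))
    refine hfin.congr' ?_
    filter_upwards [eventually_gt_atTop q] with M hM
    exact (hβ.tsum_killedTransform hlam hmu hM).symm
  exact tendsto_nhds_unique htsum hprod

end IsPassageBound

end Passage

/-! ### Transforms of the first-passage law -/

/-- The real Laplace transform of a measure, with values in `[0, ∞]`. It decides for which `s` the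
integral in `laplaceMeasure` converges. -/
def expMoment (μ : Measure ℝ) (r : ℝ) : ℝ≥0∞ := ∫⁻ t, ENNReal.ofReal (Real.exp (-(r * t))) ∂μ

/-- The (two-sided) Laplace transform of a measure. -/
def laplaceMeasure (μ : Measure ℝ) (s : ℂ) : ℂ := ∫ t : ℝ, Complex.exp (-s * t) ∂μ

section Transforms

variable {μ ν : Measure ℝ} {s : ℂ}

lemma norm_cexp_neg_mul (s : ℂ) (t : ℝ) : ‖Complex.exp (-s * t)‖ = Real.exp (-(s.re * t)) := by
  rw [Complex.norm_exp, Complex.re_mul_ofReal, Complex.neg_re, neg_mul]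

lemma integrable_cexp_iff :
    Integrable (fun t : ℝ => Complex.exp (-s * t)) μ ↔ expMoment μ s.re < ⊤ := by
  have hm : AEStronglyMeasurable (fun t : ℝ => Complex.exp (-s * t)) μ :=
    (by fun_prop : Continuous fun t : ℝ => Complex.exp (-s * t)).aestronglyMeasurable
  simp only [Integrable, hm, true_and, hasFiniteIntegral_iff_norm, norm_cexp_neg_mul, expMoment]

lemma laplaceConverges_iff {f : ℝ → ℝ} (hf : Measurable f) (hf0 : ∀ x, 0 ≤ f x) :
    LaplaceConverges f s ↔ Integrable (fun t : ℝ => Complex.exp (-s * t))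
      ((volume.restrict (Set.Ioi 0)).withDensity fun x => ENNReal.ofReal (f x)) := by
  rw [integrable_withDensity_iff_integrable_smul' (by fun_prop) (by simp), LaplaceConverges,
    IntegrableOn]
  refine integrable_congr (ae_of_all _ fun t => ?_)
  simp [ENNReal.toReal_ofReal (hf0 t), mul_comm]

lemma laplace_eq_laplaceMeasure {f : ℝ → ℝ} (hf : Measurable f) (hf0 : ∀ x, 0 ≤ f x) (s : ℂ) :
    laplace f s = laplaceMeasure
      ((volume.restrict (Set.Ioi 0)).withDensity fun x => ENNReal.ofReal (f x)) s := by
  rw [laplaceMeasure, integral_withDensity_eq_integral_toReal_smul (by fun_prop) (by simp), laplace]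
  refine integral_congr_ae (ae_of_all _ fun t => ?_)
  simp [ENNReal.toReal_ofReal (hf0 t), mul_comm]

lemma expMoment_conv [SFinite ν] (r : ℝ) :
    expMoment (μ.conv ν) r = expMoment μ r * expMoment ν r := by
  have hexp : ∀ x y : ℝ, ENNReal.ofReal (Real.exp (-(r * (x + y)))) =
      ENNReal.ofReal (Real.exp (-(r * x))) * ENNReal.ofReal (Real.exp (-(r * y))) := by
    intro x y
    rw [← ENNReal.ofReal_mul (Real.exp_pos _).le, ← Real.exp_add, mul_add, neg_add]
  simp_rw [expMoment, Measure.lintegral_conv (by fun_prop : Measurable fun x : ℝ =>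
    ENNReal.ofReal (Real.exp (-(r * x)))), hexp]
  rw [← lintegral_mul_const _ (by fun_prop)]
  exact lintegral_congr fun x => lintegral_const_mul _ (by fun_prop)

lemma expMoment_add_measure (r : ℝ) : expMoment (μ + ν) r = expMoment μ r + expMoment ν r :=
  lintegral_add_measure _ _ _

lemma expMoment_smul_measure (c : ℝ≥0∞) (r : ℝ) : expMoment (c • μ) r = c * expMoment μ r :=
  lintegral_smul_measure _ _

lemma laplaceMeasure_add_measure (hμ : Integrable (fun t : ℝ => Complex.exp (-s * t)) μ)
    (hν : Integrable (fun t : ℝ => Complex.exp (-s * t)) ν) :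
    laplaceMeasure (μ + ν) s = laplaceMeasure μ s + laplaceMeasure ν s :=
  integral_add_measure hμ hν

lemma laplaceMeasure_conv [SFinite μ] [SFinite ν]
    (h : Integrable (fun t : ℝ => Complex.exp (-s * t)) (μ.conv ν)) :
    laplaceMeasure (μ.conv ν) s = laplaceMeasure μ s * laplaceMeasure ν s := by
  have hexp : ∀ x y : ℝ, Complex.exp (-s * ((x + y : ℝ) : ℂ)) =
      Complex.exp (-s * x) * Complex.exp (-s * y) := by
    intro x y
    rw [← Complex.exp_add, Complex.ofReal_add, mul_add]
  rw [laplaceMeasure, integral_conv h]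
  simp_rw [hexp, integral_const_mul, integral_mul_const, laplaceMeasure]

lemma laplaceMeasure_smul_conv [SFinite μ] [SFinite ν] {b : ℝ≥0}
    (h : Integrable (fun t : ℝ => Complex.exp (-s * t)) ((b : ℝ≥0∞) • μ.conv ν)) :
    laplaceMeasure ((b : ℝ≥0∞) • μ.conv ν) s = b * (laplaceMeasure μ s * laplaceMeasure ν s) := by
  rcases eq_or_ne b 0 with rfl | hb
  · simp [laplaceMeasure]
  have hconv := (integrable_smul_measure (ENNReal.coe_ne_zero.2 hb) ENNReal.coe_ne_top).1 h
  rw [← laplaceMeasure_conv hconv, laplaceMeasure, integral_smul_measure, ENNReal.coe_toReal,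
    Complex.real_smul, laplaceMeasure]

lemma lintegral_exp_Ioi {r : ℝ} (hr : 0 < r) (c : ℝ) :
    ∫⁻ x in Set.Ioi c, ENNReal.ofReal (Real.exp (-(r * x))) =
      ENNReal.ofReal (Real.exp (-(r * c)) / r) := by
  have hr' : -r < 0 := neg_neg_of_pos hr
  have hint := integral_exp_mul_Ioi hr' c
  have hi := integrableOn_exp_mul_Ioi hr' c
  simp only [neg_mul] at hint hi
  rw [← ofReal_integral_eq_lintegral_ofReal hi (ae_of_all _ fun x => (Real.exp_pos _).le), hint,
    neg_div_neg_eq]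

lemma expMoment_expDens (c r : ℝ) :
    expMoment (expDens c) r =
      ∫⁻ x in Set.Ioi 0, ENNReal.ofReal (Real.exp (-((c + r) * x))) := by
  rw [expMoment, expDens, lintegral_withDensity_eq_lintegral_mul _ (by fun_prop) (by fun_prop)]
  refine lintegral_congr fun x => ?_
  rw [Pi.mul_apply, ← ENNReal.ofReal_mul (Real.exp_pos _).le, ← Real.exp_add, add_mul, neg_add]

lemma expMoment_expDens_of_pos {c r : ℝ} (h : 0 < c + r) :
    expMoment (expDens c) r = ENNReal.ofReal (1 / (c + r)) := by
  rw [expMoment_expDens, lintegral_exp_Ioi h, mul_zero, neg_zero, Real.exp_zero]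

lemma expMoment_expDens_of_nonpos {c r : ℝ} (h : c + r ≤ 0) : expMoment (expDens c) r = ⊤ := by
  rw [expMoment_expDens, eq_top_iff]
  calc (⊤ : ℝ≥0∞) = ∫⁻ _ in Set.Ioi (0 : ℝ), 1 := by simp
    _ ≤ _ := by
      refine setLIntegral_mono' measurableSet_Ioi fun x hx => ?_
      rw [ENNReal.one_le_ofReal, Real.one_le_exp_iff]
      exact neg_nonneg.2 (mul_nonpos_of_nonpos_of_nonneg h (le_of_lt hx))

lemma expMoment_expDens_ne_zero (c r : ℝ) : expMoment (expDens c) r ≠ 0 := by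
  rcases lt_or_ge 0 (c + r) with h | h
  · simp [expMoment_expDens_of_pos h, h]
  · simp [expMoment_expDens_of_nonpos h]

lemma laplaceMeasure_expDens {c : ℝ} (h : 0 < c + s.re) :
    laplaceMeasure (expDens c) s = 1 / (c + s) := by
  have hre : (-((c : ℂ) + s)).re < 0 := by
    rw [Complex.neg_re, Complex.add_re, Complex.ofReal_re]; exact neg_neg_of_pos h
  calc laplaceMeasure (expDens c) s
      = ∫ t : ℝ in Set.Ioi 0, Complex.exp (-((c : ℂ) + s) * t) := by
        rw [laplaceMeasure, expDens,
          integral_withDensity_eq_integral_toReal_smul (by fun_prop) (by simp)]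
        refine integral_congr_ae (ae_of_all _ fun t => ?_)
        dsimp only
        rw [ENNReal.toReal_ofReal (Real.exp_pos _).le, Complex.real_smul, Complex.ofReal_exp,
          ← Complex.exp_add]
        push_cast
        ring_nf
    _ = 1 / (c + s) := by
        rw [integral_exp_mul_complex_Ioi hre, Complex.ofReal_zero, mul_zero, Complex.exp_zero,
          neg_div_neg_eq]

end Transforms

variable {birth death : ℕ → ℝ≥0}

lemma expMoment_passageLaw_zero (r : ℝ) (k : ℕ) :
    expMoment (passageLaw birth death 0 k) r = if k = 0 then 1 else 0 := by
  rw [expMoment, passageLaw]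
  split_ifs
  · simp [lintegral_dirac' _
      (by fun_prop : Measurable fun t : ℝ => ENNReal.ofReal (Real.exp (-(r * t))))]
  · exact lintegral_zero_measure _

lemma expMoment_passageLaw_succ_zero (r : ℝ) (n : ℕ) :
    expMoment (passageLaw birth death (n + 1) 0) r = 0 := by
  simp [expMoment, passageLaw]

lemma expMoment_passageLaw_succ (r : ℝ) (n k : ℕ) :
    expMoment (passageLaw birth death (n + 1) (k + 1)) r =
      expMoment (expDens (bdRate birth death (k + 1))) r *
        (birth (k + 1) * expMoment (passageLaw birth death n (k + 2)) r +
          death (k + 1) * expMoment (passageLaw birth death n k) r) := by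
  rw [passageLaw_succ_of_ne n k.add_one_ne_zero, expMoment_add_measure, expMoment_smul_measure,
    expMoment_smul_measure, expMoment_conv, expMoment_conv, Nat.add_sub_cancel]
  ring

lemma laplaceMeasure_passageLaw_zero (s : ℂ) (k : ℕ) :
    laplaceMeasure (passageLaw birth death 0 k) s = if k = 0 then 1 else 0 := by
  rw [laplaceMeasure, passageLaw]
  split_ifs
  · simp [integral_dirac]
  · exact integral_zero_measure _

lemma laplaceMeasure_passageLaw_succ_zero (s : ℂ) (n : ℕ) :
    laplaceMeasure (passageLaw birth death (n + 1) 0) s = 0 := by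
  simp [laplaceMeasure, passageLaw]

lemma laplaceMeasure_passageLaw_succ {s : ℂ} {n k : ℕ}
    (hrate : 0 < bdRate birth death (k + 1) + s.re)
    (h : expMoment (passageLaw birth death (n + 1) (k + 1)) s.re < ⊤) :
    laplaceMeasure (passageLaw birth death (n + 1) (k + 1)) s =
      (birth (k + 1) * laplaceMeasure (passageLaw birth death n (k + 2)) s +
        death (k + 1) * laplaceMeasure (passageLaw birth death n k) s) /
          (bdRate birth death (k + 1) + s) := by
  rw [← integrable_cexp_iff, passageLaw_succ_of_ne n k.add_one_ne_zero, integrable_add_measure] at h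
  rw [passageLaw_succ_of_ne n k.add_one_ne_zero, laplaceMeasure_add_measure h.1 h.2,
    laplaceMeasure_smul_conv h.1, laplaceMeasure_smul_conv h.2, laplaceMeasure_expDens hrate,
    Nat.add_sub_cancel]
  ring

lemma expMoment_firstPassageLaw (r : ℝ) (k : ℕ) :
    expMoment (firstPassageLaw birth death k) r =
      ∑' n, expMoment (passageLaw birth death n k) r :=
  lintegral_sum_measure _ _

lemma laplaceMeasure_firstPassageLaw {s : ℂ} {k : ℕ}
    (h : Integrable (fun t : ℝ => Complex.exp (-s * t)) (firstPassageLaw birth death k)) :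
    laplaceMeasure (firstPassageLaw birth death k) s =
      ∑' n, laplaceMeasure (passageLaw birth death n k) s :=
  (hasSum_integral_measure h).tsum_eq.symm

/-! ### Pure death -/

lemma expMoment_death_eq_zero (r : ℝ) {n k : ℕ} (h : n ≠ k) :
    expMoment (passageLaw (fun _ => 0) death n k) r = 0 := by
  induction n generalizing k with
  | zero => rw [expMoment_passageLaw_zero, if_neg h.symm]
  | succ n ih =>
    rcases k with _ | k
    · exact expMoment_passageLaw_succ_zero r n
    · rw [expMoment_passageLaw_succ, ih (k := k) (by omega), ENNReal.coe_zero, zero_mul, mul_zero,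
        add_zero, mul_zero]

lemma bdRate_death_succ_add_pos {r : ℝ} {q k : ℕ} (hr : ∀ k ∈ Finset.Icc 1 q, -(death k : ℝ) < r)
    (hk : k + 1 ≤ q) : 0 < bdRate (fun _ => 0) death (k + 1) + r := by
  have hk' := hr (k + 1) (Finset.mem_Icc.2 ⟨by omega, hk⟩)
  rw [bdRate, if_neg k.succ_ne_zero, NNReal.coe_zero, zero_add]
  linarith

lemma expMoment_death_lt_top {r : ℝ} {q : ℕ} (hr : ∀ k ∈ Finset.Icc 1 q, -(death k : ℝ) < r)
    (n : ℕ) {k : ℕ} (hk : k ≤ q) : expMoment (passageLaw (fun _ => 0) death n k) r < ⊤ := by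
  induction n generalizing k with
  | zero => rw [expMoment_passageLaw_zero]; split_ifs <;> simp
  | succ n ih =>
    rcases k with _ | k
    · rw [expMoment_passageLaw_succ_zero]; exact ENNReal.zero_lt_top
    · rw [expMoment_passageLaw_succ, expMoment_expDens_of_pos (bdRate_death_succ_add_pos hr hk),
        ENNReal.coe_zero, zero_mul, zero_add]
      exact ENNReal.mul_lt_top ENNReal.ofReal_lt_top
        (ENNReal.mul_lt_top ENNReal.coe_lt_top (ih (by omega)))

lemma deathTransform_succ (ν : ℕ → ℝ≥0) (q : ℕ) (s : ℂ) :
    deathTransform ν (q + 1) s =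
      deathTransform ν q s * (((ν (q + 1) : ℝ) : ℂ) / (((ν (q + 1) : ℝ) : ℂ) + s)) :=
  Finset.prod_Icc_succ_top (by omega) _

lemma laplaceMeasure_death {s : ℂ} {q : ℕ} (hr : ∀ k ∈ Finset.Icc 1 q, -(death k : ℝ) < s.re)
    (n : ℕ) {k : ℕ} (hk : k ≤ q) :
    laplaceMeasure (passageLaw (fun _ => 0) death n k) s =
      if n = k then deathTransform death k s else 0 := by
  induction n generalizing k with
  | zero =>
    rw [laplaceMeasure_passageLaw_zero]
    rcases k with _ | k
    · simp [deathTransform]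
    · rfl
  | succ n ih =>
    rcases k with _ | k
    · exact laplaceMeasure_passageLaw_succ_zero s n
    · rw [laplaceMeasure_passageLaw_succ (bdRate_death_succ_add_pos hr hk)
        (expMoment_death_lt_top hr _ hk), ih (k := k) (by omega), deathTransform_succ]
      rcases eq_or_ne n k with rfl | h
      · simp only [NNReal.coe_zero, Complex.ofReal_zero, zero_mul, zero_add, if_true, bdRate,
          Nat.add_eq_zero_iff, one_ne_zero, and_false, if_false]
        ring
      · simp [h]

theorem laplaceMeasure_firstPassageLaw_death {s : ℂ} {q : ℕ}
    (hr : ∀ k ∈ Finset.Icc 1 q, -(death k : ℝ) < s.re) :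
    Integrable (fun t : ℝ => Complex.exp (-s * t)) (firstPassageLaw (fun _ => 0) death q) ∧
      laplaceMeasure (firstPassageLaw (fun _ => 0) death q) s = deathTransform death q s := by
  have hi : Integrable (fun t : ℝ => Complex.exp (-s * t))
      (firstPassageLaw (fun _ => 0) death q) := by
    rw [integrable_cexp_iff, expMoment_firstPassageLaw,
      tsum_eq_single q fun n hn => expMoment_death_eq_zero s.re hn]
    exact expMoment_death_lt_top hr q le_rfl
  refine ⟨hi, ?_⟩
  rw [laplaceMeasure_firstPassageLaw hi, tsum_eq_single q fun n hn => ?_,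
    laplaceMeasure_death hr q le_rfl, if_pos rfl]
  rw [laplaceMeasure_death hr n le_rfl, if_neg hn]

/-! ### Birth and death -/

lemma expMoment_firstPassageLaw_zero (r : ℝ) :
    expMoment (firstPassageLaw birth death 0) r = 1 := by
  rw [expMoment_firstPassageLaw, tsum_eq_single 0 fun n hn => ?_, expMoment_passageLaw_zero,
    if_pos rfl]
  obtain ⟨n, rfl⟩ := Nat.exists_eq_succ_of_ne_zero hn
  exact expMoment_passageLaw_succ_zero r n

lemma expMoment_firstPassageLaw_succ (r : ℝ) (k : ℕ) :
    expMoment (firstPassageLaw birth death (k + 1)) r =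
      expMoment (expDens (bdRate birth death (k + 1))) r *
        (birth (k + 1) * expMoment (firstPassageLaw birth death (k + 2)) r +
          death (k + 1) * expMoment (firstPassageLaw birth death k) r) := by
  simp_rw [expMoment_firstPassageLaw]
  rw [tsum_eq_zero_add' ENNReal.summable, expMoment_passageLaw_zero, if_neg k.succ_ne_zero,
    zero_add]
  simp_rw [expMoment_passageLaw_succ]
  rw [ENNReal.tsum_mul_left, ENNReal.tsum_add, ENNReal.tsum_mul_left, ENNReal.tsum_mul_left]

lemma expMoment_firstPassageLaw_neighbours_lt_top {r : ℝ} {k : ℕ} (hb : 0 < birth (k + 1))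
    (hd : 0 < death (k + 1)) (h : expMoment (firstPassageLaw birth death (k + 1)) r < ⊤) :
    expMoment (firstPassageLaw birth death (k + 2)) r < ⊤ ∧
      expMoment (firstPassageLaw birth death k) r < ⊤ := by
  rw [expMoment_firstPassageLaw_succ] at h
  obtain ⟨hup, hdown⟩ := ENNReal.add_lt_top.1
    (ENNReal.lt_top_of_mul_ne_top_right h.ne (expMoment_expDens_ne_zero _ r))
  exact ⟨ENNReal.lt_top_of_mul_ne_top_right hup.ne (ENNReal.coe_ne_zero.2 hb.ne'),
    ENNReal.lt_top_of_mul_ne_top_right hdown.ne (ENNReal.coe_ne_zero.2 hd.ne')⟩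

lemma expMoment_firstPassageLaw_lt_top {r : ℝ} (hb : ∀ k, 0 < birth k)
    (hd : ∀ k, 1 ≤ k → 0 < death k) {q : ℕ} (hq : 1 ≤ q)
    (h : expMoment (firstPassageLaw birth death q) r < ⊤) (k : ℕ) :
    expMoment (firstPassageLaw birth death k) r < ⊤ := by
  have hstep := fun k => expMoment_firstPassageLaw_neighbours_lt_top (r := r) (hb (k + 1))
    (hd (k + 1) (by omega))
  rcases le_total k q with hkq | hkq
  · refine Nat.decreasingInduction' (fun l _ _ hl => ?_) hkq h
    exact (hstep l hl).2
  · induction k, hkq using Nat.le_induction with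
    | base => exact h
    | succ k hqk ih =>
      obtain ⟨k, rfl⟩ := Nat.exists_eq_succ_of_ne_zero (show k ≠ 0 by omega)
      exact (hstep k ih).1

lemma expMoment_firstPassageLaw_ne_zero {r : ℝ} (hd : ∀ k, 1 ≤ k → 0 < death k) (k : ℕ) :
    expMoment (firstPassageLaw birth death k) r ≠ 0 := by
  induction k with
  | zero => rw [expMoment_firstPassageLaw_zero]; exact one_ne_zero
  | succ k ih =>
    rw [expMoment_firstPassageLaw_succ]
    exact mul_ne_zero (expMoment_expDens_ne_zero _ r) fun h =>
      mul_ne_zero (ENNReal.coe_ne_zero.2 (hd (k + 1) (by omega)).ne') ih (add_eq_zero.1 h).2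

lemma bdRate_add_pos_of_expMoment_lt_top {r : ℝ} (hd : ∀ k, 1 ≤ k → 0 < death k) {k : ℕ}
    (h : expMoment (firstPassageLaw birth death (k + 1)) r < ⊤) :
    0 < bdRate birth death (k + 1) + r := by
  by_contra hneg
  rw [expMoment_firstPassageLaw_succ, expMoment_expDens_of_nonpos (not_lt.1 hneg),
    ENNReal.top_mul fun h0 => ?_] at h
  · exact lt_irrefl _ h
  · exact mul_ne_zero (ENNReal.coe_ne_zero.2 (hd (k + 1) (by omega)).ne')
      (expMoment_firstPassageLaw_ne_zero hd k) (add_eq_zero.1 h0).2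

lemma bdRate_succ (k : ℕ) :
    bdRate birth death (k + 1) = (birth (k + 1) : ℝ) + death (k + 1) := by
  rw [bdRate, if_neg k.succ_ne_zero]

lemma isPassageBound_expMoment {r : ℝ} (hd : ∀ k, 1 ≤ k → 0 < death k)
    (h : ∀ k, expMoment (firstPassageLaw birth death k) r < ⊤) :
    IsPassageBound (fun k => birth k) (fun k => death k) r
      fun n k => (expMoment (passageLaw birth death n k) r).toReal where
  nonneg n k := ENNReal.toReal_nonneg
  zero := by rw [expMoment_passageLaw_zero, if_pos rfl, ENNReal.toReal_one]
  succ_succ n k := by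
    have hfin : ∀ l, expMoment (passageLaw birth death n l) r ≠ ⊤ := fun l =>
      ((ENNReal.le_tsum n).trans_lt ((expMoment_firstPassageLaw r l).symm.trans_lt (h l))).ne
    have hrate := bdRate_add_pos_of_expMoment_lt_top hd (h (k + 1))
    rw [expMoment_passageLaw_succ, expMoment_expDens_of_pos hrate, ← bdRate_succ,
      ENNReal.toReal_mul, ENNReal.toReal_add (ENNReal.mul_ne_top ENNReal.coe_ne_top (hfin _))
        (ENNReal.mul_ne_top ENNReal.coe_ne_top (hfin _)), ENNReal.toReal_mul, ENNReal.toReal_mul,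
      ENNReal.toReal_ofReal (by positivity), ENNReal.coe_toReal, ENNReal.coe_toReal]
    field_simp
  lam_nonneg k := (birth k).2
  mu_nonneg k := (death k).2
  rate_pos k := by
    rw [← bdRate_succ]
    exact bdRate_add_pos_of_expMoment_lt_top hd (h (k + 1))
  summable k := by
    exact ENNReal.summable_toReal ((expMoment_firstPassageLaw r k).symm.trans_lt (h k)).ne

lemma isPassageTransform_laplaceMeasure {s : ℂ} (hd : ∀ k, 1 ≤ k → 0 < death k)
    (h : ∀ k, expMoment (firstPassageLaw birth death k) s.re < ⊤) :
    IsPassageTransform (fun k => birth k) (fun k => death k) s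
      fun n k => laplaceMeasure (passageLaw birth death n k) s where
  zero := laplaceMeasure_passageLaw_zero s
  succ_zero := laplaceMeasure_passageLaw_succ_zero s
  succ_succ n k := by
    have hfin := (ENNReal.le_tsum (n + 1)).trans_lt
      ((expMoment_firstPassageLaw s.re (k + 1)).symm.trans_lt (h (k + 1)))
    rw [laplaceMeasure_passageLaw_succ (bdRate_add_pos_of_expMoment_lt_top hd (h (k + 1))) hfin,
      bdRate_succ, Complex.ofReal_add]

theorem exists_tendsto_cladder_laplaceMeasure (hb : ∀ k, 0 < birth k)
    (hd : ∀ k, 1 ≤ k → 0 < death k) {q : ℕ} (hq : 1 ≤ q) {s : ℂ}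
    (hi : Integrable (fun t : ℝ => Complex.exp (-s * t)) (firstPassageLaw birth death q)) :
    ∃ R : ℕ → ℂ,
      (∀ m, Tendsto (fun n => cladder (fun k => birth k) (fun k => death k) s n (m + 1)) atTop
        (𝓝 (R m))) ∧
      laplaceMeasure (firstPassageLaw birth death q) s = ∏ m ∈ Finset.range q, R m := by
  have hfin := expMoment_firstPassageLaw_lt_top hb hd hq (integrable_cexp_iff.1 hi)
  rw [laplaceMeasure_firstPassageLaw hi]
  exact (isPassageBound_expMoment hd hfin).exists_tendsto_cladder_tsum_eq
    (isPassageTransform_laplaceMeasure hd hfin) (fun k => hb k) (fun k hk => hd k hk) q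

/-! ### The mid-price of a book -/

section Quotes

variable {N a b : ℕ} {q : ℕ → ℤ} {p : Side → ℕ}

lemma bestAsk_le (h1 : 1 ≤ a) (hN : a ≤ N) (hq : 0 < q a) : bestAsk N q ≤ a :=
  Nat.sInf_le (Or.inl ⟨h1, hN, hq⟩)

lemma bestAsk_mem (N : ℕ) (q : ℕ → ℤ) :
    (1 ≤ bestAsk N q ∧ bestAsk N q ≤ N ∧ 0 < q (bestAsk N q)) ∨ bestAsk N q = N + 1 :=
  Nat.sInf_mem (s := {l | 1 ≤ l ∧ l ≤ N ∧ 0 < q l} ∪ {N + 1}) ⟨N + 1, Or.inr rfl⟩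

lemma bddAbove_bid (N : ℕ) (q : ℕ → ℤ) : BddAbove ({l | 1 ≤ l ∧ l ≤ N ∧ q l < 0} ∪ {0}) := by
  refine ⟨N, ?_⟩
  rintro l (⟨-, hl, -⟩ | rfl)
  exacts [hl, Nat.zero_le N]

lemma le_bestBid (h1 : 1 ≤ b) (hN : b ≤ N) (hq : q b < 0) : b ≤ bestBid N q :=
  le_csSup (bddAbove_bid N q) (Or.inl ⟨h1, hN, hq⟩)

lemma bestBid_mem (N : ℕ) (q : ℕ → ℤ) :
    (1 ≤ bestBid N q ∧ bestBid N q ≤ N ∧ q (bestBid N q) < 0) ∨ bestBid N q = 0 :=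
  Nat.sSup_mem (s := {l | 1 ≤ l ∧ l ≤ N ∧ q l < 0} ∪ {0}) ⟨0, Or.inr rfl⟩ (bddAbove_bid N q)

lemma le_bestAsk (ha : a ≤ N + 1) (hb : b < bestAsk N q)
    (hq : ∀ l, b < l → l < a → q l ≤ 0) : a ≤ bestAsk N q := by
  rcases bestAsk_mem N q with ⟨-, -, hpos⟩ | htop
  · by_contra! hlt
    exact (hq _ hb hlt).not_gt hpos
  · omega

lemma bestBid_le (ha : bestBid N q < a) (hq : ∀ l, b < l → l < a → 0 ≤ q l) :
    bestBid N q ≤ b := by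
  rcases bestBid_mem N q with ⟨-, -, hneg⟩ | hzero
  · by_contra! hlt
    exact (hq _ hlt ha).not_gt hneg
  · omega

lemma midPrice_congr {q' : ℕ → ℤ} (h : ∀ l ≤ N, q l = q' l) : midPrice N q = midPrice N q' := by
  have hask : {l | 1 ≤ l ∧ l ≤ N ∧ 0 < q l} = {l | 1 ≤ l ∧ l ≤ N ∧ 0 < q' l} :=
    Set.ext fun l => and_congr_right fun _ => and_congr_right fun hl => by rw [h l hl]
  have hbid : {l | 1 ≤ l ∧ l ≤ N ∧ q l < 0} = {l | 1 ≤ l ∧ l ≤ N ∧ q' l < 0} :=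
    Set.ext fun l => and_congr_right fun _ => and_congr_right fun hl => by rw [h l hl]
  simp only [midPrice, bestAsk, bestBid, hask, hbid]

/-- The mid-price of a book with best quotes `p`. -/
def quoteMid (p : Side → ℕ) : ℝ := ((p .bid : ℝ) + p .ask) / 2

lemma midPrice_eq_quoteMid (hb : 1 ≤ p .bid) (ha : p .ask ≤ N) (hp : p .bid < p .ask)
    (hu : bestBid N q < bestAsk N q) (hask : 0 < q (p .ask)) (hbid : q (p .bid) < 0)
    (hin : ∀ l, p .bid < l → l < p .ask → q l = 0) : midPrice N q = quoteMid p := by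
  have hA := bestAsk_le (hb.trans hp.le) ha hask
  have hB := le_bestBid hb (hp.le.trans ha) hbid
  rw [midPrice, quoteMid,
    hA.antisymm (le_bestAsk (by omega) (hB.trans_lt hu) fun l h1 h2 => (hin l h1 h2).le),
    (bestBid_le (hu.trans_le hA) fun l h1 h2 => (hin l h1 h2).ge).antisymm hB]

lemma midPrice_lt_quoteMid (ha1 : 1 ≤ a) (haN : a ≤ N) (hqa : 0 < q a)
    (hu : bestBid N q < bestAsk N q) (hin : ∀ l, b < l → l < a → 0 ≤ q l)
    (hab : b + a < p .bid + p .ask) : midPrice N q < quoteMid p := by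
  have hA := bestAsk_le ha1 haN hqa
  have hB := bestBid_le (hu.trans_le hA) hin
  have hlt : (bestBid N q : ℝ) + bestAsk N q < p .bid + p .ask :=
    mod_cast (add_le_add hB hA).trans_lt hab
  exact div_lt_div_of_pos_right hlt two_pos

lemma quoteMid_lt_midPrice (hb1 : 1 ≤ b) (hbN : b ≤ N) (hqb : q b < 0)
    (hu : bestBid N q < bestAsk N q) (hin : ∀ l, b < l → l < a → q l ≤ 0) (ha : a ≤ N + 1)
    (hab : p .bid + p .ask < b + a) : quoteMid p < midPrice N q := by
  have hB := le_bestBid hb1 hbN hqb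
  have hA := le_bestAsk ha (hB.trans_lt hu) hin
  have hlt : (p .bid : ℝ) + p .ask < bestBid N q + bestAsk N q :=
    mod_cast hab.trans_le (add_le_add hB hA)
  exact div_lt_div_of_pos_right hlt two_pos

end Quotes

/-! ### The first mid-price move along a path -/

section ActiveQueues

variable {p : Side → ℕ}

/-- The values of the process `Z s l`, `x = (s, l)`, that move the mid-price: a best queue has to be
depleted, and inside the spread an order has to arrive. -/
def eventSet (p : Side → ℕ) (x : Side × ℕ) : Set ℕ := if x.2 = p x.1 then {0} else {0}ᶜ

lemma Side.opp_ne (i : Side) : i.opp ≠ i := by cases i <;> exact nofun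

lemma Side.eq_opp_of_ne {s i : Side} (h : s ≠ i) : s = i.opp := by
  cases s <;> cases i <;> first | rfl | exact absurd rfl h

instance : DecidableEq Side := Classical.decEq Side

instance : Fintype Side := ⟨{.ask, .bid}, fun s => by cases s <;> simp⟩

instance finite_activeQueues (p : Side → ℕ) : Finite (activeQueues p) :=
  ((Set.finite_univ.prod (Set.finite_Icc (p .bid) (p .ask))).subset
    fun _ hx => ⟨trivial, hx.1, hx.2.1⟩ : (activeQueues p).Finite)

lemma mem_activeQueues_iff (hp : p .bid < p .ask) {s : Side} {l : ℕ} :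
    (s, l) ∈ activeQueues p ↔ l = p s ∨ (p .bid < l ∧ l < p .ask) := by
  cases s <;> simp only [activeQueues, Set.mem_ofPred_eq, ne_eq, Prod.mk.injEq, reduceCtorEq,
    true_and, false_and, not_false_eq_true, and_true] <;> omega

lemma ne_of_inside {s : Side} {l : ℕ} (hb : p .bid < l) (ha : l < p .ask) : l ≠ p s := by
  cases s <;> omega

lemma activeQueues_cases (hp : p .bid < p .ask) (i : Side) {x : Side × ℕ}
    (hx : x ∈ activeQueues p) :
    x = (i, p i) ∨ x = (i.opp, p i.opp) ∨ (p .bid < x.2 ∧ x.2 < p .ask) := by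
  obtain ⟨s, l⟩ := x
  rcases (mem_activeQueues_iff hp).1 hx with rfl | hin
  · by_cases hs : s = i
    · exact Or.inl (hs ▸ rfl)
    · exact Or.inr (Or.inl (Side.eq_opp_of_ne hs ▸ rfl))
  · exact Or.inr (Or.inr hin)

end ActiveQueues

/-- The first event of the path `z` of the order flow in the queue `x`. -/
def eventTime (p : Side → ℕ) (z : Side → ℕ → ℝ≥0 → ℕ) (x : Side × ℕ) : ℝ≥0∞ :=
  hitTime (eventSet p x) (z x.1 x.2)

/-- The time of the first move of the mid-price along the path `q` of a book. -/
def pathMoveTime (N : ℕ) (q : ℝ≥0 → ℕ → ℤ) : ℝ≥0∞ :=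
  hitTime {midPrice N (q 0)}ᶜ fun t => midPrice N (q t)

/-- `q` is a path of a book with initial best quotes `p` that follows the path `z` of the order flow
up to the first move of the mid-price, where `z i (p i)` is the position of an order in its queue.
Two events other than the execution of this order never happen at the same time. -/
structure BookPath (N : ℕ) (p : Side → ℕ) (i : Side) (z : Side → ℕ → ℝ≥0 → ℕ)
    (q : ℝ≥0 → ℕ → ℤ) : Prop where
  one_le : 1 ≤ p .bid
  le_N : p .ask ≤ N
  lt : p .bid < p .ask
  init : midPrice N (q 0) = quoteMid p
  rightCont : ∀ l t, ∀ᶠ u in 𝓝[>] t, q u l = q t l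
  uncrossed : ∀ t, bestBid N (q t) < bestAsk N (q t)
  follow : ∀ t, (∀ u < t, midPrice N (q u) = midPrice N (q 0)) →
    (z i (p i) t : ℤ) ≤ i.sgn * q t (p i) ∧
    q t (p i.opp) = i.opp.sgn * z i.opp (p i.opp) t ∧
    ∀ l, p .bid < l → l < p .ask → q t l = (z .ask l t : ℤ) - z .bid l t
  rightConst : ∀ x ∈ activeQueues p, RightConst (z x.1 x.2)
  noTie : ∀ x ∈ activeQueues p, ∀ y ∈ activeQueues p, x ≠ (i, p i) → y ≠ (i, p i) → x ≠ y →
    eventTime p z x = eventTime p z y → eventTime p z x = ⊤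

section BeforeEvent

variable {p : Side → ℕ} {z : Side → ℕ → ℝ≥0 → ℕ} {t : ℝ≥0} {s : Side} {l : ℕ}

lemma pos_of_lt_eventTime (ht : (t : ℝ≥0∞) < eventTime p z (s, p s)) : 0 < z s (p s) t := by
  have hmem := notMem_of_lt_hitTime ht
  rw [eventSet, if_pos rfl] at hmem
  exact Nat.pos_of_ne_zero hmem

lemma eq_zero_of_lt_eventTime (hb : p .bid < l) (ha : l < p .ask)
    (ht : (t : ℝ≥0∞) < eventTime p z (s, l)) : z s l t = 0 := by
  have hmem := notMem_of_lt_hitTime ht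
  rwa [eventSet, if_neg (ne_of_inside hb ha), Set.notMem_compl_iff] at hmem

end BeforeEvent

namespace BookPath

variable {N : ℕ} {p : Side → ℕ} {i : Side} {z : Side → ℕ → ℝ≥0 → ℕ} {q : ℝ≥0 → ℕ → ℤ} {t : ℝ≥0}

lemma rightConst_midPrice (hP : BookPath N p i z q) : RightConst fun t => midPrice N (q t) := by
  intro t
  filter_upwards [(Finset.eventually_all (Finset.range (N + 1))).2
    fun l _ => hP.rightCont l t] with u hu
  exact midPrice_congr fun l hl => hu l (Finset.mem_range.2 (Nat.lt_succ_of_le hl))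

lemma midPrice_eq_of_lt (hP : BookPath N p i z q) (ht : (t : ℝ≥0∞) < pathMoveTime N q) :
    midPrice N (q t) = quoteMid p :=
  (not_not.1 (notMem_of_lt_hitTime ht)).trans hP.init

lemma follow_of_le (hP : BookPath N p i z q) (ht : (t : ℝ≥0∞) ≤ pathMoveTime N q) :
    (z i (p i) t : ℤ) ≤ i.sgn * q t (p i) ∧
    q t (p i.opp) = i.opp.sgn * z i.opp (p i.opp) t ∧
    ∀ l, p .bid < l → l < p .ask → q t l = (z .ask l t : ℤ) - z .bid l t :=
  hP.follow t fun _ hu => not_not.1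
    (notMem_of_lt_hitTime ((ENNReal.coe_lt_coe.2 hu).trans_le ht))

lemma best_of_le (hP : BookPath N p i z q) (ht : (t : ℝ≥0∞) ≤ pathMoveTime N q) :
    (z .ask (p .ask) t : ℤ) ≤ q t (p .ask) ∧ q t (p .bid) ≤ -(z .bid (p .bid) t : ℤ) := by
  obtain ⟨hpos, hopp, -⟩ := hP.follow_of_le ht
  cases i <;> simp only [Side.sgn, Side.opp] at hpos hopp <;> omega

lemma midPrice_ne_of_depleted (hP : BookPath N p i z q) (ht : (t : ℝ≥0∞) ≤ pathMoveTime N q)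
    (hpos : 0 < z i (p i) t) (hopp : z i.opp (p i.opp) t = 0)
    (hin : ∀ s l, p .bid < l → l < p .ask → z s l t = 0) : midPrice N (q t) ≠ quoteMid p := by
  obtain ⟨-, hq, hinside⟩ := hP.follow_of_le ht
  have hempty : ∀ l, p .bid < l → l < p .ask → q t l = 0 := fun l h1 h2 => by
    rw [hinside l h1 h2, hin _ l h1 h2, hin _ l h1 h2, sub_self]
  obtain ⟨hask, hbid⟩ := hP.best_of_le ht
  obtain ⟨h1, hN, hlt⟩ : 1 ≤ p .bid ∧ p .ask ≤ N ∧ p .bid < p .ask := ⟨hP.one_le, hP.le_N, hP.lt⟩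
  rw [hopp, Nat.cast_zero, mul_zero] at hq
  cases i
  · refine (midPrice_lt_quoteMid (a := p .ask) (b := p .bid - 1) (by omega) hN (by omega)
      (hP.uncrossed t) (fun l hl1 hl2 => ?_) (by omega)).ne
    rcases (Nat.le_of_pred_lt hl1).eq_or_lt with rfl | hl
    exacts [hq.ge, (hempty l hl hl2).ge]
  · refine (quoteMid_lt_midPrice (a := p .ask + 1) (b := p .bid) h1 (by omega) (by omega)
      (hP.uncrossed t) (fun l hl1 hl2 => ?_) (by omega) (by omega)).ne'
    rcases (Nat.le_of_lt_succ hl2).eq_or_lt with rfl | hl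
    exacts [hq.le, (hempty l hl1 hl).le]

lemma midPrice_ne_of_arrival (hP : BookPath N p i z q) (ht : (t : ℝ≥0∞) ≤ pathMoveTime N q)
    {s : Side} {l : ℕ} (hb : p .bid < l) (ha : l < p .ask) (hz : z s l t ≠ 0)
    (hin : ∀ s' l', p .bid < l' → l' < p .ask → (s', l') ≠ (s, l) → z s' l' t = 0) :
    midPrice N (q t) ≠ quoteMid p := by
  obtain ⟨-, -, hinside⟩ := hP.follow_of_le ht
  have hempty : ∀ l', p .bid < l' → l' < p .ask → l' ≠ l → q t l' = 0 := fun l' h1 h2 hne => by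
    have hne' : ∀ s', (s', l') ≠ (s, l) := fun s' h => hne (congrArg Prod.snd h)
    rw [hinside l' h1 h2, hin _ l' h1 h2 (hne' _), hin _ l' h1 h2 (hne' _), sub_self]
  have hql := hinside l hb ha
  obtain ⟨h1, hN⟩ : 1 ≤ p .bid ∧ p .ask ≤ N := ⟨hP.one_le, hP.le_N⟩
  cases s
  · rw [hin .bid l hb ha (by simp)] at hql
    exact (midPrice_lt_quoteMid (a := l) (b := p .bid) (by omega) (by omega) (by omega)
      (hP.uncrossed t) (fun l' hl1 hl2 => (hempty l' hl1 (hl2.trans ha) hl2.ne).ge) (by omega)).ne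
  · rw [hin .ask l hb ha (by simp)] at hql
    exact (quoteMid_lt_midPrice (a := p .ask) (b := l) (by omega) (by omega) (by omega)
      (hP.uncrossed t) (fun l' hl1 hl2 => (hempty l' (hb.trans hl1) hl2 hl1.ne').le)
      (by omega) (by omega)).ne'

lemma le_moveTime (hP : BookPath N p i z q) {c : ℝ≥0∞}
    (hc : ∀ x ∈ activeQueues p, c ≤ eventTime p z x) : c ≤ pathMoveTime N q := by
  by_contra! hlt
  obtain ⟨t, ht⟩ := WithTop.ne_top_iff_exists.1 hlt.ne_top
  obtain ⟨-, -, hinside⟩ := hP.follow_of_le ht.le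
  obtain ⟨hask, hbid⟩ := hP.best_of_le ht.le
  have hbest : ∀ s, 0 < z s (p s) t := fun s => pos_of_lt_eventTime <|
    (ht ▸ hlt).trans_le (hc _ ((mem_activeQueues_iff hP.lt).2 (.inl rfl)))
  have hin : ∀ s l, p .bid < l → l < p .ask → z s l t = 0 := fun s l h1 h2 =>
    eq_zero_of_lt_eventTime h1 h2 <|
      (ht ▸ hlt).trans_le (hc _ ((mem_activeQueues_iff hP.lt).2 (.inr ⟨h1, h2⟩)))
  have hmoved : midPrice N (q t) ≠ midPrice N (q 0) := hP.rightConst_midPrice.hitTime_mem ht.symm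
  refine hmoved ((midPrice_eq_quoteMid hP.one_le hP.le_N hP.lt (hP.uncrossed t) ?_ ?_
    fun l h1 h2 => ?_).trans hP.init.symm)
  · have := hbest .ask; omega
  · have := hbest .bid; omega
  · rw [hinside l h1 h2, hin _ l h1 h2, hin _ l h1 h2, sub_self]

lemma moveTime_le (hP : BookPath N p i z q) {x : Side × ℕ} (hx : x ∈ activeQueues p)
    (ht : eventTime p z x = t)
    (hmin : ∀ y ∈ activeQueues p, y ≠ x → (t : ℝ≥0∞) < eventTime p z y) (hxi : x ≠ (i, p i)) :
    pathMoveTime N q ≤ t := by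
  by_contra! hlt
  have hmem : z x.1 x.2 t ∈ eventSet p x := (hP.rightConst x hx).hitTime_mem ht
  have hin : ∀ s l, p .bid < l → l < p .ask → (s, l) ≠ x → z s l t = 0 := fun s l h1 h2 hne =>
    eq_zero_of_lt_eventTime h1 h2 (hmin _ ((mem_activeQueues_iff hP.lt).2 (.inr ⟨h1, h2⟩)) hne)
  have hpos : 0 < z i (p i) t :=
    pos_of_lt_eventTime (hmin _ ((mem_activeQueues_iff hP.lt).2 (.inl rfl)) hxi.symm)
  refine absurd (hP.midPrice_eq_of_lt hlt) ?_
  rcases activeQueues_cases hP.lt i hx with hx' | rfl | ⟨hb, ha⟩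
  · exact absurd hx' hxi
  · rw [eventSet, if_pos rfl] at hmem
    exact hP.midPrice_ne_of_depleted hlt.le hpos hmem fun s l h1 h2 => hin s l h1 h2 fun h =>
      ne_of_inside (s := i.opp) h1 h2 (congrArg Prod.snd h)
  · rw [eventSet, if_neg (ne_of_inside hb ha)] at hmem
    exact hP.midPrice_ne_of_arrival hlt.le hb ha hmem hin

lemma fill_iff (hP : BookPath N p i z q) :
    eventTime p z (i, p i) ≤ pathMoveTime N q ↔
      ∀ x ∈ activeQueues p, x ≠ (i, p i) → eventTime p z (i, p i) ≤ eventTime p z x := by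
  refine ⟨fun h => ?_, fun h => hP.le_moveTime fun x hx => ?_⟩
  · by_contra! ⟨y, hy, hyi, hlt⟩
    obtain ⟨x, ⟨hx, hxi⟩, hmin⟩ := Set.exists_min_image {x ∈ activeQueues p | x ≠ (i, p i)}
      (eventTime p z) ((activeQueues p).toFinite.subset fun _ h => h.1) ⟨y, hy, hyi⟩
    have hxlt : eventTime p z x < eventTime p z (i, p i) := (hmin y ⟨hy, hyi⟩).trans_lt hlt
    obtain ⟨t, ht⟩ := WithTop.ne_top_iff_exists.1 hxlt.ne_top
    refine (h.trans (hP.moveTime_le hx ht.symm (fun y hy hyx => ?_) hxi)).not_gt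
      (ht.trans_lt hxlt)
    refine ht.trans_lt ?_
    by_cases hyi : y = (i, p i)
    · exact hyi ▸ hxlt
    · exact (hmin y ⟨hy, hyi⟩).lt_of_ne fun htie =>
        hxlt.ne_top (hP.noTie x hx y hy hxi hyi hyx.symm htie)
  · by_cases hxi : x = (i, p i)
    · exact hxi ▸ le_rfl
    · exact h x hx hxi

end BookPath

/-! ### The clocks of the book -/

lemma expLaw_singleton {r : ℝ} (hr : 0 ≤ r) {c : ℝ≥0∞} (hc : c ≠ ⊤) : expLaw r {c} = 0 := by
  rcases hr.eq_or_lt with rfl | hr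
  · rw [expLaw_zero, Measure.dirac_apply' _ (measurableSet_singleton c)]
    exact Set.indicator_of_notMem hc.symm (1 : ℝ≥0∞ → ℝ≥0∞)
  have hpos : expDens r (ENNReal.ofReal ⁻¹' {c}) = 0 := by
    have hnull : expDens r {c.toReal} = 0 :=
      ((expDens_absolutelyContinuous r).trans Measure.restrict_le_self.absolutelyContinuous)
        Real.volume_singleton
    rw [measure_eq_zero_iff_ae_notMem] at hnull ⊢
    filter_upwards [ae_expDens_pos r, hnull] with x hx hxc hmem
    exact hxc (by rw [← Set.mem_singleton_iff.1 hmem, ENNReal.toReal_ofReal hx.le]; rfl)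
  rw [expLaw_of_ne hr.ne', Measure.map_apply ENNReal.measurable_ofReal (measurableSet_singleton _),
    expMeasure_eq_smul_expDens hr.le, Measure.smul_apply, hpos, smul_zero]

lemma ae_ne_of_indepFun {Ω : Type*} [MeasurableSpace Ω] {P : Measure Ω} [IsProbabilityMeasure P]
    {S T : Ω → ℝ≥0∞} (hS : Measurable S) (hT : Measurable T) (hind : IndepFun S T P)
    {r : ℝ} (hr : 0 ≤ r) (hlaw : P.map T = expLaw r) : ∀ᵐ ω ∂P, S ω = T ω → T ω = ⊤ := by
  have hprod := (indepFun_iff_map_prod_eq_prod_map_map hS.aemeasurable hT.aemeasurable).1 hind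
  have := Measure.isProbabilityMeasure_map (μ := P) hT.aemeasurable
  have htie : MeasurableSet {z : ℝ≥0∞ × ℝ≥0∞ | z.1 = z.2 ∧ z.2 ≠ ⊤} :=
    (measurableSet_eq_fun measurable_fst measurable_snd).inter
      (measurable_snd (measurableSet_singleton ⊤).compl)
  have hnull : P.map (fun ω => (S ω, T ω)) {z : ℝ≥0∞ × ℝ≥0∞ | z.1 = z.2 ∧ z.2 ≠ ⊤} = 0 := by
    rw [hprod, Measure.measure_prod_null htie]
    refine ae_of_all _ fun c => ?_
    by_cases hc : c = ⊤
    · exact measure_mono_null (fun x hx => hx.2 (hx.1.symm.trans hc)) measure_empty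
    · rw [hlaw]
      exact measure_mono_null (fun x hx => hx.1.symm) (expLaw_singleton hr hc)
  rw [Measure.map_apply (hS.prodMk hT) htie, measure_eq_zero_iff_ae_notMem] at hnull
  filter_upwards [hnull] with ω hω heq
  exact not_not.1 fun hne => hω ⟨heq, hne⟩

/-- The time of the first event in the queue `x`, in the measurable version `hitTimeDense`. -/
def clock {Ω : Type*} (p : Side → ℕ) (Z : Side → ℕ → ℝ≥0 → Ω → ℕ) (x : Side × ℕ) (ω : Ω) : ℝ≥0∞ :=
  hitTimeDense (eventSet p x) (fun t => Z x.1 x.2 t ω)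

/-- The active queues other than that of the tagged order on side `i`. -/
def rivals (p : Side → ℕ) (i : Side) : Finset (Side × ℕ) :=
  insert (i.opp, p i.opp) (Finset.univ ×ˢ Finset.Ioo (p .bid) (p .ask))

/-- The time of the first event other than the execution of the tagged order on side `i`. -/
def rivalTime {Ω : Type*} (p : Side → ℕ) (i : Side) (Z : Side → ℕ → ℝ≥0 → Ω → ℕ) (ω : Ω) : ℝ≥0∞ :=
  (rivals p i).inf fun x => clock p Z x ω

/-- The total rate at which limit orders of either side are posted inside the spread. -/
def insideRate {𝒳 : Type*} (lam : Side → ℕ → 𝒳 → ℝ≥0) (X : ℕ → 𝒳) (p : Side → ℕ) : ℝ :=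
  ∑ s, ∑ l ∈ Finset.Ioo (p .bid) (p .ask), (lam s 0 (X l) : ℝ)

lemma mem_rivals_iff {p : Side → ℕ} (hp : p .bid < p .ask) {i : Side} {x : Side × ℕ} :
    x ∈ rivals p i ↔ x ∈ activeQueues p ∧ x ≠ (i, p i) := by
  rw [rivals, Finset.mem_insert, Finset.mem_product, Finset.mem_Ioo]
  constructor
  · rintro (rfl | ⟨-, hin⟩)
    · exact ⟨(mem_activeQueues_iff hp).2 (.inl rfl), fun h => i.opp_ne (congrArg Prod.fst h)⟩
    · exact ⟨(mem_activeQueues_iff hp).2 (.inr hin), fun h =>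
        ne_of_inside (s := i) hin.1 hin.2 (congrArg Prod.snd h)⟩
  · rintro ⟨hx, hne⟩
    rcases activeQueues_cases hp i hx with h | h | h
    exacts [absurd h hne, .inl h, .inr ⟨Finset.mem_univ _, h⟩]

section Book

variable {Ω 𝒳 : Type*} [MeasurableSpace Ω] {P : Measure Ω} {X : ℕ → 𝒳}
    {lam : Side → ℕ → 𝒳 → ℝ≥0} {mu phi : ℕ → 𝒳 → ℝ≥0}
    {N : ℕ} {p q₀ : Side → ℕ} {i : Side} {Z : Side → ℕ → ℝ≥0 → Ω → ℕ} {Q : ℝ≥0 → Ω → ℕ → ℤ}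

namespace IsTaggedBook

lemma measurable_clock (hbook : IsTaggedBook P X lam mu phi N p q₀ i Z Q) (hp : p .bid < p .ask)
    {x : Side × ℕ} (hx : x ∈ activeQueues p) : Measurable (clock p Z x) := by
  refine (measurable_hitTimeDense .of_discrete).comp (measurable_pi_iff.2 fun t => ?_)
  rcases activeQueues_cases hp i hx with rfl | rfl | ⟨hb, ha⟩
  exacts [hbook.position.measurable t, hbook.opposite.measurable t,
    (hbook.inside _ _ hb ha).measurable t]

lemma iIndepFun_clock (hbook : IsTaggedBook P X lam mu phi N p q₀ i Z Q) :
    iIndepFun (fun x : activeQueues p => clock p Z x.1) P :=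
  hbook.indep.comp (fun x => hitTimeDense (eventSet p x.1)) fun _ =>
    measurable_hitTimeDense .of_discrete

lemma measurable_rivalTime (hbook : IsTaggedBook P X lam mu phi N p q₀ i Z Q)
    (hp : p .bid < p .ask) : Measurable (rivalTime p i Z) := by
  rw [show rivalTime p i Z = fun ω => ⨅ x ∈ rivals p i, clock p Z x ω from
    funext fun ω => Finset.inf_eq_iInf _ _]
  exact Measurable.biInf _ (Finset.countable_toSet _) fun x hx =>
    hbook.measurable_clock hp ((mem_rivals_iff hp).1 hx).1

lemma indepFun_rivalTime (hbook : IsTaggedBook P X lam mu phi N p q₀ i Z Q)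
    (hp : p .bid < p .ask) : IndepFun (clock p Z (i, p i)) (rivalTime p i Z) P := by
  classical
  let tagged : activeQueues p := ⟨(i, p i), (mem_activeQueues_iff hp).2 (.inl rfl)⟩
  let others : Finset (activeQueues p) := (rivals p i).subtype (· ∈ activeQueues p)
  have hdisj : Disjoint {tagged} others := Finset.disjoint_singleton_left.2 fun h =>
    ((mem_rivals_iff hp).1 (Finset.mem_subtype.1 h)).2 rfl
  have hmin : rivalTime p i Z =
      (fun v : others → ℝ≥0∞ => ⨅ x, v x) ∘ fun ω x => clock p Z x.1.1 ω := by
    funext ω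
    refine le_antisymm (le_iInf fun x => Finset.inf_le (Finset.mem_subtype.1 x.2))
      (Finset.le_inf fun x hx => ?_)
    exact iInf_le (fun y : others => clock p Z y.1.1 ω)
      ⟨⟨x, ((mem_rivals_iff hp).1 hx).1⟩, Finset.mem_subtype.2 hx⟩
  rw [hmin]
  exact (hbook.iIndepFun_clock.indepFun_finset {tagged} others hdisj
    fun x => hbook.measurable_clock hp x.2).comp
    (measurable_pi_apply (⟨tagged, Finset.mem_singleton_self _⟩ : ({tagged} : Finset _)))
    (Measurable.iInf fun x : others => measurable_pi_apply x)

lemma measure_lt_rivalTime_eq_prod (hbook : IsTaggedBook P X lam mu phi N p q₀ i Z Q)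
    (hp : p .bid < p .ask) (t : ℝ≥0) :
    P {ω | (t : ℝ≥0∞) < rivalTime p i Z ω} =
      ∏ x ∈ rivals p i, P {ω | (t : ℝ≥0∞) < clock p Z x ω} := by
  classical
  have hmem : ∀ x ∈ rivals p i, x ∈ activeQueues p := fun x hx => ((mem_rivals_iff hp).1 hx).1
  rw [← Finset.prod_subtype_of_mem (p := (· ∈ activeQueues p)) _ hmem]
  refine Eq.trans (congrArg P ?_) (hbook.iIndepFun_clock.measure_inter_preimage_eq_mul
    ((rivals p i).subtype (· ∈ activeQueues p)) (sets := fun _ => Set.Ioi (t : ℝ≥0∞))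
    fun _ _ => measurableSet_Ioi)
  ext ω
  simp only [Set.mem_ofPred_eq, rivalTime, Finset.lt_inf_iff ENNReal.coe_lt_top, Set.mem_iInter,
    Finset.mem_subtype, Set.mem_preimage, Set.mem_Ioi, Subtype.forall]
  exact ⟨fun h x _ hx => h x hx, fun h x hx => h x (hmem x hx) hx⟩

variable [IsProbabilityMeasure P]

lemma ae_rightConst (hbook : IsTaggedBook P X lam mu phi N p q₀ i Z Q) (hp : p .bid < p .ask) :
    ∀ᵐ ω ∂P, ∀ x ∈ activeQueues p, RightConst fun t => Z x.1 x.2 t ω := by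
  refine (ae_ball_iff (activeQueues p).to_countable).2 fun x hx => ?_
  rcases activeQueues_cases hp i hx with rfl | rfl | ⟨hb, ha⟩
  exacts [hbook.position.ae_rightConst, hbook.opposite.ae_rightConst,
    (hbook.inside _ _ hb ha).ae_rightConst]

lemma ae_clock_eq (hbook : IsTaggedBook P X lam mu phi N p q₀ i Z Q) (hp : p .bid < p .ask) :
    ∀ᵐ ω ∂P, ∀ x ∈ activeQueues p, clock p Z x ω = eventTime p (fun s l t => Z s l t ω) x := by
  filter_upwards [hbook.ae_rightConst hp] with ω hω x hx
  exact (hω x hx).hitTimeDense_eq _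

lemma ae_firstPassage_eq (hbook : IsTaggedBook P X lam mu phi N p q₀ i Z Q)
    (hp : p .bid < p .ask) (s : Side) : firstPassage (Z s (p s)) =ᵐ[P] clock p Z (s, p s) := by
  filter_upwards [hbook.ae_clock_eq hp] with ω hω
  rw [hω _ ((mem_activeQueues_iff hp).2 (.inl rfl)), eventTime, eventSet, if_pos rfl,
    firstPassage_eq_hitTime]

lemma measure_lt_clock_inside (hbook : IsTaggedBook P X lam mu phi N p q₀ i Z Q) (s : Side)
    {l : ℕ} (hb : p .bid < l) (ha : l < p .ask) (t : ℝ≥0) :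
    P {ω | (t : ℝ≥0∞) < clock p Z (s, l) ω} =
      ENNReal.ofReal (Real.exp (-(lam s 0 (X l) * t))) := by
  rw [← (hbook.inside s l hb ha).measure_lt_hitTime t]
  refine measure_congr (eventuallyEq_set.2 ?_)
  filter_upwards [hbook.ae_clock_eq (hb.trans ha)] with ω hω
  rw [hω _ ((mem_activeQueues_iff (hb.trans ha)).2 (.inr ⟨hb, ha⟩)), eventTime, eventSet,
    if_neg (ne_of_inside hb ha)]

lemma measure_lt_rivalTime (hbook : IsTaggedBook P X lam mu phi N p q₀ i Z Q)
    (hp : p .bid < p .ask) (t : ℝ≥0) :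
    P {ω | (t : ℝ≥0∞) < rivalTime p i Z ω} =
      P {ω | (t : ℝ≥0∞) < clock p Z (i.opp, p i.opp) ω} *
        ENNReal.ofReal (Real.exp (-(insideRate lam X p * t))) := by
  have hnot : (i.opp, p i.opp) ∉ Finset.univ ×ˢ Finset.Ioo (p .bid) (p .ask) := fun h =>
    have hin := Finset.mem_Ioo.1 (Finset.mem_product.1 h).2
    ne_of_inside (s := i.opp) hin.1 hin.2 rfl
  rw [hbook.measure_lt_rivalTime_eq_prod hp, rivals, Finset.prod_insert hnot,
    insideRate, ← Finset.sum_product', Finset.sum_mul, ← Finset.sum_neg_distrib, Real.exp_sum,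
    ENNReal.ofReal_prod_of_nonneg fun _ _ => (Real.exp_pos _).le]
  refine congrArg (_ * ·) (Finset.prod_congr rfl fun x hx => ?_)
  obtain ⟨hb, ha⟩ := Finset.mem_Ioo.1 (Finset.mem_product.1 hx).2
  exact hbook.measure_lt_clock_inside x.1 hb ha t

lemma ae_clock_ne (hbook : IsTaggedBook P X lam mu phi N p q₀ i Z Q) {x y : Side × ℕ}
    (hx : x ∈ activeQueues p) (hxy : x ≠ y) (hb : p .bid < y.2) (ha : y.2 < p .ask) :
    ∀ᵐ ω ∂P, clock p Z x ω = clock p Z y ω → clock p Z y ω = ⊤ := by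
  have hp := hb.trans ha
  have hy : y ∈ activeQueues p := (mem_activeQueues_iff hp).2 (.inr ⟨hb, ha⟩)
  exact ae_ne_of_indepFun (hbook.measurable_clock hp hx) (hbook.measurable_clock hp hy)
    (hbook.iIndepFun_clock.indepFun (i := ⟨x, hx⟩) (j := ⟨y, hy⟩)
      fun h => hxy (congrArg Subtype.val h))
    (lam y.1 0 (X y.2)).coe_nonneg
    (map_eq_expLaw (hbook.measurable_clock hp hy) (NNReal.coe_nonneg _)
      (hbook.measure_lt_clock_inside y.1 hb ha))

lemma ae_noTie (hbook : IsTaggedBook P X lam mu phi N p q₀ i Z Q) (hp : p .bid < p .ask) :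
    ∀ᵐ ω ∂P, ∀ x ∈ activeQueues p, ∀ y ∈ activeQueues p, x ≠ (i, p i) → y ≠ (i, p i) → x ≠ y →
      clock p Z x ω = clock p Z y ω → clock p Z x ω = ⊤ := by
  have hcount := (activeQueues p).to_countable
  refine (ae_ball_iff hcount).2 fun x hx => (ae_ball_iff hcount).2 fun y hy => ?_
  simp only [Filter.eventually_imp_distrib_left]
  intro hxi hyi hxy
  rcases (activeQueues_cases hp i hy).resolve_left hyi with hy' | ⟨hb, ha⟩
  · rcases (activeQueues_cases hp i hx).resolve_left hxi with hx' | ⟨hb, ha⟩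
    · exact absurd (hx'.trans hy'.symm) hxy
    · filter_upwards [hbook.ae_clock_ne hy hxy.symm hb ha] with ω hω heq using hω heq.symm
  · filter_upwards [hbook.ae_clock_ne hx hxy hb ha] with ω hω heq using heq.trans (hω heq)

lemma fillEvent_ae_eq (hbook : IsTaggedBook P X lam mu phi N p q₀ i Z Q) (h1 : 1 ≤ p .bid)
    (hN : p .ask ≤ N) (hp : p .bid < p .ask) :
    fillEvent N p i Z Q =ᵐ[P]
      {ω | clock p Z (i, p i) ω ≠ ⊤ ∧ clock p Z (i, p i) ω ≤ rivalTime p i Z ω} := by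
  refine eventuallyEq_set.2 ?_
  filter_upwards [hbook.ae_rightConst hp, hbook.ae_clock_eq hp, hbook.ae_noTie hp,
    hbook.ae_firstPassage_eq hp i, hbook.init, hbook.rightCont, hbook.uncrossed, hbook.follow]
    with ω hright hclock htie hfirst hinit hcont hunc hfollow
  have hpath : BookPath N p i (fun s l t => Z s l t ω) (fun t => Q t ω) :=
    { one_le := h1
      le_N := hN
      lt := hp
      init := by rw [midPrice, hinit.1, hinit.2.1, quoteMid]
      rightCont := hcont
      uncrossed := hunc
      follow := hfollow
      rightConst := hright
      noTie := fun x hx y hy => by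
        rw [← hclock x hx, ← hclock y hy]
        exact htie x hx y hy }
  change firstPassage (Z i (p i)) ω ≠ ⊤ ∧
      firstPassage (Z i (p i)) ω ≤ pathMoveTime N (fun t => Q t ω) ↔
    clock p Z (i, p i) ω ≠ ⊤ ∧ clock p Z (i, p i) ω ≤ rivalTime p i Z ω
  rw [hfirst, rivalTime, Finset.le_inf_iff]
  refine and_congr_right fun _ => ?_
  have hi := hclock (i, p i) ((mem_activeQueues_iff hp).2 (.inl rfl))
  rw [hi]
  refine hpath.fill_iff.trans ⟨fun h x hx => ?_, fun h x hx hxi => ?_⟩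
  · obtain ⟨hx, hxi⟩ := (mem_rivals_iff hp).1 hx
    exact (h x hx hxi).trans_eq (hclock x hx).symm
  · exact (h x ((mem_rivals_iff hp).2 ⟨hx, hxi⟩)).trans_eq (hclock x hx)

end IsTaggedBook

end Book

lemma sum_Ioo_eq_sum_sub {M : Type*} [AddCommMonoid M] (f : ℕ → M) (b s₀ : ℕ) :
    ∑ l ∈ Finset.Ioo b (b + s₀), f l = ∑ m ∈ Finset.Icc 1 (s₀ - 1), f (b + s₀ - m) := by
  refine Finset.sum_nbij' (fun l => b + s₀ - l) (fun m => b + s₀ - m) ?_ ?_ ?_ ?_ ?_ <;>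
    intro l hl <;> simp only [Finset.mem_Ioo, Finset.mem_Icc] at * <;> try omega
  congr 1
  omega

lemma sum_Ioo_eq_sum_add {M : Type*} [AddCommMonoid M] (f : ℕ → M) (b s₀ : ℕ) :
    ∑ l ∈ Finset.Ioo b (b + s₀), f l = ∑ m ∈ Finset.Icc 1 (s₀ - 1), f (b + m) := by
  refine Finset.sum_nbij' (fun l => l - b) (fun m => b + m) ?_ ?_ ?_ ?_ ?_ <;>
    intro l hl <;> simp only [Finset.mem_Ioo, Finset.mem_Icc] at * <;> try omega
  congr 1
  omega

/-! ### Bromwich inversion -/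

section Bromwich

open FourierTransform

lemma fourier_cexp_mul (G : ℝ → ℂ) (γ w : ℝ) :
    𝓕 (fun t : ℝ => Complex.exp (-(γ : ℂ) * t) * G t) w =
      ∫ t : ℝ, Complex.exp (-(γ + ((2 * Real.pi * w : ℝ) : ℂ) * Complex.I) * t) * G t := by
  rw [Real.fourier_real_eq_integral_exp_smul]
  refine integral_congr_ae (ae_of_all _ fun v => ?_)
  simp only [smul_eq_mul]
  rw [← mul_assoc, ← Complex.exp_add]
  congr 2
  push_cast
  ring

lemma fourierInv_comp_two_pi_mul (H : ℝ → ℂ) (t : ℝ) :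
    𝓕⁻ (fun w : ℝ => H (2 * Real.pi * w)) t =
      (2 * Real.pi : ℂ)⁻¹ * ∫ u : ℝ, Complex.exp (u * Complex.I * t) * H u := by
  have hscale := Measure.integral_comp_mul_left
    (fun u : ℝ => Complex.exp (u * Complex.I * t) * H u) (2 * Real.pi)
  rw [abs_of_pos (by positivity), Complex.real_smul] at hscale
  push_cast at hscale
  rw [Real.fourierInv_eq', ← hscale]
  refine integral_congr_ae (ae_of_all _ fun v => ?_)
  simp only [smul_eq_mul, RCLike.inner_apply, conj_trivial]
  congr 2
  push_cast
  ring

lemma bromwich_inversion {G : ℝ → ℂ} {γ : ℝ} {L : ℂ → ℂ} (hG : Continuous G)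
    (hint : Integrable fun t : ℝ => Complex.exp (-(γ : ℂ) * t) * G t)
    (hL : ∀ u : ℝ, ∫ t : ℝ, Complex.exp (-(γ + u * Complex.I) * t) * G t = L (γ + u * Complex.I))
    (hLint : Integrable fun u : ℝ => L (γ + u * Complex.I)) (t : ℝ) :
    G t = (2 * Real.pi : ℂ)⁻¹ *
      ∫ u : ℝ, Complex.exp ((γ + u * Complex.I) * t) * L (γ + u * Complex.I) := by
  set f : ℝ → ℂ := fun t => Complex.exp (-(γ : ℂ) * t) * G t
  have hfourier : 𝓕 f = fun w => L (γ + ((2 * Real.pi * w : ℝ) : ℂ) * Complex.I) :=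
    funext fun w => (fourier_cexp_mul G γ w).trans (hL _)
  have hfourier_int : Integrable (𝓕 f) := by
    rw [hfourier]
    exact (integrable_comp_mul_left_iff (fun u : ℝ => L (γ + u * Complex.I)) (by positivity)).2
      hLint
  have hinv : f t =
      (2 * Real.pi : ℂ)⁻¹ * ∫ u : ℝ, Complex.exp (u * Complex.I * t) * L (γ + u * Complex.I) := by
    rw [← fourierInv_comp_two_pi_mul, ← hfourier,
      (by fun_prop : Continuous f).fourierInv_fourier_eq hint hfourier_int]
  calc G t = Complex.exp ((γ : ℂ) * t) * f t := by
        simp only [f]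
        rw [← mul_assoc, ← Complex.exp_add, neg_mul, add_neg_cancel, Complex.exp_zero, one_mul]
    _ = _ := by
        rw [hinv, mul_left_comm, ← integral_const_mul]
        congr 1
        refine integral_congr_ae (ae_of_all _ fun u => ?_)
        simp only
        rw [← mul_assoc, ← Complex.exp_add, add_mul]

end Bromwich

/-! ### Transforms of distribution functions and tails -/

section Sections

variable {α β : Type*} [MeasurableSpace α] [MeasurableSpace β] {ρ : Measure α}
  {μ : Measure β} [SFinite μ] {K : Set (α × β)} {h : β → ℂ}

lemma integrable_prod_indicator_snd (hK : MeasurableSet K) (hh : Measurable h)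
    (hsec : ∀ x, IntegrableOn h {t | (x, t) ∈ K} μ)
    (hnorm : Integrable (fun x => ∫ t in {t | (x, t) ∈ K}, ‖h t‖ ∂μ) ρ) :
    Integrable (K.indicator fun z => h z.2) (ρ.prod μ) := by
  have hKx : ∀ x, MeasurableSet {t | (x, t) ∈ K} := fun x => measurable_prodMk_left hK
  have hmeas : Measurable (K.indicator fun z => h z.2) := (hh.comp measurable_snd).indicator hK
  rw [integrable_prod_iff hmeas.aestronglyMeasurable]
  refine ⟨ae_of_all _ fun x => (integrable_indicator_iff (hKx x)).2 (hsec x),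
    hnorm.congr (ae_of_all _ fun x => ?_)⟩
  dsimp only
  rw [← integral_indicator (hKx x)]
  refine integral_congr_ae (ae_of_all _ fun t => ?_)
  simp only [norm_indicator_eq_indicator_norm]
  rfl

lemma integral_mul_measureReal_section [IsFiniteMeasure ρ] (hK : MeasurableSet K)
    (hh : Measurable h)
    (hsec : ∀ x, IntegrableOn h {t | (x, t) ∈ K} μ)
    (hnorm : Integrable (fun x => ∫ t in {t | (x, t) ∈ K}, ‖h t‖ ∂μ) ρ) :
    Integrable (fun t => h t * (ρ.real {x | (x, t) ∈ K} : ℂ)) μ ∧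
      ∫ t, h t * (ρ.real {x | (x, t) ∈ K} : ℂ) ∂μ =
        ∫ x, ∫ t in {t | (x, t) ∈ K}, h t ∂μ ∂ρ := by
  have hint := integrable_prod_indicator_snd (ρ := ρ) hK hh hsec hnorm
  have hKt : ∀ t, MeasurableSet {x | (x, t) ∈ K} := fun t => measurable_prodMk_right hK
  have hinner : ∀ t, ∫ x, K.indicator (fun z => h z.2) (x, t) ∂ρ =
      h t * (ρ.real {x | (x, t) ∈ K} : ℂ) := by
    intro t
    calc ∫ x, K.indicator (fun z => h z.2) (x, t) ∂ρ
        = ∫ x, {x | (x, t) ∈ K}.indicator (fun _ => h t) x ∂ρ := rfl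
      _ = h t * (ρ.real {x | (x, t) ∈ K} : ℂ) := by
        rw [integral_indicator_const _ (hKt t), Complex.real_smul, mul_comm]
  simp_rw [← hinner]
  refine ⟨hint.integral_prod_right, ?_⟩
  rw [← integral_integral_swap (f := fun x t => K.indicator (fun z => h z.2) (x, t)) hint]
  exact integral_congr_ae (ae_of_all _ fun x => integral_indicator (measurable_prodMk_left hK))

end Sections

variable {ρ ν : Measure ℝ} {s : ℂ} {γ : ℝ}

lemma continuous_measureReal_Iic [IsFiniteMeasure ρ] [NullSingletonClass ρ] :
    Continuous fun t => ρ.real (Set.Iic t) := by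
  have hprim : (fun t => ρ.real (Set.Iic t)) =
      fun t => ρ.real (Set.Iic 0) + ∫ _ in (0 : ℝ)..t, 1 ∂ρ := by
    ext t
    rw [← intervalIntegral.integral_Iic_sub_Iic (integrable_const _) (integrable_const _)]
    simp
  rw [hprim]
  exact continuous_const.add
    (intervalIntegral.continuous_primitive (fun a b => intervalIntegrable_const) 0)

lemma integral_cexp_mul_measureReal_Iic [IsFiniteMeasure ρ] (hρ : ∀ᵐ x ∂ρ, 0 ≤ x)
    (hs : 0 < s.re) :
    Integrable (fun t : ℝ => Complex.exp (-s * t) * (ρ.real (Set.Iic t) : ℂ)) ∧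
      ∫ t : ℝ, Complex.exp (-s * t) * (ρ.real (Set.Iic t) : ℂ) = 1 / s * laplaceMeasure ρ s := by
  have hre : (-s).re < 0 := neg_neg_of_pos hs
  have hnorm : ∀ x : ℝ, ∫ t in Set.Ici x, ‖Complex.exp (-s * t)‖ =
      Real.exp (-(s.re * x)) / s.re := by
    intro x
    simp_rw [norm_cexp_neg_mul, ← neg_mul]
    rw [integral_Ici_eq_integral_Ioi, integral_exp_mul_Ioi (neg_neg_of_pos hs), neg_div_neg_eq]
  have hbound : Integrable (fun x => Real.exp (-(s.re * x)) / s.re) ρ := by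
    refine (Integrable.of_bound (by fun_prop) 1 ?_).div_const _
    filter_upwards [hρ] with x hx
    rw [Real.norm_of_nonneg (Real.exp_pos _).le, Real.exp_le_one_iff]
    exact neg_nonpos.2 (mul_nonneg hs.le hx)
  have hsec : ∀ x : ℝ, IntegrableOn (fun t : ℝ => Complex.exp (-s * t)) (Set.Ici x) := fun x =>
    integrableOn_Ici_iff_integrableOn_Ioi (by finiteness) |>.2
      (integrableOn_exp_mul_complex_Ioi hre x)
  obtain ⟨hint, heq⟩ := integral_mul_measureReal_section (ρ := ρ) (K := {z : ℝ × ℝ | z.1 ≤ z.2})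
    (measurableSet_le measurable_fst measurable_snd) (by fun_prop) hsec
    (hbound.congr (ae_of_all _ fun x => (hnorm x).symm))
  refine ⟨hint, heq.trans ?_⟩
  rw [laplaceMeasure, ← integral_const_mul]
  refine integral_congr_ae (ae_of_all _ fun x => ?_)
  change ∫ t in Set.Ici x, Complex.exp (-s * t) = _
  rw [integral_Ici_eq_integral_Ioi, integral_exp_mul_complex_Ioi hre, neg_div_neg_eq,
    div_eq_mul_one_div, mul_comm]

lemma integral_Iio_restrict_Ioi {E : Type*} [NormedAddCommGroup E] [NormedSpace ℝ E] (f : ℝ → E)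
    {x : ℝ} (hx : 0 ≤ x) :
    ∫ t in Set.Iio x, f t ∂(volume.restrict (Set.Ioi 0)) = ∫ t in (0 : ℝ)..x, f t := by
  rw [Measure.restrict_restrict measurableSet_Iio, Set.inter_comm, Set.Ioi_inter_Iio,
    ← integral_Ioc_eq_integral_Ioo, intervalIntegral.integral_of_le hx]

lemma integral_cexp_mul_measureReal_Ioi [IsFiniteMeasure ν] (hν : ∀ᵐ x ∂ν, 0 ≤ x)
    (hs : s.re ≠ 0) (hi : expMoment ν s.re < ⊤) :
    ∫ t in Set.Ioi (0 : ℝ), Complex.exp (-s * t) * (ν.real (Set.Ioi t) : ℂ) =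
      1 / s * (ν.real Set.univ - laplaceMeasure ν s) := by
  have hs0 : s ≠ 0 := fun h => hs (by rw [h, Complex.zero_re])
  have hi' := integrable_cexp_iff.2 hi
  have hnorm : ∀ x : ℝ, 0 ≤ x →
      ∫ t in Set.Iio x, ‖Complex.exp (-s * t)‖ ∂(volume.restrict (Set.Ioi 0)) =
        (Real.exp (-(s.re * x)) - 1) / -s.re := by
    intro x hx
    simp_rw [integral_Iio_restrict_Ioi _ hx, norm_cexp_neg_mul, ← neg_mul]
    rw [intervalIntegral.integral_comp_mul_left (fun t => Real.exp t) (neg_ne_zero.2 hs),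
      integral_exp, mul_zero, Real.exp_zero, smul_eq_mul, div_eq_inv_mul]
  have hbound : Integrable (fun x => (Real.exp (-(s.re * x)) - 1) / -s.re) ν := by
    simp_rw [← norm_cexp_neg_mul]
    exact (hi'.norm.sub (integrable_const _)).div_const _
  have hsec : ∀ x : ℝ, IntegrableOn (fun t : ℝ => Complex.exp (-s * t)) (Set.Iio x)
      (volume.restrict (Set.Ioi 0)) := by
    intro x
    rw [IntegrableOn, Measure.restrict_restrict measurableSet_Iio, Set.inter_comm,
      Set.Ioi_inter_Iio]
    exact (Continuous.integrableOn_Icc (by fun_prop)).mono_set Set.Ioo_subset_Icc_self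
  refine (integral_mul_measureReal_section (K := {z : ℝ × ℝ | z.2 < z.1})
    (measurableSet_lt measurable_snd measurable_fst) (by fun_prop) hsec
    (hbound.congr (hν.mono fun x hx => (hnorm x hx).symm))).2.trans ?_
  calc ∫ x, ∫ t in Set.Iio x, Complex.exp (-s * t) ∂(volume.restrict (Set.Ioi 0)) ∂ν
      = ∫ x : ℝ, 1 / s * (1 - Complex.exp (-s * x)) ∂ν := by
        refine integral_congr_ae (hν.mono fun x hx => ?_)
        dsimp only
        rw [integral_Iio_restrict_Ioi _ hx, integral_exp_mul_complex (neg_ne_zero.2 hs0),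
          Complex.ofReal_zero, mul_zero, Complex.exp_zero, ← neg_sub, neg_div_neg_eq]
        ring
    _ = _ := by
        rw [integral_const_mul, integral_sub (integrable_const _) hi', integral_const,
          Complex.real_smul, mul_one, laplaceMeasure]

lemma expMoment_neg_lt_top_iff [IsFiniteMeasure ν] (hν : ∀ᵐ x ∂ν, 0 ≤ x) (hγ : 0 < γ) :
    expMoment ν (-γ) < ⊤ ↔
      ∫⁻ t in Set.Ioi 0, ν (Set.Ioi t) * ENNReal.ofReal (Real.exp (γ * t)) < ⊤ := by
  have hlayer := lintegral_comp_eq_lintegral_meas_lt_mul (f := fun x : ℝ => x)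
    (g := fun t => γ * Real.exp (γ * t)) ν hν (by fun_prop)
    (fun t _ => (by fun_prop : Continuous fun t => γ * Real.exp (γ * t)).intervalIntegrable _ _)
    (ae_of_all _ fun t => by positivity)
  have hprim : ∀ x : ℝ, ∫ t in (0 : ℝ)..x, γ * Real.exp (γ * t) = Real.exp (γ * x) - 1 := by
    intro x
    rw [intervalIntegral.integral_const_mul,
      intervalIntegral.integral_comp_mul_left (fun t => Real.exp t) hγ.ne', integral_exp]
    simp [hγ.ne']
  have hsplit : expMoment ν (-γ) =
      ∫⁻ x, ENNReal.ofReal (Real.exp (γ * x) - 1) ∂ν + ν Set.univ := by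
    rw [← lintegral_one, ← lintegral_add_right _ measurable_const, expMoment]
    refine lintegral_congr_ae (hν.mono fun x hx => ?_)
    have hone : 1 ≤ Real.exp (γ * x) := Real.one_le_exp (by positivity)
    dsimp only
    rw [← ENNReal.ofReal_one, ← ENNReal.ofReal_add (sub_nonneg.2 hone) zero_le_one, sub_add_cancel,
      neg_mul, neg_neg]
  simp_rw [hprim] at hlayer
  rw [hsplit, hlayer, ENNReal.add_lt_top, and_iff_left (measure_lt_top _ _)]
  simp_rw [ENNReal.ofReal_mul hγ.le, mul_left_comm _ (ENNReal.ofReal γ)]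
  rw [lintegral_const_mul' _ _ ENNReal.ofReal_ne_top]
  refine ⟨fun h => ENNReal.lt_top_of_mul_ne_top_right h.ne (by simpa using hγ), fun h => ?_⟩
  exact ENNReal.mul_lt_top ENNReal.ofReal_lt_top h

/-! ### The probability that one time precedes another, as a Bromwich integral -/

lemma ofReal_measureReal_Iic_eq [IsFiniteMeasure ρ] [NullSingletonClass ρ] (hρ : ∀ᵐ x ∂ρ, 0 ≤ x)
    (hγ : 0 < γ)
    (hint : Integrable fun u : ℝ =>
      1 / ((γ : ℂ) + u * Complex.I) * laplaceMeasure ρ (γ + u * Complex.I)) (t : ℝ) :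
    (ρ.real (Set.Iic t) : ℂ) = (2 * Real.pi : ℂ)⁻¹ *
      ∫ u : ℝ, Complex.exp ((γ + u * Complex.I) * t) *
        (1 / ((γ : ℂ) + u * Complex.I) * laplaceMeasure ρ (γ + u * Complex.I)) := by
  refine bromwich_inversion (G := fun t => (ρ.real (Set.Iic t) : ℂ))
    (L := fun s => 1 / s * laplaceMeasure ρ s)
    (Complex.continuous_ofReal.comp continuous_measureReal_Iic) ?_ (fun u => ?_) hint t
  · exact (integral_cexp_mul_measureReal_Iic hρ (s := γ) (by rwa [Complex.ofReal_re])).1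
  · exact (integral_cexp_mul_measureReal_Iic hρ (by simpa using hγ)).2

lemma integrable_prod_mul_cexp {F : ℝ → ℂ} (hF : Integrable F)
    (hν : expMoment ν (-γ) < ⊤) :
    Integrable (fun z : ℝ × ℝ => F z.1 * Complex.exp ((γ + z.1 * Complex.I) * z.2))
      (volume.prod ν) := by
  have hexp : Integrable (fun x : ℝ => Complex.exp (-(-(γ : ℂ)) * x)) ν :=
    integrable_cexp_iff.2 (by rwa [Complex.neg_re, Complex.ofReal_re])
  have hbdd : Integrable (fun z : ℝ × ℝ => F z.1 * Complex.exp (-(-(γ : ℂ)) * z.2) *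
      Complex.exp ((z.1 * z.2 : ℝ) * Complex.I)) (volume.prod ν) :=
    (hF.mul_prod hexp).mul_bdd (c := 1) (Continuous.aestronglyMeasurable (by fun_prop))
      (ae_of_all _ fun z => (Complex.norm_exp_ofReal_mul_I _).le)
  refine hbdd.congr (ae_of_all _ fun z => ?_)
  dsimp only
  rw [mul_assoc, ← Complex.exp_add]
  congr 2
  push_cast
  ring

theorem integral_measureReal_Iic_eq_bromwich [IsFiniteMeasure ρ] [NullSingletonClass ρ]
    [SFinite ν] (hρ : ∀ᵐ x ∂ρ, 0 ≤ x) (hγ : 0 < γ) (hν : expMoment ν (-γ) < ⊤)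
    (hint : Integrable fun u : ℝ =>
      1 / ((γ : ℂ) + u * Complex.I) * laplaceMeasure ρ (γ + u * Complex.I)) :
    Integrable (fun u : ℝ => 1 / ((γ : ℂ) + u * Complex.I) *
        laplaceMeasure ρ (γ + u * Complex.I) * laplaceMeasure ν (-(γ + u * Complex.I))) ∧
      ((∫ x, ρ.real (Set.Iic x) ∂ν : ℝ) : ℂ) = (2 * Real.pi : ℂ)⁻¹ *
        ∫ u : ℝ, 1 / ((γ : ℂ) + u * Complex.I) * laplaceMeasure ρ (γ + u * Complex.I) *
          laplaceMeasure ν (-(γ + u * Complex.I)) := by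
  have hprod := integrable_prod_mul_cexp hint hν
  have hinner : ∀ u : ℝ, 1 / ((γ : ℂ) + u * Complex.I) * laplaceMeasure ρ (γ + u * Complex.I) *
      laplaceMeasure ν (-(γ + u * Complex.I)) =
      ∫ x : ℝ, 1 / ((γ : ℂ) + u * Complex.I) * laplaceMeasure ρ (γ + u * Complex.I) *
        Complex.exp ((γ + u * Complex.I) * x) ∂ν := by
    intro u
    rw [integral_const_mul, laplaceMeasure.eq_1 ν, neg_neg]
  simp_rw [hinner]
  refine ⟨hprod.integral_prod_left, ?_⟩
  rw [integral_integral_swap hprod, ← integral_complex_ofReal, ← integral_const_mul]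
  refine integral_congr_ae (ae_of_all _ fun x => ?_)
  dsimp only
  rw [ofReal_measureReal_Iic_eq hρ hγ hint]
  simp_rw [mul_comm (Complex.exp _)]

/-! ### Decay of the transform of a pure-death passage -/

lemma norm_le_norm_ofReal_add {r : ℝ} (hr : 0 ≤ r) (hs : 0 ≤ s.re) : ‖s‖ ≤ ‖(r : ℂ) + s‖ := by
  rw [← sq_le_sq₀ (norm_nonneg _) (norm_nonneg _), ← Complex.normSq_eq_norm_sq,
    ← Complex.normSq_eq_norm_sq]
  simp only [Complex.normSq_apply, Complex.add_re, Complex.add_im, Complex.ofReal_re,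
    Complex.ofReal_im]
  nlinarith

lemma norm_ofReal_div_ofReal_add_le_one {r : ℝ} (hr : 0 ≤ r) (hs : 0 ≤ s.re) :
    ‖(r : ℂ) / (r + s)‖ ≤ 1 := by
  rw [norm_div, Complex.norm_real, Real.norm_of_nonneg hr]
  refine div_le_one_of_le₀ ?_ (norm_nonneg _)
  have hre := Complex.re_le_norm ((r : ℂ) + s)
  rw [Complex.add_re, Complex.ofReal_re] at hre
  linarith

lemma norm_deathTransform_le (death : ℕ → ℝ≥0) {q : ℕ} (hq : 1 ≤ q) (hs : 0 < s.re) :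
    ‖deathTransform death q s‖ ≤ death 1 / ‖s‖ := by
  have hs0 : 0 < ‖s‖ := hs.trans_le (Complex.re_le_norm s)
  have hfirst : ‖((death 1 : ℝ) : ℂ) / (((death 1 : ℝ) : ℂ) + s)‖ ≤ death 1 / ‖s‖ := by
    rw [norm_div, Complex.norm_real, Real.norm_of_nonneg (death 1).coe_nonneg]
    exact div_le_div_of_nonneg_left (death 1).coe_nonneg hs0
      (norm_le_norm_ofReal_add (death 1).coe_nonneg hs.le)
  rw [deathTransform, ← Finset.mul_prod_erase _ _ (Finset.mem_Icc.2 ⟨le_rfl, hq⟩), norm_mul,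
    norm_prod]
  refine (mul_le_of_le_one_right (norm_nonneg _) ?_).trans hfirst
  exact Finset.prod_le_one (fun _ _ => norm_nonneg _) fun k _ =>
    norm_ofReal_div_ofReal_add_le_one (death k).coe_nonneg hs.le

lemma integrable_inv_sq_add_sq (hγ : γ ≠ 0) : Integrable fun u : ℝ => (γ ^ 2 + u ^ 2)⁻¹ := by
  refine ((integrable_inv_one_add_sq.comp_div hγ).const_mul (γ ^ 2)⁻¹).congr
    (ae_of_all _ fun u => ?_)
  dsimp only
  rw [← mul_inv]
  congr 1
  field_simp

lemma integrable_deathTransform (death : ℕ → ℝ≥0) {q : ℕ} (hq : 1 ≤ q) (hγ : 0 < γ) :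
    Integrable fun u : ℝ => 1 / ((γ : ℂ) + u * Complex.I) *
      deathTransform death q (γ + u * Complex.I) := by
  refine ((integrable_inv_sq_add_sq hγ.ne').const_mul (death 1 : ℝ)).mono' ?_
    (ae_of_all _ fun u => ?_)
  · unfold deathTransform
    exact (Measurable.mul (by fun_prop) (Finset.measurable_fun_prod _ fun k _ =>
      by fun_prop)).aestronglyMeasurable
  · have hs : 0 < ((γ : ℂ) + u * Complex.I).re := by simpa using hγ
    have hsq : ‖(γ : ℂ) + u * Complex.I‖ ^ 2 = γ ^ 2 + u ^ 2 := by
      rw [← Complex.normSq_eq_norm_sq, Complex.normSq_add_mul_I]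
    rw [norm_mul, norm_div, norm_one, ← hsq]
    calc 1 / ‖(γ : ℂ) + u * Complex.I‖ * ‖deathTransform death q (γ + u * Complex.I)‖
        ≤ 1 / ‖(γ : ℂ) + u * Complex.I‖ * (death 1 / ‖(γ : ℂ) + u * Complex.I‖) := by
          gcongr
          exact norm_deathTransform_le death hq hs
      _ = death 1 * (‖(γ : ℂ) + u * Complex.I‖ ^ 2)⁻¹ := by ring

/-! ### The minimum of a random time and an independent exponential time -/

section Minimum

variable {ρ ν : Measure ℝ} {z s : ℂ} {c γ : ℝ}

lemma integral_cexp_mul_one_sub_measureReal_Iic_of_re_pos [IsFiniteMeasure ρ]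
    (hρ : ∀ᵐ x ∂ρ, 0 < x) (hz : 0 < z.re) :
    ∫ t in Set.Ioi (0 : ℝ), Complex.exp (-z * t) * ((1 - ρ.real (Set.Iic t) : ℝ) : ℂ) =
      1 / z * (1 - laplaceMeasure ρ z) := by
  obtain ⟨hint, hlaplace⟩ := integral_cexp_mul_measureReal_Iic (hρ.mono fun _ h => h.le) hz
  have hre : (-z).re < 0 := by simpa using hz
  have hIoi : ∫ t in Set.Ioi (0 : ℝ), Complex.exp (-z * t) * (ρ.real (Set.Iic t) : ℂ) =
      1 / z * laplaceMeasure ρ z := by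
    rw [← hlaplace]
    refine setIntegral_eq_integral_of_forall_compl_eq_zero fun t ht => ?_
    have hnull : ρ (Set.Iic t) = 0 := by
      rw [measure_eq_zero_iff_ae_notMem]
      filter_upwards [hρ] with x hx hxt
      exact ht (hx.trans_le hxt)
    rw [measureReal_def, hnull, ENNReal.toReal_zero, Complex.ofReal_zero, mul_zero]
  simp only [Complex.ofReal_sub, Complex.ofReal_one, mul_sub, mul_one]
  rw [integral_sub (integrableOn_exp_mul_complex_Ioi hre 0) hint.integrableOn, hIoi,
    integral_exp_mul_complex_Ioi hre 0]
  simp [neg_div_neg_eq]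

lemma integral_cexp_mul_one_sub_measureReal_Iic_of_re_neg [IsProbabilityMeasure ρ]
    (hρ : ∀ᵐ x ∂ρ, 0 < x) (hz : z.re < 0) (hmoment : expMoment ρ z.re < ⊤) :
    ∫ t in Set.Ioi (0 : ℝ), Complex.exp (-z * t) * ((1 - ρ.real (Set.Iic t) : ℝ) : ℂ) =
      1 / z * (1 - laplaceMeasure ρ z) := by
  simp_rw [← probReal_compl_eq_one_sub measurableSet_Iic, Set.compl_Iic]
  rw [integral_cexp_mul_measureReal_Ioi (hρ.mono fun _ h => h.le) hz.ne hmoment, probReal_univ,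
    Complex.ofReal_one]

lemma expMoment_neg_lt_top_of_tail_le [IsFiniteMeasure ν] (hν : ∀ᵐ x ∂ν, 0 ≤ x) (hγ : 0 < γ)
    (hγc : γ < c) (htail : ∀ t, 0 < t → ν.real (Set.Ioi t) ≤ Real.exp (-(c * t))) :
    expMoment ν (-γ) < ⊤ := by
  rw [expMoment_neg_lt_top_iff hν hγ]
  calc ∫⁻ t in Set.Ioi 0, ν (Set.Ioi t) * ENNReal.ofReal (Real.exp (γ * t))
      ≤ ∫⁻ t in Set.Ioi 0, ENNReal.ofReal (Real.exp (-((c - γ) * t))) := by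
        refine setLIntegral_mono' measurableSet_Ioi fun t ht => ?_
        rw [← ofReal_measureReal, ← ENNReal.ofReal_mul measureReal_nonneg,
          show -((c - γ) * t) = -(c * t) + γ * t by ring, Real.exp_add]
        gcongr
        exact htail t ht
    _ < ⊤ := by
        rw [lintegral_exp_Ioi (sub_pos.2 hγc)]
        exact ENNReal.ofReal_lt_top

lemma expMoment_neg_lt_top_iff_of_tail_eq [IsFiniteMeasure ρ] [IsFiniteMeasure ν]
    (hρ : ∀ᵐ x ∂ρ, 0 ≤ x) (hν : ∀ᵐ x ∂ν, 0 ≤ x) (hγ : 0 < γ) (hcγ : c < γ)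
    (htail : ∀ t, 0 < t → ν.real (Set.Ioi t) = ρ.real (Set.Ioi t) * Real.exp (-(c * t))) :
    expMoment ν (-γ) < ⊤ ↔ expMoment ρ (-(γ - c)) < ⊤ := by
  rw [expMoment_neg_lt_top_iff hν hγ, expMoment_neg_lt_top_iff hρ (sub_pos.2 hcγ)]
  refine iff_of_eq (congrArg (· < ⊤) (setLIntegral_congr_fun measurableSet_Ioi fun t ht => ?_))
  rw [← ofReal_measureReal, ← ofReal_measureReal (μ := ρ), ← ENNReal.ofReal_mul measureReal_nonneg,
    ← ENNReal.ofReal_mul measureReal_nonneg, htail t ht,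
    show (γ - c) * t = -(c * t) + γ * t by ring, Real.exp_add, mul_assoc]

lemma laplaceMeasure_neg_of_tail_eq [IsProbabilityMeasure ν] (hν : ∀ᵐ x ∂ν, 0 ≤ x)
    (hs : 0 < s.re) (hsc : s.re ≠ c) (hmoment : expMoment ν (-s.re) < ⊤)
    (htail : ∀ t, 0 < t → ν.real (Set.Ioi t) = (1 - ρ.real (Set.Iic t)) * Real.exp (-(c * t)))
    (hρ : ∫ t in Set.Ioi (0 : ℝ), Complex.exp (-(c - s) * t) * ((1 - ρ.real (Set.Iic t) : ℝ) : ℂ) =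
      1 / (c - s) * (1 - laplaceMeasure ρ (c - s))) :
    laplaceMeasure ν (-s) =
      laplaceMeasure ρ (c - s) + c / (c - s) * (1 - laplaceMeasure ρ (c - s)) := by
  have htailν := integral_cexp_mul_measureReal_Ioi (s := -s) hν (by simpa using hs.ne')
    (by simpa using hmoment)
  have hcongr : ∫ t in Set.Ioi (0 : ℝ), Complex.exp (-(-s) * t) * (ν.real (Set.Ioi t) : ℂ) =
      ∫ t in Set.Ioi (0 : ℝ), Complex.exp (-(c - s) * t) * ((1 - ρ.real (Set.Iic t) : ℝ) : ℂ) := by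
    refine setIntegral_congr_fun measurableSet_Ioi fun t ht => ?_
    simp only [htail t ht]
    rw [Complex.ofReal_mul, Complex.ofReal_exp, mul_left_comm, ← Complex.exp_add, mul_comm]
    congr 2
    push_cast
    ring
  rw [hcongr, hρ, probReal_univ, Complex.ofReal_one] at htailν
  have hs0 : s ≠ 0 := fun h => hs.ne' (by rw [h, Complex.zero_re])
  have hcs : (c : ℂ) - s ≠ 0 := fun h => hsc (by rw [← sub_eq_zero.1 h, Complex.ofReal_re])
  field_simp at htailν ⊢
  linear_combination -htailν

theorem laplaceMeasure_neg_of_min_exponential [IsFiniteMeasure ρ] [IsProbabilityMeasure ν]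
    (hρ : ∀ᵐ x ∂ρ, 0 < x) (hν : ∀ᵐ x ∂ν, 0 ≤ x) (hγ : 0 < γ)
    (htail : ∀ t, 0 < t → ν.real (Set.Ioi t) = (1 - ρ.real (Set.Iic t)) * Real.exp (-(c * t)))
    (hc : γ < c ∨ c < γ ∧ IsProbabilityMeasure ρ ∧ expMoment ρ (c - γ) < ⊤) :
    expMoment ν (-γ) < ⊤ ∧ ∀ s : ℂ, s.re = γ → laplaceMeasure ν (-s) =
      laplaceMeasure ρ (c - s) + c / (c - s) * (1 - laplaceMeasure ρ (c - s)) := by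
  rcases hc with hγc | ⟨hcγ, hprob, hmoment⟩
  · have hνmoment : expMoment ν (-γ) < ⊤ := expMoment_neg_lt_top_of_tail_le hν hγ hγc fun t ht =>
      (htail t ht).trans_le <|
        mul_le_of_le_one_left (Real.exp_pos _).le (sub_le_self 1 measureReal_nonneg)
    refine ⟨hνmoment, ?_⟩
    rintro s rfl
    exact laplaceMeasure_neg_of_tail_eq hν hγ hγc.ne hνmoment htail
      (integral_cexp_mul_one_sub_measureReal_Iic_of_re_pos hρ (by simpa using hγc))
  · have hνmoment : expMoment ν (-γ) < ⊤ := by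
      rw [expMoment_neg_lt_top_iff_of_tail_eq (hρ.mono fun _ h => h.le) hν hγ hcγ fun t ht => by
        rw [htail t ht, ← probReal_compl_eq_one_sub measurableSet_Iic, Set.compl_Iic], neg_sub]
      exact hmoment
    refine ⟨hνmoment, ?_⟩
    rintro s rfl
    exact laplaceMeasure_neg_of_tail_eq hν hγ hcγ.ne' hνmoment htail
      (integral_cexp_mul_one_sub_measureReal_Iic_of_re_neg hρ (by simpa using hcγ)
        (by simpa using hmoment))

end Minimum

/-! ### First-passage laws of birth-death processes -/

namespace IsBirthDeath

variable {Ω : Type*} [MeasurableSpace Ω] {P : Measure Ω} [IsProbabilityMeasure P]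
  {X : ℝ≥0 → Ω → ℕ} {x₀ : ℕ} {birth death : ℕ → ℝ≥0} {f : ℝ → ℝ}

lemma firstPassageLaw_Iic (h : IsBirthDeath P X x₀ birth death) (t : ℝ≥0) :
    firstPassageLaw birth death x₀ (Set.Iic t) = P {ω | firstPassage X ω ≤ t} := by
  rw [← h.measure_firstPassage measurableSet_Iic]
  congr 1
  ext ω
  constructor
  · rintro ⟨hfin, hle⟩
    exact (ENNReal.toReal_le_toReal hfin ENNReal.coe_ne_top).1 hle
  · intro (hle : firstPassage X ω ≤ t)
    exact ⟨ne_top_of_le_ne_top ENNReal.coe_ne_top hle, ENNReal.toReal_mono ENNReal.coe_ne_top hle⟩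

lemma isProbabilityMeasure_firstPassageLaw (h : IsBirthDeath P X x₀ birth death)
    (hfin : ∀ᵐ ω ∂P, firstPassage X ω ≠ ⊤) :
    IsProbabilityMeasure (firstPassageLaw birth death x₀) := by
  constructor
  rw [← h.measure_firstPassage MeasurableSet.univ]
  exact (measure_congr (eventuallyEq_univ.2 (hfin.mono fun ω hω => ⟨hω, trivial⟩))).trans
    measure_univ

lemma laplaceConverges_iff_integrable (h : IsBirthDeath P X x₀ birth death)
    (hf : IsDensity P (firstPassage X) f) {s : ℂ} :
    LaplaceConverges f s ↔
      Integrable (fun t : ℝ => Complex.exp (-s * t)) (firstPassageLaw birth death x₀) := by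
  rw [laplaceConverges_iff hf.measurable hf.nonneg, h.withDensity_eq hf]

lemma laplace_eq_laplaceMeasure (h : IsBirthDeath P X x₀ birth death)
    (hf : IsDensity P (firstPassage X) f) :
    laplace f = laplaceMeasure (firstPassageLaw birth death x₀) := by
  funext s
  rw [_root_.laplace_eq_laplaceMeasure hf.measurable hf.nonneg, h.withDensity_eq hf]

lemma exists_tendsto_contFrac_laplace (h : IsBirthDeath P X x₀ birth death)
    (hf : IsDensity P (firstPassage X) f) (hx₀ : 1 ≤ x₀) (hb : ∀ k, 0 < birth k)
    (hd : ∀ k, 1 ≤ k → 0 < death k) {s : ℂ} (hs : LaplaceConverges f s) :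
    ∃ K : ℕ → ℂ,
      (∀ m ∈ Finset.Icc 1 x₀, Tendsto (fun n => contFrac
        (fun k => -(((birth (k - 1) * death k : ℝ≥0) : ℝ) : ℂ))
        (fun k => (((birth k + death k : ℝ≥0) : ℝ) : ℂ) + s) n m) atTop (𝓝 (K m))) ∧
      laplace f s = ∏ m ∈ Finset.Icc 1 x₀, (-(1 / ((birth (m - 1) : ℝ) : ℂ)) * K m) := by
  obtain ⟨R, hR, hprod⟩ := exists_tendsto_cladder_laplaceMeasure hb hd hx₀
    ((h.laplaceConverges_iff_integrable hf).1 hs)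
  refine ⟨fun m => -((birth (m - 1) : ℝ) : ℂ) * R (m - 1), fun m hm => ?_, ?_⟩
  · have hm : 1 ≤ m := (Finset.mem_Icc.1 hm).1
    refine ((hR (m - 1)).const_mul _).congr fun n => ?_
    rw [Nat.sub_add_cancel hm]
    exact (contFrac_eq_ladder (lam := fun k => ((birth k : ℝ) : ℂ))
      (mu := fun k => ((death k : ℝ) : ℂ)) (fun k _ => by push_cast; rfl)
      (fun k => by push_cast; rfl) n hm).symm
  · rw [h.laplace_eq_laplaceMeasure hf, hprod, Finset.range_eq_Ico,
      ← Finset.prod_Ico_add_right_sub_eq 0 x₀ 1]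
    refine Finset.prod_congr (by ext; simp) fun m _ => ?_
    have hne : ((birth (m - 1) : ℝ) : ℂ) ≠ 0 := mod_cast (hb (m - 1)).ne'
    field_simp

end IsBirthDeath

/-! ### The fill probability -/

lemma inverseLaplace_zero (F : ℂ → ℂ) (γ : ℝ) :
    inverseLaplace F γ 0 = (2 * Real.pi : ℂ)⁻¹ * ∫ u : ℝ, F (γ + u * Complex.I) := by
  simp only [inverseLaplace, Complex.ofReal_zero, mul_zero, Complex.exp_zero, one_mul]
  rw [integral_mul_const]
  field_simp

lemma measure_mem_eq_lintegral_of_indepFun {Ω α β : Type*} [MeasurableSpace Ω] [MeasurableSpace α]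
    [MeasurableSpace β] {P : Measure Ω} [IsFiniteMeasure P] {S : Ω → α} {T : Ω → β}
    (hindep : IndepFun S T P) (hS : Measurable S) (hT : Measurable T) {D : Set (α × β)}
    (hD : MeasurableSet D) :
    P {ω | (S ω, T ω) ∈ D} = ∫⁻ ω, P {ω' | (S ω', T ω) ∈ D} ∂P := by
  calc P {ω | (S ω, T ω) ∈ D} = ((P.map S).prod (P.map T)) D := by
        rw [← (indepFun_iff_map_prod_eq_prod_map_map hS.aemeasurable hT.aemeasurable).1 hindep,
          Measure.map_apply (hS.prodMk hT) hD]
        rfl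
    _ = ∫⁻ ω, P {ω' | (S ω', T ω) ∈ D} ∂P := by
        rw [Measure.prod_apply_symm hD, lintegral_map (measurable_measure_prodMk_right hD) hT]
        refine lintegral_congr fun ω => ?_
        rw [Measure.map_apply hS (measurable_prodMk_right hD)]
        rfl

section Fill

variable {Ω 𝒳 : Type*} [MeasurableSpace Ω] {P : Measure Ω} {X : ℕ → 𝒳}
  {lam : Side → ℕ → 𝒳 → ℝ≥0} {mu phi : ℕ → 𝒳 → ℝ≥0} {N : ℕ} {p q₀ : Side → ℕ} {i : Side}
  {Z : Side → ℕ → ℝ≥0 → Ω → ℕ} {Q : ℝ≥0 → Ω → ℕ → ℤ}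

/-- The law of the time at which the tagged order on side `i` would be filled in a book whose
mid-price did not move. -/
def positionLaw (X : ℕ → 𝒳) (mu phi : ℕ → 𝒳 → ℝ≥0) (p q₀ : Side → ℕ) (i : Side) : Measure ℝ :=
  firstPassageLaw (fun _ => 0) (fun k => mu k (X (p i)) + phi k (X (p i))) (q₀ i)

/-- The law of the depletion time of the best queue opposite to side `i`, a measure of mass less
than `1` if the queue may never be depleted. -/
def oppositeLaw (X : ℕ → 𝒳) (lam : Side → ℕ → 𝒳 → ℝ≥0) (mu phi : ℕ → 𝒳 → ℝ≥0)
    (p q₀ : Side → ℕ) (i : Side) : Measure ℝ :=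
  firstPassageLaw (fun k => lam i.opp k (X (p i.opp)))
    (fun k => mu k (X (p i.opp)) + phi k (X (p i.opp))) (q₀ i.opp)

/-- The law of `rivalTime`, where the value `∞` is read as `0`. -/
def rivalLaw (P : Measure Ω) (p : Side → ℕ) (i : Side) (Z : Side → ℕ → ℝ≥0 → Ω → ℕ) :
    Measure ℝ :=
  P.map fun ω => (rivalTime p i Z ω).toReal

lemma insideRate_eq_two_mul {s₀ : ℕ} (hspread : p .ask = p .bid + s₀) {Λ : ℝ}
    (hask : Λ = ∑ m ∈ Finset.Icc 1 (s₀ - 1), (lam .ask 0 (X (p .ask - m)) : ℝ))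
    (hbid : Λ = ∑ m ∈ Finset.Icc 1 (s₀ - 1), (lam .bid 0 (X (p .bid + m)) : ℝ)) :
    insideRate lam X p = 2 * Λ := by
  rw [hspread, ← sum_Ioo_eq_sum_sub fun l => (lam .ask 0 (X l) : ℝ)] at hask
  rw [← sum_Ioo_eq_sum_add fun l => (lam .bid 0 (X l) : ℝ)] at hbid
  rw [insideRate, hspread, two_mul]
  nth_rewrite 1 [hask]
  rw [hbid]
  exact Finset.sum_pair nofun

lemma fillTransform_zero_rate (gHat fHat : ℂ → ℂ) (s : ℂ) :
    fillTransform gHat fHat 0 s = 1 / s * gHat s * fHat (-s) := by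
  simp [fillTransform]

namespace IsTaggedBook

lemma ae_rivalLaw_nonneg (hbook : IsTaggedBook P X lam mu phi N p q₀ i Z Q)
    (hp : p .bid < p .ask) : ∀ᵐ x ∂rivalLaw P p i Z, 0 ≤ x :=
  (ae_map_iff (hbook.measurable_rivalTime hp).ennreal_toReal.aemeasurable measurableSet_Ici).2
    (ae_of_all _ fun _ => ENNReal.toReal_nonneg)

variable [IsProbabilityMeasure P]

lemma measureReal_lt_rivalTime (hbook : IsTaggedBook P X lam mu phi N p q₀ i Z Q)
    (hp : p .bid < p .ask) (t : ℝ≥0) :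
    P.real {ω | (t : ℝ≥0∞) < rivalTime p i Z ω} =
      (1 - (oppositeLaw X lam mu phi p q₀ i).real (Set.Iic t)) *
        Real.exp (-(insideRate lam X p * t)) := by
  have hclock := hbook.measurable_clock hp ((mem_activeQueues_iff hp).2 (.inl (Eq.refl (p i.opp))))
  have hle : (oppositeLaw X lam mu phi p q₀ i).real (Set.Iic t) =
      P.real {ω | clock p Z (i.opp, p i.opp) ω ≤ t} := by
    rw [measureReal_def, oppositeLaw, hbook.opposite.firstPassageLaw_Iic]
    refine congrArg ENNReal.toReal (measure_congr (eventuallyEq_set.2 ?_))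
    filter_upwards [hbook.ae_firstPassage_eq hp i.opp] with ω hω
    rw [hω]
  rw [hle, ← probReal_compl_eq_one_sub (measurableSet_le hclock measurable_const),
    measureReal_def, hbook.measure_lt_rivalTime hp, ENNReal.toReal_mul,
    ENNReal.toReal_ofReal (Real.exp_pos _).le, measureReal_def]
  simp only [Set.compl_ofPred, not_le]

lemma ae_rivalTime_ne_top_of_insideRate_pos (hbook : IsTaggedBook P X lam mu phi N p q₀ i Z Q)
    (hp : p .bid < p .ask) (hrate : 0 < insideRate lam X p) :
    ∀ᵐ ω ∂P, rivalTime p i Z ω ≠ ⊤ := by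
  have hle : ∀ n : ℕ, P.real {ω | rivalTime p i Z ω = ⊤} ≤ Real.exp (-(insideRate lam X p * n)) :=
    fun n => calc P.real {ω | rivalTime p i Z ω = ⊤}
      _ ≤ P.real {ω | ((n : ℝ≥0) : ℝ≥0∞) < rivalTime p i Z ω} :=
        measureReal_mono fun ω (hω : rivalTime p i Z ω = ⊤) => ENNReal.coe_lt_top.trans_eq hω.symm
      _ ≤ _ := by
        rw [hbook.measureReal_lt_rivalTime hp]
        exact mul_le_of_le_one_left (Real.exp_pos _).le (sub_le_self 1 measureReal_nonneg)
  have hlim : Tendsto (fun n : ℕ => Real.exp (-(insideRate lam X p * n))) atTop (𝓝 0) :=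
    Real.tendsto_exp_neg_atTop_nhds_zero.comp (tendsto_natCast_atTop_atTop.const_mul_atTop hrate)
  have hnull := le_antisymm (ge_of_tendsto' hlim hle) measureReal_nonneg
  rw [measureReal_eq_zero_iff] at hnull
  simpa only [ae_iff, not_not] using hnull

lemma ae_rivalTime_ne_top_of_opposite (hbook : IsTaggedBook P X lam mu phi N p q₀ i Z Q)
    (hp : p .bid < p .ask) (hfin : ∀ᵐ ω ∂P, firstPassage (Z i.opp (p i.opp)) ω ≠ ⊤) :
    ∀ᵐ ω ∂P, rivalTime p i Z ω ≠ ⊤ := by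
  filter_upwards [hfin, hbook.ae_firstPassage_eq hp i.opp] with ω hω heq
  rw [heq] at hω
  exact ne_top_of_le_ne_top hω (Finset.inf_le (Finset.mem_insert_self _ _))

lemma isProbabilityMeasure_rivalLaw (hbook : IsTaggedBook P X lam mu phi N p q₀ i Z Q)
    (hp : p .bid < p .ask) : IsProbabilityMeasure (rivalLaw P p i Z) :=
  Measure.isProbabilityMeasure_map (hbook.measurable_rivalTime hp).ennreal_toReal.aemeasurable

lemma rivalLaw_measureReal_Ioi (hbook : IsTaggedBook P X lam mu phi N p q₀ i Z Q)
    (hp : p .bid < p .ask) (hfin : ∀ᵐ ω ∂P, rivalTime p i Z ω ≠ ⊤) {t : ℝ} (ht : 0 < t) :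
    (rivalLaw P p i Z).real (Set.Ioi t) =
      (1 - (oppositeLaw X lam mu phi p q₀ i).real (Set.Iic t)) *
        Real.exp (-(insideRate lam X p * t)) := by
  lift t to ℝ≥0 using ht.le
  rw [← hbook.measureReal_lt_rivalTime hp t, rivalLaw,
    map_measureReal_apply (hbook.measurable_rivalTime hp).ennreal_toReal measurableSet_Ioi]
  refine measureReal_congr (eventuallyEq_set.2 ?_)
  filter_upwards [hfin] with ω hω
  exact ENNReal.toReal_lt_toReal ENNReal.coe_ne_top hω

lemma measureReal_fillEvent (hbook : IsTaggedBook P X lam mu phi N p q₀ i Z Q) (hb : 1 ≤ p .bid)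
    (ha : p .ask ≤ N) (hp : p .bid < p .ask) (hfin : ∀ᵐ ω ∂P, rivalTime p i Z ω ≠ ⊤) :
    P.real (fillEvent N p i Z Q) =
      ∫ x, (positionLaw X mu phi p q₀ i).real (Set.Iic x) ∂rivalLaw P p i Z := by
  set ρ := positionLaw X mu phi p q₀ i
  have : IsFiniteMeasure ρ := hbook.position.isFiniteMeasure_firstPassageLaw
  have hS := hbook.measurable_clock hp ((mem_activeQueues_iff hp).2 (.inl (Eq.refl (p i))))
  have hT := hbook.measurable_rivalTime hp
  have hD : MeasurableSet {z : ℝ≥0∞ × ℝ≥0∞ | z.1 ≠ ⊤ ∧ z.1 ≤ z.2} :=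
    (measurable_fst (measurableSet_singleton ⊤).compl).inter
      (measurableSet_le measurable_fst measurable_snd)
  have hmono : Measurable fun x => ρ (Set.Iic x) :=
    Monotone.measurable fun x y hxy => measure_mono (Set.Iic_subset_Iic.2 hxy)
  have hsection : ∀ t : ℝ≥0, P {ω | clock p Z (i, p i) ω ≠ ⊤ ∧ clock p Z (i, p i) ω ≤ t} =
      ρ (Set.Iic t) := by
    intro t
    refine Eq.trans (measure_congr (eventuallyEq_set.2 ?_))
      (hbook.position.firstPassageLaw_Iic t).symm
    filter_upwards [hbook.ae_firstPassage_eq hp i] with ω hω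
    rw [hω]
    exact and_iff_right_of_imp (ne_top_of_le_ne_top ENNReal.coe_ne_top)
  have hfill : P (fillEvent N p i Z Q) = ∫⁻ ω, ρ (Set.Iic (rivalTime p i Z ω).toReal) ∂P := by
    rw [measure_congr (hbook.fillEvent_ae_eq hb ha hp)]
    refine (measure_mem_eq_lintegral_of_indepFun (hbook.indepFun_rivalTime hp) hS hT hD).trans
      (lintegral_congr_ae ?_)
    filter_upwards [hfin] with ω hω
    lift rivalTime p i Z ω to ℝ≥0 using hω with t
    exact hsection t
  simp only [measureReal_def]
  rw [integral_toReal hmono.aemeasurable (ae_of_all _ fun _ => measure_lt_top _ _), hfill,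
    rivalLaw, lintegral_map hmono hT.ennreal_toReal]

lemma ae_rivalTime_ne_top (hbook : IsTaggedBook P X lam mu phi N p q₀ i Z Q)
    (hp : p .bid < p .ask)
    (h : 0 < insideRate lam X p ∨ ∀ᵐ ω ∂P, firstPassage (Z i.opp (p i.opp)) ω ≠ ⊤) :
    ∀ᵐ ω ∂P, rivalTime p i Z ω ≠ ⊤ :=
  h.elim (hbook.ae_rivalTime_ne_top_of_insideRate_pos hp) (hbook.ae_rivalTime_ne_top_of_opposite hp)

lemma laplaceMeasure_rivalLaw_neg (hbook : IsTaggedBook P X lam mu phi N p q₀ i Z Q)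
    (hp : p .bid < p .ask) (hq : q₀ i.opp ≠ 0) (hfin : ∀ᵐ ω ∂P, rivalTime p i Z ω ≠ ⊤)
    {c γ : ℝ} (hc : insideRate lam X p = c) (hγ : 0 < γ)
    (hcase : γ < c ∨ c < γ ∧ (∀ᵐ ω ∂P, firstPassage (Z i.opp (p i.opp)) ω ≠ ⊤) ∧
      expMoment (oppositeLaw X lam mu phi p q₀ i) (c - γ) < ⊤) :
    expMoment (rivalLaw P p i Z) (-γ) < ⊤ ∧ ∀ s : ℂ, s.re = γ →
      laplaceMeasure (rivalLaw P p i Z) (-s) =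
        laplaceMeasure (oppositeLaw X lam mu phi p q₀ i) (c - s) +
          c / (c - s) * (1 - laplaceMeasure (oppositeLaw X lam mu phi p q₀ i) (c - s)) := by
  have := hbook.isProbabilityMeasure_rivalLaw hp
  have : IsFiniteMeasure (oppositeLaw X lam mu phi p q₀ i) :=
    hbook.opposite.isFiniteMeasure_firstPassageLaw
  subst hc
  refine laplaceMeasure_neg_of_min_exponential
    ((firstPassageLaw_absolutelyContinuous hq).ae_le (ae_restrict_mem measurableSet_Ioi))
    (hbook.ae_rivalLaw_nonneg hp) hγ (fun t ht => hbook.rivalLaw_measureReal_Ioi hp hfin ht)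
    (hcase.imp_right fun ⟨hγc, hopp, hmoment⟩ =>
      ⟨hγc, hbook.opposite.isProbabilityMeasure_firstPassageLaw hopp, hmoment⟩)

lemma integral_positionLaw_eq_bromwich (hbook : IsTaggedBook P X lam mu phi N p q₀ i Z Q)
    (hq : 1 ≤ q₀ i) {ν : Measure ℝ} [SFinite ν] {γ : ℝ} (hγ : 0 < γ) (hν : expMoment ν (-γ) < ⊤) :
    let F : ℂ → ℂ := fun s => 1 / s *
      deathTransform (fun k => mu k (X (p i)) + phi k (X (p i))) (q₀ i) s * laplaceMeasure ν (-s)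
    Integrable (fun u : ℝ => F (γ + u * Complex.I)) ∧
      ((∫ x, (positionLaw X mu phi p q₀ i).real (Set.Iic x) ∂ν : ℝ) : ℂ) =
        (2 * Real.pi : ℂ)⁻¹ * ∫ u : ℝ, F (γ + u * Complex.I) := by
  have hac : positionLaw X mu phi p q₀ i ≪ volume.restrict (Set.Ioi 0) :=
    firstPassageLaw_absolutelyContinuous (Nat.one_le_iff_ne_zero.1 hq)
  have : IsFiniteMeasure (positionLaw X mu phi p q₀ i) :=
    hbook.position.isFiniteMeasure_firstPassageLaw
  have : NullSingletonClass (positionLaw X mu phi p q₀ i) := ⟨fun x => hac (by simp)⟩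
  have htransform : ∀ u : ℝ, laplaceMeasure (positionLaw X mu phi p q₀ i) (γ + u * Complex.I) =
      deathTransform (fun k => mu k (X (p i)) + phi k (X (p i))) (q₀ i) (γ + u * Complex.I) :=
    fun u => (laplaceMeasure_firstPassageLaw_death fun k _ => by
      have hre : ((γ : ℂ) + u * Complex.I).re = γ := by simp
      exact (neg_nonpos.2 (NNReal.coe_nonneg _)).trans_lt (hγ.trans_eq hre.symm)).2
  have hnonneg : ∀ᵐ x ∂positionLaw X mu phi p q₀ i, 0 ≤ x :=
    Eventually.mono (hac.ae_le (ae_restrict_mem measurableSet_Ioi)) fun _ h => le_of_lt h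
  have hmain := integral_measureReal_Iic_eq_bromwich hnonneg hγ hν
    (by simpa only [htransform] using integrable_deathTransform _ hq hγ)
  simpa only [htransform] using hmain

theorem measureReal_fillEvent_eq_inverseLaplace
    (hbook : IsTaggedBook P X lam mu phi N p q₀ i Z Q) (hb : 1 ≤ p .bid) (ha : p .ask ≤ N)
    (hp : p .bid < p .ask) (hq : ∀ s, 1 ≤ q₀ s) {Λ γ : ℝ} (hΛ : insideRate lam X p = 2 * Λ)
    (hγ : 0 < γ)
    (hcase : γ < 2 * Λ ∨ 2 * Λ < γ ∧ (∀ᵐ ω ∂P, firstPassage (Z i.opp (p i.opp)) ω ≠ ⊤) ∧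
      expMoment (oppositeLaw X lam mu phi p q₀ i) (2 * Λ - γ) < ⊤) :
    let F := fillTransform (deathTransform (fun k => mu k (X (p i)) + phi k (X (p i))) (q₀ i))
      (laplaceMeasure (oppositeLaw X lam mu phi p q₀ i)) Λ
    Integrable (fun u : ℝ => F (γ + u * Complex.I)) ∧
      ((P.real (fillEvent N p i Z Q) : ℝ) : ℂ) = inverseLaplace F γ 0 := by
  intro F
  have hfin : ∀ᵐ ω ∂P, rivalTime p i Z ω ≠ ⊤ := hbook.ae_rivalTime_ne_top hp <|
    hcase.imp (fun h => by linarith) fun h => h.2.1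
  have := hbook.isProbabilityMeasure_rivalLaw hp
  obtain ⟨hmoment, htransform⟩ :=
    hbook.laplaceMeasure_rivalLaw_neg hp (Nat.one_le_iff_ne_zero.1 (hq _)) hfin hΛ hγ hcase
  have hrival : ∀ u : ℝ, 1 / ((γ : ℂ) + u * Complex.I) *
      deathTransform (fun k => mu k (X (p i)) + phi k (X (p i))) (q₀ i) (γ + u * Complex.I) *
        laplaceMeasure (rivalLaw P p i Z) (-(γ + u * Complex.I)) = F (γ + u * Complex.I) := by
    intro u
    rw [htransform _ (by simp), Complex.ofReal_mul, Complex.ofReal_ofNat]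
    rfl
  rw [hbook.measureReal_fillEvent hb ha hp hfin, inverseLaplace_zero]
  simpa only [hrival] using hbook.integral_positionLaw_eq_bromwich (hq i) hγ hmoment

end IsTaggedBook

end Fill

end

theorem mainTheorem2 {Ω 𝒳 : Type*} [MeasurableSpace Ω] (P : Measure Ω) [IsProbabilityMeasure P]
    (X : ℕ → 𝒳) (lam : Side → ℕ → 𝒳 → ℝ≥0) (mu phi : ℕ → 𝒳 → ℝ≥0)
    (N : ℕ) (p q₀ : Side → ℕ) (s₀ : ℕ) (hs₀ : 1 ≤ s₀) (hspread : p .ask = p .bid + s₀)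
    (hbid : 1 ≤ p .bid) (hask : p .ask ≤ N) (hq₀ : ∀ s, 1 ≤ q₀ s)
    (i : Side) (hpos : ∀ k ∈ Finset.Icc 1 (q₀ i), 0 < mu k (X (p i)) + phi k (X (p i)))
    (Λ : ℝ) (hΛask : Λ = ∑ m ∈ Finset.Icc 1 (s₀ - 1), (lam .ask 0 (X (p .ask - m)) : ℝ))
    (hΛbid : Λ = ∑ m ∈ Finset.Icc 1 (s₀ - 1), (lam .bid 0 (X (p .bid + m)) : ℝ))
    (Z : Side → ℕ → ℝ≥0 → Ω → ℕ) (Q : ℝ≥0 → Ω → ℕ → ℤ)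
    (hbook : IsTaggedBook P X lam mu phi N p q₀ i Z Q) :
    let j := i.opp
    let ε := firstPassage (Z i (p i))
    let σ := firstPassage (Z j (p j))
    let gHat := deathTransform (fun k => mu k (X (p i)) + phi k (X (p i))) (q₀ i)
    ∃ g f : ℝ → ℝ, IsDensity P ε g ∧ IsDensity P σ f ∧
      -- the transform of the time to fill
      (∀ s : ℂ,
        (∀ k ∈ Finset.Icc 1 (q₀ i), -((mu k (X (p i)) + phi k (X (p i)) : ℝ≥0) : ℝ) < s.re) →
        LaplaceConverges g s ∧ laplace g s = gHat s) ∧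
      -- the transform of the depletion time of the opposite queue, as a product of continued fractions
      ((∀ k, 0 < lam j k (X (p j))) → (∀ k, 1 ≤ k → 0 < mu k (X (p j)) + phi k (X (p j))) →
        ∀ s : ℂ, LaplaceConverges f s →
          ∃ K : ℕ → ℂ,
            (∀ m ∈ Finset.Icc 1 (q₀ j),
              Tendsto (fun n => contFrac
                (fun k => -(((lam j (k - 1) (X (p j)) *
                  (mu k (X (p j)) + phi k (X (p j))) : ℝ≥0) : ℝ) : ℂ))
                (fun k => (((lam j k (X (p j)) + mu k (X (p j)) + phi k (X (p j)) : ℝ≥0) : ℝ) : ℂ)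
                  + s) n m) atTop (𝓝 (K m))) ∧
            laplace f s =
              ∏ m ∈ Finset.Icc 1 (q₀ j), (-(1 / ((lam j (m - 1) (X (p j)) : ℝ) : ℂ)) * K m)) ∧
      -- the fill probability, for every contour in the strip of convergence
      (∀ γ : ℝ, 0 < γ →
        (γ < 2 * Λ ∨
          (2 * Λ < γ ∧ (∀ᵐ ω ∂P, σ ω ≠ ⊤) ∧ LaplaceConverges f ((2 * Λ - γ : ℝ) : ℂ))) →
        Integrable (fun u : ℝ => fillTransform gHat (laplace f) Λ (γ + u * Complex.I)) ∧
        ((P.real (fillEvent N p i Z Q) : ℝ) : ℂ) =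
          inverseLaplace (fillTransform gHat (laplace f) Λ) γ 0) ∧
      -- the case in which no orders can be posted inside the spread
      (s₀ = 1 → ∀ s : ℂ,
        fillTransform gHat (laplace f) Λ s = 1 / s * gHat s * laplace f (-s)) := by
  intro j ε σ gHat
  have hp : p .bid < p .ask := by omega
  have hqi : q₀ i ≠ 0 := Nat.one_le_iff_ne_zero.1 (hq₀ i)
  have hqj : q₀ j ≠ 0 := Nat.one_le_iff_ne_zero.1 (hq₀ j)
  obtain ⟨g, hg⟩ := hbook.position.exists_isDensity hqi
  obtain ⟨f, hf⟩ := hbook.opposite.exists_isDensity hqj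
  have hlaplace : laplace f = laplaceMeasure (oppositeLaw X lam mu phi p q₀ i) :=
    hbook.opposite.laplace_eq_laplaceMeasure hf
  refine ⟨g, f, hg, hf, fun s hs => ?_, fun hlam hdeath s hs => ?_, fun γ hγ hcase => ?_,
    fun hs₀ s => ?_⟩
  · obtain ⟨hint, htransform⟩ := laplaceMeasure_firstPassageLaw_death hs
    refine ⟨(hbook.position.laplaceConverges_iff_integrable hg).2 hint, ?_⟩
    rw [hbook.position.laplace_eq_laplaceMeasure hg, htransform]
  · simp only [add_assoc]
    exact hbook.opposite.exists_tendsto_contFrac_laplace hf (hq₀ j) hlam hdeath hs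
  · rw [hlaplace]
    refine hbook.measureReal_fillEvent_eq_inverseLaplace hbid hask hp hq₀
      (insideRate_eq_two_mul hspread hΛask hΛbid) hγ (hcase.imp_right ?_)
    exact fun ⟨hΛγ, hfin, hconv⟩ => ⟨hΛγ, hfin, integrable_cexp_iff.1
      ((hbook.opposite.laplaceConverges_iff_integrable hf).1 hconv)⟩
  · have hΛ : Λ = 0 := by simpa [hs₀] using hΛask
    rw [hΛ, fillTransform_zero_rate]
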